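/- Let $D\subset\mathbb{Q}$ be a finite domain and let $\Gamma$ be a finite constraint language over $D$, i.e. a finite family of relations $R\subseteq D^{k_R}$. Suppose that $\Gamma$ is closed under the dual discriminator $\nabla$ on $D$ (the ternary operation with $\nabla(a,a,b)=\nabla(a,b,a)=\nabla(b,a,a)=a$ for all $a,b\in D$ and $\nabla(a,b,c)=a$ for pairwise distinct $a,b,c\in D$): applying $\nabla$ coordinatewise to any three tuples of a relation of $\Gamma$ gives a tuple of the same relation. For every relation $R$ of $\Gamma$ fix a polynomial $f_R\in\mathbb{Q}[y_1,\dots,y_{k_R}]$ that, on $D^{k_R}$, vanishes exactly at the tuples of $R$. For an instance $\mathcal{C}$ of $\mathrm{CSP}(\Gamma)$, that is, a finite set of constraints $R(x_{i_1},\dots,x_{i_{k_R}})$ with $R\in\Gamma$ on variables $x_1,\dots,x_n$, let $I_{\mathcal{C}}\subseteq\mathbb{Q}[x_1,\dots,x_n]$ be its combinatorial ideal, the vanishing ideal of its set of solutions in $D^n$. A Polynomial Calculus (PC) derivation from $\mathcal{C}$ is a sequence of polynomials each of which is a constraint polynomial $f_R(x_{i_1},\dots,x_{i_{k_R}})$ of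 $\mathcal{C}$, a domain polynomial $\prod_{\rho\in D}(x_j-\rho)$, a linear combination $af+bg$ ($a,b\in\mathbb{Q}$) of two earlier polynomials, or the product $x_jf$ of a variable with an earlier polynomial. Then PC computes the (full, not truncated) reduced Gröbner basis of $I_{\mathcal{C}}$ in graded lexicographic order, $x_1>\dots>x_n$, in time $n^{O(1)}$. That is, there are an algorithm (a random access machine program whose only arithmetic is addition and truncated subtraction) and a constant $c$, both depending only on $D$, $\Gamma$ and the polynomials $f_R$, such that for every $n$ and every instance $\mathcal{C}$ of $\mathrm{CSP}(\Gamma)$ on $n$ variables the algorithm, given $\mathcal{C}$, halts after at most $n^{c}+c$ steps and outputs a PC derivation from $\mathcal{C}$, of encoding length at most $n^c+c$ (polynomials being written as sums of terms, with reduced fractions in binary as coefficients), together with a list of polynomials occurring in this derivation that is exactly the reduced grlex Gröbner basis of $I_{\mathcal{C}}$. -/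

import Mathlib

noncomputable section

/-! ### Constraint languages, instances, polymorphisms -/

/-- A finite constraint language over the finite domain `D ⊆ ℚ`: a finite family of relations
`rel i ⊆ D ^ (arity i)`. -/
structure ConstraintLanguage (D : Finset ℚ) where
  size : ℕ
  arity : Fin size → ℕ
  rel : (i : Fin size) → Set (Fin (arity i) → D)

/-- An `m`-ary operation on `D` is a polymorphism of `Γ` if, applied coordinatewise to any `m`
tuples of a relation of `Γ`, it gives a tuple of the same relation. -/
def IsPolymorphism {D : Finset ℚ} (Γ : ConstraintLanguage D) {m : ℕ}
    (f : (Fin m → D) → D) : Prop :=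
  ∀ i, ∀ t : Fin m → (Fin (Γ.arity i) → D), (∀ l, t l ∈ Γ.rel i) →
    (fun j => f (fun l => t l j)) ∈ Γ.rel i

/-- A majority operation. -/
def IsMajority {D : Type} (f : D → D → D → D) : Prop :=
  ∀ a b, f a a b = a ∧ f a b a = a ∧ f b a a = a

/-- The dual discriminator: the majority operation which returns its first argument when the
three arguments are pairwise distinct. -/
def IsDualDiscriminator {D : Type} (f : D → D → D → D) : Prop :=
  IsMajority f ∧ ∀ a b c, a ≠ b → a ≠ c → b ≠ c → f a b c = a

/-- A constraint over `Γ` on the variables `x_0, …, x_{n-1}`: a relation of `Γ` and a tuple of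
variables (repetitions allowed). -/
structure Constraint {D : Finset ℚ} (Γ : ConstraintLanguage D) (n : ℕ) where
  rel : Fin Γ.size
  scope : Fin (Γ.arity rel) → Fin n

/-- An instance of `CSP(Γ)` on `n` variables: a set of constraints, listed in some order without
repetition. -/
structure CSPInstance {D : Finset ℚ} (Γ : ConstraintLanguage D) (n : ℕ) where
  constraints : List (Constraint Γ n)
  nodup : constraints.Nodup

/-- The set of solutions, as a set of points of `D ^ n ⊆ ℚ ^ n`. -/
def CSPInstance.sol {D : Finset ℚ} {Γ : ConstraintLanguage D} {n : ℕ} (𝒞 : CSPInstance Γ n) :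
    Set (Fin n → ℚ) :=
  {x | ∃ φ : Fin n → D, (∀ c ∈ 𝒞.constraints, (fun j => φ (c.scope j)) ∈ Γ.rel c.rel) ∧
    x = fun v => (φ v : ℚ)}

/-! ### Polynomials attached to an instance -/

/-- The combinatorial ideal of an instance: the vanishing ideal of its set of solutions. -/
def CSPInstance.combinatorialIdeal {D : Finset ℚ} {Γ : ConstraintLanguage D} {n : ℕ}
    (𝒞 : CSPInstance Γ n) : Ideal (MvPolynomial (Fin n) ℚ) :=
  MvPolynomial.vanishingIdeal ℚ 𝒞.sol

/-- The polynomials `f i` define the relations of `Γ`: on `D ^ (arity i)`, the polynomial `f i`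
vanishes exactly at the tuples of `rel i`. -/
def DefinesRelations {D : Finset ℚ} (Γ : ConstraintLanguage D)
    (f : (i : Fin Γ.size) → MvPolynomial (Fin (Γ.arity i)) ℚ) : Prop :=
  ∀ i, ∀ a : Fin (Γ.arity i) → D,
    MvPolynomial.eval (fun j => (a j : ℚ)) (f i) = 0 ↔ a ∈ Γ.rel i

/-- The constraint polynomials `f_R(x_{i_1}, …, x_{i_k})` of an instance. -/
def CSPInstance.constraintPolys {D : Finset ℚ} {Γ : ConstraintLanguage D} {n : ℕ}
    (𝒞 : CSPInstance Γ n) (f : (i : Fin Γ.size) → MvPolynomial (Fin (Γ.arity i)) ℚ) :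
    Set (MvPolynomial (Fin n) ℚ) :=
  {p | ∃ c ∈ 𝒞.constraints, p = MvPolynomial.rename c.scope (f c.rel)}

/-- The domain polynomial `∏_{ρ ∈ D} (x_v - ρ)`. -/
def domainPoly (D : Finset ℚ) {n : ℕ} (v : Fin n) : MvPolynomial (Fin n) ℚ :=
  ∏ ρ ∈ D, (MvPolynomial.X v - MvPolynomial.C ρ)

/-! ### Polynomial Calculus -/

/-- `π` is a Polynomial Calculus derivation from `P` over the domain `D`: every line is a member
of `P`, a domain polynomial, a linear combination of two earlier lines, or the product of a
variable with an earlier line. -/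
def IsPCDerivation (D : Finset ℚ) {n : ℕ} (P : Set (MvPolynomial (Fin n) ℚ))
    (π : List (MvPolynomial (Fin n) ℚ)) : Prop :=
  ∀ i : Fin π.length,
    π.get i ∈ P ∨
    (∃ v : Fin n, π.get i = domainPoly D v) ∨
    (∃ j < i, ∃ k < i, ∃ a b : ℚ,
      π.get i = MvPolynomial.C a * π.get j + MvPolynomial.C b * π.get k) ∨
    (∃ j < i, ∃ v : Fin n, π.get i = MvPolynomial.X v * π.get j)

/-! ### Reduced Gröbner bases in grlex order

`MonomialOrder.degLex` on `Fin n` compares total degrees first and breaks ties by the leftmost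
differing exponent, so `x_0 > x_1 > … > x_{n-1}`. -/

/-- `s` is a remainder of `r` on division by `G` in grlex order. -/
def IsGrlexRemainder {n : ℕ} (G : Set (MvPolynomial (Fin n) ℚ))
    (r s : MvPolynomial (Fin n) ℚ) : Prop :=
  (∃ h : G →₀ MvPolynomial (Fin n) ℚ,
    r = (h.sum fun g q => q * (g : MvPolynomial (Fin n) ℚ)) + s ∧
    ∀ g : G, MonomialOrder.degLex.toSyn (MonomialOrder.degLex.degree (h g * g.1)) ≤
      MonomialOrder.degLex.toSyn (MonomialOrder.degLex.degree r)) ∧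
  ∀ g ∈ G, g ≠ 0 → ∀ α ∈ s.support, ¬ MonomialOrder.degLex.degree g ≤ α

/-- `G` is a grlex Gröbner basis of `I`: it generates `I`, and a polynomial lies in `I` if and
only if its remainder on division by `G` is zero. -/
def IsGrlexGroebnerBasis {n : ℕ} (I : Ideal (MvPolynomial (Fin n) ℚ))
    (G : Set (MvPolynomial (Fin n) ℚ)) : Prop :=
  Ideal.span G = I ∧ ∀ r s, IsGrlexRemainder G r s → (r ∈ I ↔ s = 0)

/-- `G` is the reduced grlex Gröbner basis of `I`: a finite Gröbner basis whose members are monic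
and in which no monomial of a member is divisible by the leading monomial of another member. -/
def IsReducedGrlexGroebnerBasis {n : ℕ} (I : Ideal (MvPolynomial (Fin n) ℚ))
    (G : Set (MvPolynomial (Fin n) ℚ)) : Prop :=
  G.Finite ∧ IsGrlexGroebnerBasis I G ∧
  (∀ g ∈ G, MonomialOrder.degLex.leadingCoeff g = 1) ∧
  ∀ g ∈ G, ∀ h ∈ G, h ≠ g → ∀ α ∈ g.support, ¬ MonomialOrder.degLex.degree h ≤ α

/-! ### Binary encodings -/

/-- A polynomial written out as a sum of terms; a term is a rational coefficient together with
the list of the variables of the monomial (with multiplicity). -/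
abbrev SparsePoly (n : ℕ) := List (ℚ × List (Fin n))

/-- The polynomial that a sum of terms denotes. -/
def SparsePoly.toPoly {n : ℕ} (p : SparsePoly n) : MvPolynomial (Fin n) ℚ :=
  (p.map fun t => MvPolynomial.C t.1 * (t.2.map MvPolynomial.X).prod).sum

/-- Self-delimiting encoding of a list: each entry is preceded by `1`, and `0` ends the list. -/
def encodeList {α : Type} (e : α → List ℕ) (l : List α) : List ℕ :=
  l.flatMap (fun a => 1 :: e a) ++ [0]

/-- A natural number, by its binary digits. -/
def encodeNat (k : ℕ) : List ℕ := encodeList (fun b => [b]) (Nat.digits 2 k)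

/-- A rational number: sign, then numerator and denominator of the reduced fraction in binary. -/
def encodeRat (q : ℚ) : List ℕ :=
  (if q < 0 then 1 else 0) :: (encodeNat q.num.natAbs ++ encodeNat q.den)

/-- A polynomial, term by term. -/
def encodePoly {n : ℕ} (p : SparsePoly n) : List ℕ :=
  encodeList (fun t => encodeRat t.1 ++ encodeList (fun v : Fin n => [v.val]) t.2) p

/-- A list of polynomials. -/
def encodePolys {n : ℕ} (l : List (SparsePoly n)) : List ℕ := encodeList encodePoly l

/-- An instance of `CSP(Γ)`: the number of variables, then for each constraint the index of its
relation and its tuple of variables. -/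
def CSPInstance.encode {D : Finset ℚ} {Γ : ConstraintLanguage D} {n : ℕ}
    (𝒞 : CSPInstance Γ n) : List ℕ :=
  n :: encodeList (fun c : Constraint Γ n =>
    c.rel.val :: List.ofFn (fun j => (c.scope j).val)) 𝒞.constraints

/-! ### Random access machines

The memory consists of arrays of natural numbers: `s a i` is the `i`-th cell of array number `a`.
A program names finitely many arrays; the index into an array is computed at run time. Addition
and truncated subtraction are the only arithmetic, so the number of executed instructions is
polynomially related to the running time of a Turing machine. -/

namespace RAM

abbrev Memory := ℕ → ℕ → ℕ

inductive Expr where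
  | const : ℕ → Expr
  | read : ℕ → Expr → Expr
  | add : Expr → Expr → Expr
  | sub : Expr → Expr → Expr

def Expr.eval (s : Memory) : Expr → ℕ
  | .const k => k
  | .read a i => s a (i.eval s)
  | .add e₁ e₂ => e₁.eval s + e₂.eval s
  | .sub e₁ e₂ => e₁.eval s - e₂.eval s

/-- Programs: `assign a i e` is `a[i] := e`; `ite e p q` runs `p` if `e ≠ 0` and `q` otherwise;
`loop e p` repeats `p` as long as `e ≠ 0`. -/
inductive Prog where
  | assign : ℕ → Expr → Expr → Prog
  | seq : Prog → Prog → Prog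
  | ite : Expr → Prog → Prog → Prog
  | loop : Expr → Prog → Prog

/-- The memory after the instruction `a[i] := x`. -/
def Memory.write (s : Memory) (a i x : ℕ) : Memory :=
  Function.update s a (Function.update (s a) i x)

/-- `Runs p s s' t`: started in memory `s`, the program `p` halts in memory `s'` after executing
exactly `t` assignments and tests. -/
inductive Runs : Prog → Memory → Memory → ℕ → Prop where
  | assign (a : ℕ) (i e : Expr) (s : Memory) :
      Runs (.assign a i e) s (s.write a (i.eval s) (e.eval s)) 1
  | seq {p q : Prog} {s s' s'' : Memory} {t t' : ℕ} :
      Runs p s s' t → Runs q s' s'' t' → Runs (.seq p q) s s'' (t + t')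
  | ite_true {e : Expr} {p q : Prog} {s s' : Memory} {t : ℕ} :
      e.eval s ≠ 0 → Runs p s s' t → Runs (.ite e p q) s s' (t + 1)
  | ite_false {e : Expr} {p q : Prog} {s s' : Memory} {t : ℕ} :
      e.eval s = 0 → Runs q s s' t → Runs (.ite e p q) s s' (t + 1)
  | loop_true {e : Expr} {p : Prog} {s s' s'' : Memory} {t t' : ℕ} :
      e.eval s ≠ 0 → Runs p s s' t → Runs (.loop e p) s' s'' t' →
      Runs (.loop e p) s s'' (t + t' + 1)
  | loop_false {e : Expr} {p : Prog} {s : Memory} :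
      e.eval s = 0 → Runs (.loop e p) s s 1

/-- The initial memory: the input in array `0`, zeros elsewhere. -/
def initial (input : List ℕ) : Memory :=
  fun a i => if a = 0 then input.getD i 0 else 0

/-- On the given input, `p` halts after at most `T` steps with the given output (padded with
zeros) in array `1`. -/
def OutputsInTime (p : Prog) (input output : List ℕ) (T : ℕ) : Prop :=
  ∃ s' t, Runs p (initial input) s' t ∧ t ≤ T ∧ ∀ i, s' 1 i = output.getD i 0

end RAM

/-! ### Computing a Gröbner basis by Polynomial Calculus -/

/-- The program `p` computes, by Polynomial Calculus from the constraint and domain polynomials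
of `𝒞`, the reduced grlex Gröbner basis of the combinatorial ideal of `𝒞` in time `T`: it outputs
a PC derivation `π` and a list `G` of lines of `π` which is that basis. The length of the output,
and with it the bit size of the derivation, is bounded by `T` as well. -/
def PCComputesReducedGroebnerBasis {D : Finset ℚ} {Γ : ConstraintLanguage D} {n : ℕ}
    (f : (i : Fin Γ.size) → MvPolynomial (Fin (Γ.arity i)) ℚ) (p : RAM.Prog)
    (𝒞 : CSPInstance Γ n) (T : ℕ) : Prop :=
  ∃ π G : List (SparsePoly n),
    RAM.OutputsInTime p 𝒞.encode (encodePolys π ++ encodePolys G) T ∧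
    (encodePolys π ++ encodePolys G).length ≤ T ∧
    IsPCDerivation D (𝒞.constraintPolys f) (π.map SparsePoly.toPoly) ∧
    (∀ g ∈ G, g.toPoly ∈ π.map SparsePoly.toPoly) ∧
    IsReducedGrlexGroebnerBasis 𝒞.combinatorialIdeal {q | ∃ g ∈ G, q = g.toPoly}

end

/-! Everything about the reduced basis can be decided on tuples of `K` variables, where `K` depends
only on `D`.

Structure. The dual discriminator forces the projection of the solution set `S` to two coordinates
to be a bijection, a product, or a fan `{p} × B ∪ A × {q}` (`pair_cases`). Coordinates related by a
bijection form blocks. The leading monomials of the vanishing ideal are generated by those of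
members living on a single block and of members `(x_i - p)(x_j - q)` (`exists_isLocalElem_le`). The
core is `eq_zero_of_isStd`, which strips a polynomial of one block at a time, using that a solution
can be changed freely on a block once the fan partners are moved to fixed values (`exists_mix`). On
a block all coordinates are functions of one value in `D`, so at most `|D|` of them are linearly
independent; hence a basis element has at most `|D| + 2` variables (`IsReducedIn.card_vars_le`).

Locality. By this bound, reducedness in the ideal only has to be tested against tuples of length `K`
(`isReducedIn_iff_forall`), and on a given tuple it depends only on the order of the variables and
on the projection of `S` (`Realizes.isReducedIn`). There are finitely many such patterns, each with
finitely many candidates (`exists_candidates`). The candidates, the tests and the derivations are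
therefore finite tables, obtained by classical choice and built into the program.

Projections. A table of excluded pairs of values is saturated by inferences on `K`-tuples. The
majority property turns this local consistency into global consistency
(`PairClosure.exists_global`), so a saturated table describes all projections of `S` to nonempty
tuples, provided that no constraint has an empty relation (`image_solSet_eq_localSols`). For each
pattern the inferences have one fixed PC derivation, which exists by the Nullstellensatz on the grid
(`mem_span_of_vanishing`, `exists_template`) and is printed with renamed variables. At most `n²
|D|²` pairs can be excluded, so polynomially many rounds over all `n ^ K` tuples suffice. A last
round derives the candidates for the final patterns, and those that pass every test are the basis.
-/

open MvPolynomial RAM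

/-! ### Relations closed under a majority operation -/

/-- A set of functions closed under a ternary operation applied coordinatewise. -/
def ClosedUnder {A ι : Type} (f : A → A → A → A) (S : Set (ι → A)) : Prop :=
  ∀ φ ∈ S, ∀ ψ ∈ S, ∀ χ ∈ S, (fun v => f (φ v) (ψ v) (χ v)) ∈ S

/-- A set closed under a majority operation is determined by its projections to pairs of
coordinates. -/
theorem ClosedUnder.mem_of_pairs {A ι : Type} [Fintype ι] {f : A → A → A → A}
    (hf : IsMajority f) {S : Set (ι → A)} (hS : ClosedUnder f S) (hne : S.Nonempty) (a : ι → A)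
    (h : ∀ i j, ∃ t ∈ S, t i = a i ∧ t j = a j) : a ∈ S := by
  classical
  have key : ∀ k : ℕ, ∀ T : Finset ι, T.card = k → ∃ t ∈ S, ∀ i ∈ T, t i = a i := by
    intro k
    induction k using Nat.strong_induction_on with
    | _ k ih =>
      intro T hT
      by_cases hc : 2 < T.card
      · obtain ⟨x, hx, y, hy, z, hz, hxy, hxz, hyz⟩ := Finset.two_lt_card.1 hc
        have hlt : ∀ w ∈ T, (T.erase w).card < k := fun w hw => by
          rw [← hT]; exact Finset.card_erase_lt_of_mem hw
        obtain ⟨t₁, h₁, e₁⟩ := ih _ (hlt x hx) (T.erase x) rfl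
        obtain ⟨t₂, h₂, e₂⟩ := ih _ (hlt y hy) (T.erase y) rfl
        obtain ⟨t₃, h₃, e₃⟩ := ih _ (hlt z hz) (T.erase z) rfl
        -- The Baker–Pixley argument: each of the three members may fail at one coordinate only, and
        -- these coordinates are distinct, so at every point of `T` two of the three agree with `a`.
        refine ⟨_, hS t₁ h₁ t₂ h₂ t₃ h₃, fun i hi => ?_⟩
        simp only [Finset.mem_erase, ne_eq, and_imp] at e₁ e₂ e₃
        by_cases ix : i = x
        · subst ix
          simp only [e₂ i hxy hi, e₃ i hxz hi, (hf _ _).2.2]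
        · by_cases iy : i = y
          · subst iy
            simp only [e₁ i ix hi, e₃ i hyz hi, (hf _ _).2.1]
          · simp only [e₁ i ix hi, e₂ i iy hi, (hf _ _).1]
      · have h3 : T.card = 0 ∨ T.card = 1 ∨ T.card = 2 := by omega
        rcases h3 with h0 | h1 | h2
        · obtain ⟨t, ht⟩ := hne
          refine ⟨t, ht, ?_⟩
          simp [Finset.card_eq_zero.1 h0]
        · obtain ⟨i, rfl⟩ := Finset.card_eq_one.1 h1
          obtain ⟨t, ht, hi, -⟩ := h i i
          exact ⟨t, ht, by simpa using hi⟩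
        · obtain ⟨i, j, -, rfl⟩ := Finset.card_eq_two.1 h2
          obtain ⟨t, ht, hi, hj⟩ := h i j
          exact ⟨t, ht, by simp [hi, hj]⟩
  obtain ⟨t, ht, e⟩ := key _ Finset.univ rfl
  rwa [show a = t from funext fun i => (e i (Finset.mem_univ i)).symm]

/-! ### Normal forms and reduced elements of a space of polynomials -/

open MonomialOrder in
/-- The leading monomial in grlex order. -/
noncomputable abbrev lm {n : ℕ} (g : MvPolynomial (Fin n) ℚ) : Fin n →₀ ℕ :=
  degLex.degree g

noncomputable abbrev syn {n : ℕ} (α : Fin n →₀ ℕ) : (MonomialOrder.degLex (σ := Fin n)).syn :=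
  MonomialOrder.degLex.toSyn α

section NormalForm

variable {n : ℕ} (V : Submodule ℚ (MvPolynomial (Fin n) ℚ))

theorem syn_inj {α β : Fin n →₀ ℕ} : syn α = syn β ↔ α = β :=
  MonomialOrder.degLex.toSyn.injective.eq_iff

theorem syn_mono {α β : Fin n →₀ ℕ} (h : α ≤ β) : syn α ≤ syn β :=
  MonomialOrder.degLex.toSyn_monotone h

theorem coeff_lm_ne_zero {g : MvPolynomial (Fin n) ℚ} (hg : g ≠ 0) : g.coeff (lm g) ≠ 0 :=
  MonomialOrder.degLex.coeff_degree_ne_zero_iff.2 hg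

/-- Division by a mere linear space: a leading term is cancelled if some member of `V` has the same
leading monomial, and is otherwise set aside into the remainder. The order is a well-order, so this
ends; the bound `s` later keeps the remainder of a tail below the leading monomial. -/
theorem exists_normalForm_lt (s : (MonomialOrder.degLex (σ := Fin n)).syn) :
    ∀ p : MvPolynomial (Fin n) ℚ, (∀ α ∈ p.support, syn α < s) →
      ∃ r, p - r ∈ V ∧ (∀ h ∈ V, h ≠ 0 → lm h ∉ r.support) ∧ ∀ α ∈ r.support, syn α < s := by
  induction s using WellFoundedLT.induction with
  | _ s ih =>
    intro p hp
    by_cases hp0 : p = 0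
    · exact ⟨0, by simp [hp0], by simp, by simp⟩
    have hm : syn (lm p) < s := hp _ (MonomialOrder.degLex.degree_mem_support hp0)
    have hle : ∀ α, p.coeff α ≠ 0 → syn α ≤ syn (lm p) := fun α hα =>
      MonomialOrder.degLex.le_degree (mem_support_iff.2 hα)
    by_cases hV : ∃ h ∈ V, h ≠ 0 ∧ lm h = lm p
    · obtain ⟨h, hh, h0, hlm⟩ := hV
      have hc : h.coeff (lm p) ≠ 0 := by
        rw [← hlm]; exact coeff_lm_ne_zero h0
      obtain ⟨r, h₁, h₂, h₃⟩ := ih _ hm (p - (p.coeff (lm p) / h.coeff (lm p)) • h) (by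
        intro α hα
        rw [mem_support_iff, coeff_sub, coeff_smul, smul_eq_mul] at hα
        have hne : α ≠ lm p := by
          rintro rfl
          apply hα
          field_simp
          ring
        refine lt_of_le_of_ne ?_ (fun e => hne (syn_inj.1 e))
        by_contra hcon
        have e₁ : p.coeff α = 0 := by
          by_contra e; exact hcon (hle α e)
        have e₂ : h.coeff α = 0 := by
          by_contra e
          apply hcon
          rw [← hlm]
          exact MonomialOrder.degLex.le_degree (mem_support_iff.2 e)
        simp [e₁, e₂] at hα)
      refine ⟨r, ?_, h₂, fun α hα => (h₃ α hα).trans hm⟩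
      have := V.add_mem h₁ (V.smul_mem (p.coeff (lm p) / h.coeff (lm p)) hh)
      convert this using 1
      ring
    · push Not at hV
      obtain ⟨r, h₁, h₂, h₃⟩ := ih _ hm (p - monomial (lm p) (p.coeff (lm p))) (by
        intro α hα
        rw [mem_support_iff, coeff_sub, coeff_monomial] at hα
        split_ifs at hα with h
        · subst h; simp at hα
        · rw [sub_zero] at hα
          exact lt_of_le_of_ne (hle α hα) (fun e => h (syn_inj.1 e).symm))
      refine ⟨r + monomial (lm p) (p.coeff (lm p)), ?_, ?_, ?_⟩
      · convert h₁ using 1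
        ring
      · intro h hh h0 hmem
        have hr := h₂ h hh h0
        rw [mem_support_iff, coeff_add, coeff_monomial, if_neg (fun e => hV h hh h0 e.symm),
          add_zero, ← mem_support_iff] at hmem
        exact hr hmem
      · intro α hα
        by_cases e : lm p = α
        · rwa [← e]
        · rw [mem_support_iff, coeff_add, coeff_monomial, if_neg e, add_zero,
            ← mem_support_iff] at hα
          exact (h₃ α hα).trans hm

/-- `g` is a monic element of `V` whose other monomials are not leading monomials of `V`. -/
def IsTailReduced (g : MvPolynomial (Fin n) ℚ) : Prop :=
  g ∈ V ∧ g.coeff (lm g) = 1 ∧ ∀ α ∈ g.support, α ≠ lm g → ∀ h ∈ V, h ≠ 0 → lm h ≠ α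

/-- After scaling, everything below the leading term is replaced by its normal form, which stays
below it. -/
theorem exists_isTailReduced {h : MvPolynomial (Fin n) ℚ} (hV : h ∈ V) (h0 : h ≠ 0) :
    ∃ g, IsTailReduced V g ∧ lm g = lm h := by
  have hc := coeff_lm_ne_zero h0
  obtain ⟨r, h₁, h₂, h₃⟩ := exists_normalForm_lt V (syn (lm h))
    ((h.coeff (lm h))⁻¹ • h - monomial (lm h) 1) (by
      intro α hα
      rw [mem_support_iff, coeff_sub, coeff_smul, smul_eq_mul, coeff_monomial] at hα
      split_ifs at hα with e
      · subst e; simp [hc] at hα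
      · rw [sub_zero] at hα
        refine lt_of_le_of_ne (MonomialOrder.degLex.le_degree (mem_support_iff.2 ?_))
          (fun e' => e (syn_inj.1 e').symm)
        exact right_ne_zero_of_mul hα)
  have hr : r.coeff (lm h) = 0 := by
    by_contra e
    exact lt_irrefl _ (h₃ _ (mem_support_iff.2 e))
  have hg1 : (monomial (lm h) 1 + r).coeff (lm h) = 1 := by simp [hr]
  have hlm : lm (monomial (lm h) 1 + r) = lm h := by
    apply syn_inj.1
    apply le_antisymm
    · apply MonomialOrder.degLex.degree_le_iff.2
      intro α hα
      by_cases e : lm h = α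
      · rw [← e]
      · rw [mem_support_iff, coeff_add, coeff_monomial, if_neg e, zero_add,
            ← mem_support_iff] at hα
        exact (h₃ α hα).le
    · exact MonomialOrder.degLex.le_degree (mem_support_iff.2 (by rw [hg1]; exact one_ne_zero))
  refine ⟨monomial (lm h) 1 + r, ⟨?_, by rw [hlm, hg1], ?_⟩, hlm⟩
  · convert V.sub_mem (V.smul_mem (h.coeff (lm h))⁻¹ hV) h₁ using 1
    ring
  · intro α hα hne f hf f0 e
    rw [hlm] at hne
    rw [mem_support_iff, coeff_add, coeff_monomial, if_neg (Ne.symm hne), zero_add,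
            ← mem_support_iff] at hα
    exact h₂ f hf f0 (e ▸ hα)

theorem IsTailReduced.ne_zero {V : Submodule ℚ (MvPolynomial (Fin n) ℚ)}
    {g : MvPolynomial (Fin n) ℚ} (hg : IsTailReduced V g) : g ≠ 0 := by
  rintro rfl
  simpa using hg.2.1

/-- A nonzero difference would belong to `V` and have its leading monomial in one of the two tails.
This uniqueness identifies a basis element with a polynomial found elsewhere, on one block or from
another instance with the same pattern. -/
theorem IsTailReduced.eq {V : Submodule ℚ (MvPolynomial (Fin n) ℚ)}
    {g g' : MvPolynomial (Fin n) ℚ} (hg : IsTailReduced V g) (hg' : IsTailReduced V g')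
    (h : lm g = lm g') : g = g' := by
  by_contra hne
  have h0 : g - g' ≠ 0 := sub_ne_zero.2 hne
  have hV := V.sub_mem hg.1 hg'.1
  have hc := coeff_lm_ne_zero h0
  have hm : lm (g - g') ≠ lm g := by
    intro e
    rw [e, coeff_sub, hg.2.1, h, hg'.2.1] at hc
    simp at hc
  by_cases e : g.coeff (lm (g - g')) = 0
  · refine hg'.2.2 (lm (g - g')) (mem_support_iff.2 ?_) (h ▸ hm) _ hV h0 rfl
    intro e'
    rw [coeff_sub, e, e'] at hc
    simp at hc
  · exact hg.2.2 _ (mem_support_iff.2 e) hm _ hV h0 rfl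

/-- `g` is a monic element of `V` and no leading monomial of `V` divides a monomial of `g`, except
that the leading monomial of `g` divides itself. -/
def IsReducedIn (g : MvPolynomial (Fin n) ℚ) : Prop :=
  g ∈ V ∧ g.coeff (lm g) = 1 ∧
    ∀ h ∈ V, h ≠ 0 → ∀ α ∈ g.support, lm h ≤ α → α = lm g ∧ lm h = lm g

theorem IsReducedIn.isTailReduced {V : Submodule ℚ (MvPolynomial (Fin n) ℚ)}
    {g : MvPolynomial (Fin n) ℚ} (hg : IsReducedIn V g) : IsTailReduced V g :=
  ⟨hg.1, hg.2.1, fun α hα hne h hh h0 e => hne (hg.2.2 h hh h0 α hα e.le).1⟩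

/-- A smaller space has fewer leading monomials to avoid. This allows the passage from the ideal to
its members in a few variables. -/
theorem IsReducedIn.mono {V W : Submodule ℚ (MvPolynomial (Fin n) ℚ)} (hVW : V ≤ W)
    {g : MvPolynomial (Fin n) ℚ} (hg : IsReducedIn W g) (hV : g ∈ V) : IsReducedIn V g :=
  ⟨hV, hg.2.1, fun h hh => hg.2.2 h (hVW hh)⟩

theorem exists_mem_lm_eq (I : Ideal (MvPolynomial (Fin n) ℚ)) {k : MvPolynomial (Fin n) ℚ}
    (hk : k ∈ I) (k0 : k ≠ 0) {α : Fin n →₀ ℕ} (hα : lm k ≤ α) :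
    ∃ k' ∈ I, k' ≠ 0 ∧ lm k' = α := by
  have hX : (monomial (α - lm k) (1 : ℚ)) ≠ 0 := by simp
  refine ⟨monomial (α - lm k) 1 * k, I.mul_mem_left _ hk, mul_ne_zero hX k0, ?_⟩
  rw [lm, MonomialOrder.degree_mul hX k0, MonomialOrder.degree_monomial,
    if_neg one_ne_zero]
  exact tsub_add_cancel_of_le hα

/-- Every leading monomial of an ideal is divisible by that of a reduced element. -/
theorem exists_isReducedIn_le (I : Ideal (MvPolynomial (Fin n) ℚ)) {h : MvPolynomial (Fin n) ℚ}
    (hI : h ∈ I) (h0 : h ≠ 0) : ∃ g, IsReducedIn (I.restrictScalars ℚ) g ∧ lm g ≤ lm h := by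
  -- A grlex-least leading monomial among those dividing `lm h` is also minimal for divisibility,
  -- because proper divisors are smaller in the order.
  obtain ⟨s, ⟨f, hf, f0, hle, rfl⟩, hmin⟩ := WellFounded.has_min
    (wellFounded_lt (α := (MonomialOrder.degLex (σ := Fin n)).syn))
    {s | ∃ f ∈ I, f ≠ 0 ∧ lm f ≤ lm h ∧ syn (lm f) = s} ⟨_, h, hI, h0, le_rfl, rfl⟩
  obtain ⟨g, hg, hgf⟩ := exists_isTailReduced (I.restrictScalars ℚ) (h := f) hf f0
  refine ⟨g, ⟨hg.1, hg.2.1, ?_⟩, hgf ▸ hle⟩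
  intro k hk k0 α hα hkα
  have hα' : α = lm g := by
    by_contra hne
    obtain ⟨k', hk', k0', e⟩ := exists_mem_lm_eq I hk k0 hkα
    exact hg.2.2 α hα hne k' hk' k0' e
  refine ⟨hα', ?_⟩
  subst hα'
  rw [hgf] at hkα ⊢
  have := hmin _ ⟨k, hk, k0, hkα.trans hle, rfl⟩
  exact syn_inj.1 (le_antisymm (syn_mono hkα) (not_lt.1 this))

/-- The reduced elements of an ideal form its reduced Gröbner basis. -/
theorem isReducedGrlexGroebnerBasis_of_forall (I : Ideal (MvPolynomial (Fin n) ℚ))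
    (G : Set (MvPolynomial (Fin n) ℚ)) (hfin : G.Finite)
    (hG : ∀ g, g ∈ G ↔ IsReducedIn (I.restrictScalars ℚ) g) :
    IsReducedGrlexGroebnerBasis I G := by
  have hsub : G ⊆ I := fun g hg => ((hG g).1 hg).1
  have hspan : Ideal.span G = I := by
    apply le_antisymm (Ideal.span_le.2 hsub)
    intro r hr
    by_contra hr'
    -- Take a member of `I` outside the span with least leading monomial; cancelling its leading
    -- term by a multiple of a reduced element gives a smaller one.
    obtain ⟨s, ⟨f, hf, hf', rfl⟩, hmin⟩ := WellFounded.has_min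
      (wellFounded_lt (α := (MonomialOrder.degLex (σ := Fin n)).syn))
      {s | ∃ f ∈ I, f ∉ Ideal.span G ∧ syn (lm f) = s} ⟨_, r, hr, hr', rfl⟩
    have f0 : f ≠ 0 := by
      rintro rfl
      exact hf' (Ideal.zero_mem _)
    obtain ⟨g, hg, hle⟩ := exists_isReducedIn_le I hf f0
    obtain ⟨k, hk, k0, hkf⟩ := exists_mem_lm_eq (Ideal.span G)
      (Ideal.subset_span ((hG g).2 hg)) hg.isTailReduced.ne_zero hle
    have hc : k.coeff (lm f) ≠ 0 := by
      rw [← hkf]; exact coeff_lm_ne_zero k0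
    set f' := f - C (f.coeff (lm f) / k.coeff (lm f)) * k with hf'def
    have hmem : C (f.coeff (lm f) / k.coeff (lm f)) * k ∈ Ideal.span G :=
      Ideal.mul_mem_left _ _ hk
    have hnot : f' ∉ Ideal.span G := fun h => hf' (by
      have := Ideal.add_mem _ h hmem
      rwa [hf'def, sub_add_cancel] at this)
    have f0' : f' ≠ 0 := by
      intro h
      exact hnot (h ▸ Ideal.zero_mem _)
    apply hmin _ ⟨f', I.sub_mem hf (Ideal.span_le.2 hsub hmem), hnot, rfl⟩
    have hcf := coeff_lm_ne_zero f0'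
    refine lt_of_le_of_ne ?_ ?_
    · by_contra hcon
      apply hcf
      rw [hf'def, coeff_sub, coeff_C_mul, ← hf'def,
        MonomialOrder.degLex.coeff_eq_zero_of_lt (not_le.1 hcon),
        MonomialOrder.degLex.coeff_eq_zero_of_lt (f := k) (d := lm f') (by
          have h := not_le.1 hcon
          rwa [← hkf] at h)]
      simp
    · intro e
      apply hcf
      rw [syn_inj.1 e, hf'def, coeff_sub, coeff_C_mul]
      field_simp
      ring
  refine ⟨hfin, ⟨hspan, ?_⟩, fun g hg => ((hG g).1 hg).2.1, ?_⟩
  · rintro r s ⟨⟨h, hr, -⟩, hs⟩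
    have hsum : (h.sum fun g q => q * (g : MvPolynomial (Fin n) ℚ)) ∈ I :=
      I.sum_mem fun g _ => I.mul_mem_left _ (hsub g.2)
    constructor
    · intro hrI
      by_contra s0
      have hsI : s ∈ I := by
        rw [hr] at hrI
        exact (Ideal.add_mem_iff_right _ hsum).1 hrI
      obtain ⟨g, hg, hle⟩ := exists_isReducedIn_le I hsI s0
      exact hs g ((hG g).2 hg) hg.isTailReduced.ne_zero _
        (MonomialOrder.degLex.degree_mem_support s0) hle
    · rintro rfl
      rw [hr, add_zero]
      exact hsum
  · intro g hg h hh hne α hα hle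
    have hg' := (hG g).1 hg
    have hh' := (hG h).1 hh
    have := hg'.2.2 h hh'.1 hh'.isTailReduced.ne_zero α hα hle
    exact hne (hh'.isTailReduced.eq hg'.isTailReduced this.2)

end NormalForm

/-! ### Binary projections of sets closed under the dual discriminator -/

section Binary

variable {A : Type} {f : A → A → A → A} {ρ : A → A → Prop}

/-- Apply the operation to `(c, e)`, `(a, b)`, `(a, b')`: majority puts `a` in the first place, and
the second place keeps `e` if it differs from both `b` and `b'`. Thus a row with two entries
contains every column that occurs. Only here is the value on distinct arguments used; all else needs
majority alone. -/
theorem IsDualDiscriminator.row (hf : IsDualDiscriminator f)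
    (hρ : ∀ a b a' b' a'' b'', ρ a b → ρ a' b' → ρ a'' b'' → ρ (f a a' a'') (f b b' b''))
    {a b b' : A} (hb : b ≠ b') (h : ρ a b) (h' : ρ a b') {c e : A} (hce : ρ c e) : ρ a e := by
  have := hρ _ _ _ _ _ _ hce h h'
  rw [(hf.1 a c).2.2] at this
  by_cases e₁ : e = b
  · rwa [e₁]
  by_cases e₂ : e = b'
  · rwa [e₂]
  rwa [hf.2 e b b' e₁ e₂ hb] at this

/-- The row of `a` is complete by `row`. If a second row has two entries, it is complete too, so
every column has two entries and is complete by symmetry: a product. Otherwise every other row has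
one entry `e`; its column already contains `a`, so it is complete, giving a fan with `p = a` and `q
= e`, or there is no other row. -/
theorem IsDualDiscriminator.full_or_fan (hf : IsDualDiscriminator f)
    (hρ : ∀ a b a' b' a'' b'', ρ a b → ρ a' b' → ρ a'' b'' → ρ (f a a' a'') (f b b' b''))
    {a b b' : A} (hb : b ≠ b') (h : ρ a b) (h' : ρ a b') :
    (∀ x y x' y', ρ x y → ρ x' y' → ρ x y') ∨
    ∃ p q, (∀ x y, ρ x y → x = p ∨ y = q) ∧ (∀ x y, ρ x y → ρ p y) ∧
      ∀ x y, ρ x y → ρ x q := by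
  have hcol : ∀ {a b b' : A}, b ≠ b' → ρ b a → ρ b' a → ∀ {c e : A}, ρ c e → ρ c a :=
    fun hb h h' _ _ hce => hf.row (ρ := fun x y => ρ y x)
      (fun a b a' b' a'' b'' h₁ h₂ h₃ => hρ _ _ _ _ _ _ h₁ h₂ h₃) hb h h' hce
  have hrow : ∀ {c e : A}, ρ c e → ρ a e := fun hce => hf.row hρ hb h h' hce
  by_cases h2 : ∃ a', a' ≠ a ∧ ∃ b b', b ≠ b' ∧ ρ a' b ∧ ρ a' b'
  · obtain ⟨a', ha, d, d', hd, g, g'⟩ := h2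
    left
    intro x y x' y' hxy hxy'
    exact hcol ha (hf.row hρ hd g g' hxy') (hrow hxy') hxy
  · by_cases h3 : ∃ c e, c ≠ a ∧ ρ c e
    · obtain ⟨c, e, hc, hce⟩ := h3
      have hce' : ∀ x y, ρ x y → ρ x e := fun x y hxy => hcol hc hce (hrow hce) hxy
      refine Or.inr ⟨a, e, fun x y hxy => ?_, fun x y hxy => hrow hxy, hce'⟩
      by_contra hcon
      push Not at hcon
      exact h2 ⟨x, hcon.1, y, e, hcon.2, hxy, hce' x y hxy⟩
    · left
      intro x y x' y' hxy hxy'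
      have : x = a := by
        by_contra hx
        exact h3 ⟨x, y, hx, hxy⟩
      subst this
      exact hrow hxy'

end Binary

/-! ### Blocks, independent pairs and fans of coordinates -/

section Pairs

variable {D : Finset ℚ} {n : ℕ}

/-- On `S`, the values at `i` and at `j` determine each other. -/
def SameBlock (S : Set (Fin n → D)) (i j : Fin n) : Prop :=
  ∀ φ ∈ S, ∀ ψ ∈ S, φ i = ψ i ↔ φ j = ψ j

/-- On `S`, the values at `i` and at `j` are independent. -/
def IsFull (S : Set (Fin n → D)) (i j : Fin n) : Prop :=
  ∀ φ ∈ S, ∀ ψ ∈ S, ∃ χ ∈ S, χ i = φ i ∧ χ j = ψ j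

/-- The projection of `S` to the coordinates `i` and `j` is `{p} × B ∪ A × {q}`. -/
def IsFan (S : Set (Fin n → D)) (i j : Fin n) (p q : D) : Prop :=
  (∀ χ ∈ S, χ i = p ∨ χ j = q) ∧ (∀ φ ∈ S, ∃ χ ∈ S, χ i = p ∧ χ j = φ j) ∧
    ∀ φ ∈ S, ∃ χ ∈ S, χ i = φ i ∧ χ j = q

/-- If the values at the two coordinates do not determine each other, some value on one side has two
partners on the other, and `full_or_fan` applies to the projection or to its transpose. -/
theorem pair_cases {nabla : D → D → D → D} (hf : IsDualDiscriminator nabla)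
    {S : Set (Fin n → D)} (hS : ClosedUnder nabla S) (i j : Fin n) :
    SameBlock S i j ∨ IsFull S i j ∨ ∃ p q, IsFan S i j p q := by
  by_cases hB : SameBlock S i j
  · exact Or.inl hB
  right
  have hne : ∃ φ ∈ S, ∃ ψ ∈ S, (φ i = ψ i ∧ φ j ≠ ψ j) ∨ (φ j = ψ j ∧ φ i ≠ ψ i) := by
    by_contra hcon
    push Not at hcon
    exact hB fun φ hφ ψ hψ => ⟨fun h => (hcon φ hφ ψ hψ).1 h, fun h => (hcon φ hφ ψ hψ).2 h⟩
  obtain ⟨φ, hφ, ψ, hψ, ⟨h₁, h₂⟩ | ⟨h₁, h₂⟩⟩ := hne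
  · have hρ : ∀ a b a' b' a'' b'', (∃ χ ∈ S, χ i = a ∧ χ j = b) → (∃ χ ∈ S, χ i = a' ∧ χ j = b') →
        (∃ χ ∈ S, χ i = a'' ∧ χ j = b'') →
        ∃ χ ∈ S, χ i = nabla a a' a'' ∧ χ j = nabla b b' b'' := by
      rintro _ _ _ _ _ _ ⟨x, hx, rfl, rfl⟩ ⟨y, hy, rfl, rfl⟩ ⟨z, hz, rfl, rfl⟩
      exact ⟨_, hS x hx y hy z hz, rfl, rfl⟩
    rcases hf.full_or_fan (ρ := fun a b => ∃ χ ∈ S, χ i = a ∧ χ j = b) hρ h₂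
      ⟨φ, hφ, rfl, rfl⟩ ⟨ψ, hψ, h₁.symm, rfl⟩ with h | ⟨p, q, ha, hb, hc⟩
    · left
      intro x hx y hy
      exact h _ _ _ _ ⟨x, hx, rfl, rfl⟩ ⟨y, hy, rfl, rfl⟩
    · exact Or.inr ⟨p, q, fun x hx => ha _ _ ⟨x, hx, rfl, rfl⟩,
        fun x hx => hb _ _ ⟨x, hx, rfl, rfl⟩, fun x hx => hc _ _ ⟨x, hx, rfl, rfl⟩⟩
  · have hρ : ∀ a b a' b' a'' b'', (∃ χ ∈ S, χ i = b ∧ χ j = a) → (∃ χ ∈ S, χ i = b' ∧ χ j = a') →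
        (∃ χ ∈ S, χ i = b'' ∧ χ j = a'') →
        ∃ χ ∈ S, χ i = nabla b b' b'' ∧ χ j = nabla a a' a'' := by
      rintro _ _ _ _ _ _ ⟨x, hx, rfl, rfl⟩ ⟨y, hy, rfl, rfl⟩ ⟨z, hz, rfl, rfl⟩
      exact ⟨_, hS x hx y hy z hz, rfl, rfl⟩
    rcases hf.full_or_fan (ρ := fun a b => ∃ χ ∈ S, χ i = b ∧ χ j = a) hρ h₂
      ⟨φ, hφ, rfl, rfl⟩ ⟨ψ, hψ, rfl, h₁.symm⟩ with h | ⟨p, q, ha, hb, hc⟩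
    · left
      intro x hx y hy
      exact h _ _ _ _ ⟨y, hy, rfl, rfl⟩ ⟨x, hx, rfl, rfl⟩
    · exact Or.inr ⟨q, p, fun x hx => (ha _ _ ⟨x, hx, rfl, rfl⟩).symm,
        fun x hx => hc _ _ ⟨x, hx, rfl, rfl⟩, fun x hx => hb _ _ ⟨x, hx, rfl, rfl⟩⟩

open Classical in
/-- Around a coordinate `i`, one point of `S` can be changed on the block of `i` to any other point
of `S`, provided that the coordinates in a fan with `i` are moved to fixed values. -/
theorem exists_mix {nabla : D → D → D → D} (hf : IsDualDiscriminator nabla)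
    {S : Set (Fin n → D)} (hS : ClosedUnder nabla S) (hne : S.Nonempty) (i : Fin n) :
    ∃ q : Fin n → D,
      (∀ v, ¬ SameBlock S i v → ¬ IsFull S i v → ∃ p, IsFan S i v p (q v)) ∧
      ∀ b ∈ S, ∀ y ∈ S, (fun v => if SameBlock S i v then b v else
        if IsFull S i v then y v else q v) ∈ S := by
  have hch : ∀ v, ∃ q p : D, ¬ SameBlock S i v → ¬ IsFull S i v → IsFan S i v p q := by
    intro v
    obtain ⟨b, -⟩ := hne
    rcases pair_cases hf hS i v with h | h | ⟨p, q, h⟩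
    · exact ⟨b i, b i, fun h' => absurd h h'⟩
    · exact ⟨b i, b i, fun _ h' => absurd h h'⟩
    · exact ⟨q, p, fun _ _ => h⟩
  choose q p hpq using hch
  refine ⟨q, fun v h₁ h₂ => ⟨p v, hpq v h₁ h₂⟩, fun b hb y hy => ?_⟩
  -- A constant coordinate is independent of every other one, so `i` takes a value different from
  -- any prescribed one as soon as some `v` is not independent of it.
  have hnc : ∀ v, ¬ IsFull S i v → ∀ a, ∃ ψ ∈ S, ψ i ≠ a := by
    intro v hv a
    by_contra hcon
    push Not at hcon
    exact hv fun φ hφ ψ hψ => ⟨ψ, hψ, by rw [hcon φ hφ, hcon ψ hψ], rfl⟩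
  have hBN : ∀ u v, SameBlock S i u → ¬ SameBlock S i v → ¬ IsFull S i v →
      ∃ t ∈ S, t u = b u ∧ t v = q v := by
    intro u v hu hv hv'
    obtain ⟨χ, hχ, h₁, h₂⟩ := (hpq v hv hv').2.2 b hb
    exact ⟨χ, hχ, (hu χ hχ b hb).1 h₁, h₂⟩
  have hBF : ∀ u v, SameBlock S i u → IsFull S i v → ∃ t ∈ S, t u = b u ∧ t v = y v := by
    intro u v hu hv
    obtain ⟨χ, hχ, h₁, h₂⟩ := hv b hb y hy
    exact ⟨χ, hχ, (hu χ hχ b hb).1 h₁, h₂⟩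
  -- A value at `i` different from `p u` forces `q u` at `u`, and independence still allows `y v` at
  -- `v`.
  have hNF : ∀ u v, ¬ SameBlock S i u → ¬ IsFull S i u → IsFull S i v →
      ∃ t ∈ S, t u = q u ∧ t v = y v := by
    intro u v hu hu' hv
    obtain ⟨ψ, hψ, hψp⟩ := hnc u hu' (p u)
    obtain ⟨χ, hχ, h₁, h₂⟩ := hv ψ hψ y hy
    exact ⟨χ, hχ, ((hpq u hu hu').1 χ hχ).resolve_left (h₁ ▸ hψp), h₂⟩
  have hNN : ∀ u v, ¬ SameBlock S i u → ¬ IsFull S i u → ¬ SameBlock S i v → ¬ IsFull S i v →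
      ∃ t ∈ S, t u = q u ∧ t v = q v := by
    intro u v hu hu' hv hv'
    -- If the two fans have the same `p`, a value at `i` other than `p` forces both `q u` and `q v`.
    -- If not, `p u` can be combined with `q u` and, differing from `p v`, forces `q v`.
    by_cases hp : p u = p v
    · obtain ⟨ψ, hψ, hψp⟩ := hnc u hu' (p u)
      exact ⟨ψ, hψ, ((hpq u hu hu').1 ψ hψ).resolve_left hψp,
        ((hpq v hv hv').1 ψ hψ).resolve_left (hp ▸ hψp)⟩
    · obtain ⟨χ, hχ, h₁, -⟩ := (hpq u hu hu').2.1 b hb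
      obtain ⟨ψ, hψ, h₂, h₃⟩ := (hpq u hu hu').2.2 χ hχ
      exact ⟨ψ, hψ, h₃, ((hpq v hv hv').1 ψ hψ).resolve_left (by rw [h₂, h₁]; exact hp)⟩
  -- The mixed point belongs to `S` because each pair of its coordinates occurs in `S`.
  refine hS.mem_of_pairs hf.1 hne _ fun u v => ?_
  have swap : ∀ {u v : Fin n} {a c : D}, (∃ t ∈ S, t u = a ∧ t v = c) →
      ∃ t ∈ S, t v = c ∧ t u = a :=
    fun ⟨t, h₁, h₂, h₃⟩ => ⟨t, h₁, h₃, h₂⟩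
  by_cases hu : SameBlock S i u <;> by_cases hv : SameBlock S i v <;>
    by_cases hu' : IsFull S i u <;> by_cases hv' : IsFull S i v <;>
    simp only [hu, hv, hu', hv', if_true, if_false] <;>
    first
    | exact ⟨b, hb, rfl, rfl⟩
    | exact ⟨y, hy, rfl, rfl⟩
    | exact hBN _ _ hu hv hv'
    | exact hBF _ _ hu hv'
    | exact swap (hBN _ _ hv hu hu')
    | exact swap (hBF _ _ hv hu')
    | exact hNF _ _ hu hu' hv'
    | exact swap (hNF _ _ hv hv' hu')
    | exact hNN _ _ hu hu' hv hv'

end Pairs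

/-! ### Leading monomials of the vanishing ideal -/

section Structure

variable {D : Finset ℚ} {n : ℕ}

/-- A point of `D ^ n` as a point of `ℚ ^ n`. -/
def toPt {ι : Type} (φ : ι → D) : ι → ℚ := fun v => (φ v : ℚ)

/-- The vanishing ideal of a set of points of `D ^ n`. -/
noncomputable def solIdeal (S : Set (Fin n → D)) : Ideal (MvPolynomial (Fin n) ℚ) :=
  vanishingIdeal ℚ (toPt '' S)

theorem mem_solIdeal {S : Set (Fin n → D)} {g : MvPolynomial (Fin n) ℚ} :
    g ∈ solIdeal S ↔ ∀ φ ∈ S, eval (toPt φ) g = 0 := by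
  simp [solIdeal, mem_vanishingIdeal_iff, aeval_eq_eval]

/-- The nonzero members of the vanishing ideal that depend on one block only or are products
`(x_i - p) (x_j - q)`. -/
def IsLocalElem (S : Set (Fin n → D)) (h : MvPolynomial (Fin n) ℚ) : Prop :=
  h ∈ solIdeal S ∧ h ≠ 0 ∧ ((∃ i, ∀ v ∈ h.vars, SameBlock S i v) ∨
    ∃ i j, ∃ p q : ℚ, h = (X i - C p) * (X j - C q))

/-- The monomials not divisible by the leading monomial of a local element. -/
def IsStd (S : Set (Fin n → D)) (α : Fin n →₀ ℕ) : Prop :=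
  ∀ h, IsLocalElem S h → ¬ lm h ≤ α

theorem IsStd.of_le {S : Set (Fin n → D)} {α β : Fin n →₀ ℕ} (h : IsStd S β) (hle : α ≤ β) :
    IsStd S α := fun g hg hα => h g hg (hα.trans hle)

theorem zero_lt_syn_single (i : Fin n) : syn (0 : Fin n →₀ ℕ) < syn (Finsupp.single i 1) := by
  refine lt_of_le_of_ne (syn_mono (zero_le)) fun h => ?_
  have := DFunLike.congr_fun (syn_inj.1 h) i
  simp at this

theorem lm_X_sub_C (i : Fin n) (p : ℚ) : lm (X i - C p) = Finsupp.single i 1 := by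
  rw [lm, MonomialOrder.degree_sub_of_lt, MonomialOrder.degree_X]
  rw [MonomialOrder.degree_C, MonomialOrder.degree_X]
  exact zero_lt_syn_single i

theorem X_sub_C_ne_zero' (i : Fin n) (p : ℚ) : (X i - C p : MvPolynomial (Fin n) ℚ) ≠ 0 := by
  intro h
  have := lm_X_sub_C i p
  rw [h, lm, MonomialOrder.degree_zero] at this
  simpa using DFunLike.congr_fun this i

theorem lm_mul_X_sub_C (i j : Fin n) (p q : ℚ) :
    lm ((X i - C p) * (X j - C q)) = Finsupp.single i 1 + Finsupp.single j 1 := by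
  rw [lm, MonomialOrder.degree_mul (X_sub_C_ne_zero' i p) (X_sub_C_ne_zero' j q)]
  rw [← lm, ← lm, lm_X_sub_C, lm_X_sub_C]

/-- Inside the block of `i`, the value `p` at `i` corresponds to one value `p'` at `i'`, so the fan
is inherited by the whole block. -/
theorem IsFan.mem {S : Set (Fin n → D)} {i j : Fin n} {p q : D} (h : IsFan S i j p q) {i' : Fin n}
    (hi : SameBlock S i i') : ∃ p' : ℚ, (X i' - C p') * (X j - C (q : ℚ)) ∈ solIdeal S := by
  by_cases hne : S.Nonempty
  · obtain ⟨φ, hφ⟩ := hne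
    obtain ⟨χ, hχ, h₁, -⟩ := h.2.1 φ hφ
    refine ⟨χ i', mem_solIdeal.2 fun ψ hψ => ?_⟩
    simp only [map_mul, map_sub, eval_X, eval_C, toPt]
    rcases h.1 ψ hψ with h' | h'
    · rw [(hi ψ hψ χ hχ).1 (h'.trans h₁.symm)]
      simp
    · rw [h']
      simp
  · exact ⟨0, mem_solIdeal.2 fun ψ hψ => absurd ⟨ψ, hψ⟩ hne⟩

theorem coeff_sum_monomial {σ : Type} [DecidableEq σ] {ι : Type} (s : Finset ι) (g : ι → σ →₀ ℕ)
    (c : ι → ℚ) (γ : σ →₀ ℕ) :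
    (∑ a ∈ s, monomial (g a) (c a)).coeff γ = ∑ a ∈ s with g a = γ, c a := by
  rw [coeff_sum, Finset.sum_filter]
  simp [coeff_monomial]

theorem support_sum_monomial {σ : Type} {ι : Type} {s : Finset ι} {g : ι → σ →₀ ℕ}
    {c : ι → ℚ} {γ : σ →₀ ℕ} (h : γ ∈ (∑ a ∈ s, monomial (g a) (c a)).support) :
    ∃ a ∈ s, g a = γ := by
  classical
  by_contra hcon
  push Not at hcon
  rw [mem_support_iff, coeff_sum_monomial, Finset.filter_false_of_mem hcon] at h
  simp at h

-- Let a monomial `α` of `f` contain `x_i`, and split the variables into the block of `i` and the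
-- rest. By `exists_mix`, `f` vanishes when the block takes its values from `b` and the independent
-- coordinates theirs from `y`, for arbitrary `b` and `y` in `S`. For fixed `y` this is a polynomial
-- `H y` in block variables that vanishes on `S`; its leading monomial divides a monomial of `f`, so
-- `H y` would be a local element with standard leading monomial unless it is zero. The coefficient
-- `g` of the block part of `α` then vanishes on `S`, has standard monomials and smaller degree, so
-- it is zero by induction, contradicting the choice of `α`. Hence `f` is constant.
open Classical in
theorem eq_zero_of_isStd {nabla : D → D → D → D} (hf : IsDualDiscriminator nabla)
    {S : Set (Fin n → D)} (hS : ClosedUnder nabla S) (hne : S.Nonempty) (d : ℕ) :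
    ∀ f ∈ solIdeal S, (∀ α ∈ f.support, IsStd S α ∧ α.degree ≤ d) → f = 0 := by
  have hconst : ∀ c : ℚ, C c ∈ solIdeal S → c = 0 := by
    intro c hc
    obtain ⟨φ, hφ⟩ := hne
    simpa using mem_solIdeal.1 hc φ hφ
  induction d with
  | zero =>
    intro f hfI hsupp
    have : f = C (f.coeff 0) := by
      ext α
      rw [coeff_C]
      split_ifs with h
      · rw [h]
      · by_contra hα
        have := (hsupp α (mem_support_iff.2 hα)).2
        exact h ((Finsupp.degree_eq_zero_iff α).1 (Nat.le_zero.1 this)).symm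
    rw [this] at hfI ⊢
    rw [hconst _ hfI, map_zero]
  | succ d ih =>
    intro f hfI hsupp
    have hvars : ∀ α ∈ f.support, ∀ i, α i = 0 := by
      intro α hα i
      by_contra hi
      obtain ⟨q, hq, hmix⟩ := exists_mix hf hS hne i
      set B : Fin n → Prop := SameBlock S i with hB
      have hBi : B i := fun _ _ _ _ => Iff.rfl
      set γ := α.filter B with hγ
      have hγi : γ i ≠ 0 := by
        rw [hγ, Finsupp.filter_apply_pos _ _ hBi]; exact hi
      set w : (Fin n → D) → Fin n → ℚ := fun y v => if IsFull S i v then (y v : ℚ) else q v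
      let ev : (Fin n → ℚ) → (Fin n →₀ ℕ) → ℚ := fun x α => α.prod fun v k => x v ^ k
      have ev_congr : ∀ x x' : Fin n → ℚ, ∀ β : Fin n →₀ ℕ, (∀ v ∈ β.support, x v = x' v) →
          ev x β = ev x' β := fun x x' β h =>
        Finset.prod_congr rfl fun v hv => by simp only [h v hv]
      have evalf : ∀ x, eval x f = ∑ β ∈ f.support, f.coeff β * ev x β := by
        intro x
        rw [eval_eq]
        rfl
      -- the part of `f` seen on the block, for a fixed point outside
      let H : (Fin n → D) → MvPolynomial (Fin n) ℚ := fun y =>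
        ∑ β ∈ f.support, monomial (β.filter B) (f.coeff β * ev (w y) (β.filter fun v => ¬ B v))
      have hH : ∀ y ∈ S, H y = 0 := by
        intro y hy
        by_contra h0
        have hstd : IsStd S (lm (H y)) := by
          obtain ⟨β, hβ, e⟩ := support_sum_monomial
            (MonomialOrder.degLex.degree_mem_support h0)
          rw [← lm] at e
          rw [← e]
          refine (hsupp β hβ).1.of_le fun v => ?_
          rw [Finsupp.filter_apply]
          split_ifs <;> simp
        refine hstd (H y) ⟨mem_solIdeal.2 fun b hb => ?_, h0, Or.inl ⟨i, ?_⟩⟩ le_rfl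
        · have h1 := mem_solIdeal.1 hfI _ (hmix b hb y hy)
          rw [evalf] at h1
          rw [← h1, map_sum]
          refine Finset.sum_congr rfl fun β _ => ?_
          rw [eval_monomial, mul_assoc, mul_comm (ev (w y) _)]
          congr 1
          have hsplit : ∀ x, ev x β = ev x (β.filter B) * ev x (β.filter fun v => ¬ B v) := by
            intro x
            conv_lhs => rw [← Finsupp.filter_add_filter_not β B]
            exact Finsupp.prod_add_index' (by simp) (by intros; rw [pow_add])
          rw [hsplit]
          congr 1
          · refine ev_congr _ _ _ fun v hv => ?_
            have : B v := by
              by_contra hv'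
              simp [hv'] at hv
            simp only [toPt, if_pos this]
          · refine ev_congr _ _ _ fun v hv => ?_
            have : ¬ B v := by
              intro hv'
              simp [hv'] at hv
            simp only [toPt, w, if_neg this]
            split_ifs <;> rfl
        · intro v hv
          obtain ⟨β, hβ, hvβ⟩ := (mem_vars_iff_mem_support v).1 hv
          obtain ⟨δ, -, rfl⟩ := support_sum_monomial hβ
          by_contra hv'
          simp [B, hv'] at hvβ
      -- the coefficient of `γ`
      let g : MvPolynomial (Fin n) ℚ :=
        ∑ β ∈ f.support with β.filter B = γ, monomial (β.filter fun v => ¬ B v) (f.coeff β)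
      have hgI : g ∈ solIdeal S := by
        refine mem_solIdeal.2 fun y hy => ?_
        have h1 := congrArg (coeff γ) (hH y hy)
        rw [coeff_sum_monomial, coeff_zero] at h1
        rw [← h1, map_sum]
        refine Finset.sum_congr rfl fun β hβ => ?_
        rw [Finset.mem_filter] at hβ
        rw [eval_monomial]
        congr 1
        refine ev_congr _ _ _ fun v hv => ?_
        have hvB : ¬ B v := by
          intro hv'
          simp [hv'] at hv
        have hvβ : β v ≠ 0 := by
          simpa [hvB] using hv
        have hiβ : β i ≠ 0 := by
          have := DFunLike.congr_fun hβ.2 i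
          rw [Finsupp.filter_apply_pos _ _ hBi] at this
          rw [this]; exact hγi
        -- The monomial `β` contains `x_i`, so a variable in a fan with `i` would make it divisible
        -- by the leading monomial of a local product. Hence only coordinates independent of `i`
        -- remain, on which `w y` is `y` itself.
        have hfull : IsFull S i v := by
          by_contra hv'
          obtain ⟨p, hp⟩ := hq v hvB hv'
          obtain ⟨p', hp'⟩ := hp.mem hBi
          refine (hsupp β hβ.1).1 _ ⟨hp', mul_ne_zero (X_sub_C_ne_zero' _ _)
            (X_sub_C_ne_zero' _ _), Or.inr ⟨_, _, _, _, rfl⟩⟩ ?_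
          rw [lm_mul_X_sub_C]
          intro u
          have hiv : i ≠ v := fun e => hvB (e ▸ hBi)
          rw [Finsupp.add_apply, Finsupp.single_apply, Finsupp.single_apply]
          split_ifs with h₁ h₂ h₂
          · exact absurd (h₁.trans h₂.symm) hiv
          · subst h₁; omega
          · subst h₂; omega
          · omega
        simp only [w, if_pos hfull, toPt]
      have hg0 : g = 0 := by
        refine ih g hgI fun δ hδ => ?_
        obtain ⟨β, hβ, rfl⟩ := support_sum_monomial hδ
        rw [Finset.mem_filter] at hβ
        refine ⟨(hsupp β hβ.1).1.of_le fun v => ?_, ?_⟩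
        · rw [Finsupp.filter_apply]
          split_ifs <;> simp
        · have h1 := (hsupp β hβ.1).2
          rw [← Finsupp.filter_add_filter_not β B, hβ.2, map_add] at h1
          -- The degree drops because `γ` contains `x_i`.
          have h2 : γ.degree ≠ 0 := fun h =>
            hγi (by rw [(Finsupp.degree_eq_zero_iff γ).1 h]; rfl)
          omega
      have h1 := congrArg (coeff (α.filter fun v => ¬ B v)) hg0
      rw [coeff_sum_monomial, coeff_zero, Finset.sum_eq_single_of_mem α] at h1
      · exact mem_support_iff.1 hα h1
      · simp only [Finset.mem_filter]
        exact ⟨⟨hα, by rw [hγ]⟩, trivial⟩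
      · intro β hβ hne'
        simp only [Finset.mem_filter] at hβ
        exfalso
        apply hne'
        rw [← Finsupp.filter_add_filter_not β B, hβ.1.2, hβ.2, hγ,
          Finsupp.filter_add_filter_not α B]
    refine ih f hfI fun α hα => ⟨(hsupp α hα).1, ?_⟩
    have : α = 0 := Finsupp.ext fun i => hvars α hα i
    simp [this]

end Structure

/-! ### Basis elements have boundedly many variables -/

section VarsBound

variable {D : Finset ℚ} {n : ℕ} {nabla : D → D → D → D} {S : Set (Fin n → D)}

theorem C_notMem_solIdeal (hne : S.Nonempty) {c : ℚ} (hc : C c ∈ solIdeal S) : c = 0 := by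
  obtain ⟨φ, hφ⟩ := hne
  simpa using mem_solIdeal.1 hc φ hφ

/-- The leading monomials of the local elements generate those of the vanishing ideal. -/
theorem exists_isLocalElem_le (hf : IsDualDiscriminator nabla) (hS : ClosedUnder nabla S)
    (hne : S.Nonempty) {k : MvPolynomial (Fin n) ℚ} (hk : k ∈ solIdeal S) (k0 : k ≠ 0) :
    ∃ h, IsLocalElem S h ∧ lm h ≤ lm k := by
  by_contra hcon
  push Not at hcon
  -- If no local leading monomial divided `lm k`, reducing the tail of `k` modulo the local elements
  -- would leave a nonzero member of the ideal with standard monomials only.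
  set J : Ideal (MvPolynomial (Fin n) ℚ) := Ideal.span {h | IsLocalElem S h} with hJ
  have hJI : J ≤ solIdeal S := Ideal.span_le.2 fun h hh => hh.1
  have hc := coeff_lm_ne_zero k0
  obtain ⟨r, h₁, h₂, h₃⟩ := exists_normalForm_lt (J.restrictScalars ℚ) (syn (lm k))
    (k - monomial (lm k) (k.coeff (lm k))) (by
      intro α hα
      rw [mem_support_iff, coeff_sub, coeff_monomial] at hα
      split_ifs at hα with e
      · subst e; simp at hα
      · rw [sub_zero] at hα
        exact lt_of_le_of_ne (MonomialOrder.degLex.le_degree (mem_support_iff.2 hα))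
          (fun e' => e (syn_inj.1 e').symm))
  have hr : r.coeff (lm k) = 0 := by
    by_contra e
    exact lt_irrefl _ (h₃ _ (mem_support_iff.2 e))
  set f := monomial (lm k) (k.coeff (lm k)) + r with hfdef
  have hfI : f ∈ solIdeal S := by
    convert (solIdeal S).sub_mem hk (hJI h₁) using 1
    rw [hfdef]
    ring
  have hstd : ∀ α ∈ f.support, IsStd S α := by
    intro α hα h hh hle
    by_cases e : lm k = α
    · exact hcon h hh (e ▸ hle)
    · rw [mem_support_iff, hfdef, coeff_add, coeff_monomial, if_neg e, zero_add,
        ← mem_support_iff] at hα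
      obtain ⟨k', hk', k0', e'⟩ := exists_mem_lm_eq J (Ideal.subset_span hh) hh.2.1 hle
      exact h₂ k' hk' k0' (e' ▸ hα)
  have hf0 : f = 0 := eq_zero_of_isStd hf hS hne f.totalDegree f hfI fun α hα =>
    ⟨hstd α hα, le_totalDegree hα⟩
  apply hc
  have := congrArg (coeff (lm k)) hf0
  simpa [hfdef, hr] using this

theorem support_X_sub_C_le {i : Fin n} {p : ℚ} {α : Fin n →₀ ℕ}
    (h : α ∈ (X i - C p : MvPolynomial (Fin n) ℚ).support) : α ≤ Finsupp.single i 1 := by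
  classical
  rw [mem_support_iff, coeff_sub, coeff_X, coeff_C] at h
  by_cases h₁ : Finsupp.single i 1 = α
  · exact h₁.ge
  · by_cases h₂ : 0 = α
    · rw [← h₂]; exact zero_le
    · simp [h₁, h₂] at h

theorem support_mul_X_sub_C_le {i j : Fin n} {p q : ℚ} {α : Fin n →₀ ℕ}
    (h : α ∈ ((X i - C p) * (X j - C q) : MvPolynomial (Fin n) ℚ).support) :
    α ≤ Finsupp.single i 1 + Finsupp.single j 1 := by
  classical
  obtain ⟨β, hβ, γ, hγ, rfl⟩ := Finset.mem_add.1 (support_mul _ _ h)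
  exact add_le_add (support_X_sub_C_le hβ) (support_X_sub_C_le hγ)

theorem mem_or_mem_of_mem_vars_mul {i j : Fin n} {p q : ℚ} {v : Fin n}
    (hv : v ∈ ((X i - C p) * (X j - C q) : MvPolynomial (Fin n) ℚ).vars) : v = i ∨ v = j := by
  classical
  obtain ⟨α, hα, hvα⟩ := (mem_vars_iff_mem_support v).1 hv
  have := support_mul_X_sub_C_le hα v
  by_contra hcon
  push Not at hcon
  rw [Finsupp.add_apply, Finsupp.single_eq_of_ne hcon.1, Finsupp.single_eq_of_ne hcon.2] at this
  exact Finsupp.mem_support_iff.1 hvα (Nat.le_zero.1 this)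

/-- Coordinates of one block that are not leading monomials are linearly independent functions of
the value at one coordinate. -/
theorem card_le_of_block {i : Fin n} (T : Finset (Fin n)) (hT : ∀ v ∈ T, SameBlock S i v)
    (hstd : ∀ v ∈ T, ∀ k ∈ solIdeal S, k ≠ 0 → lm k ≠ Finsupp.single v 1) : T.card ≤ D.card := by
  classical
  -- The function computing coordinate `v` from the value at `i`, zero on values not taken. A linear
  -- relation among these functions is a linear form in the ideal whose leading monomial is one of
  -- the excluded variables; so they are independent in the `|D|`-dimensional space of functions on
  -- `D`.
  let z : T → D → ℚ := fun v a => if h : ∃ φ ∈ S, φ i = a then (h.choose v : ℚ) else 0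
  have hz : ∀ v : T, ∀ φ ∈ S, z v (φ i) = φ v := by
    intro v φ hφ
    have h : ∃ ψ ∈ S, ψ i = φ i := ⟨φ, hφ, rfl⟩
    simp only [z, dif_pos h]
    rw [(hT v v.2 _ h.choose_spec.1 φ hφ).1 h.choose_spec.2]
  have hli : LinearIndependent ℚ z := by
    rw [Fintype.linearIndependent_iff]
    intro c hc
    by_contra hcon
    push Not at hcon
    obtain ⟨v₀, hv₀⟩ := hcon
    set k : MvPolynomial (Fin n) ℚ :=
      ∑ v : T, monomial (Finsupp.single (v : Fin n) 1) (c v) with hkdef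
    have hkI : k ∈ solIdeal S := by
      refine mem_solIdeal.2 fun φ hφ => ?_
      have := congrFun hc (φ i)
      rw [hkdef, map_sum]
      simp only [Finset.sum_apply, Pi.smul_apply, smul_eq_mul, Pi.zero_apply] at this
      rw [← this]
      refine Finset.sum_congr rfl fun v _ => ?_
      rw [hz v φ hφ, eval_monomial]
      simp [toPt]
    have k0 : k ≠ 0 := by
      intro h
      apply hv₀
      have := congrArg (coeff (Finsupp.single (v₀ : Fin n) 1)) h
      rw [hkdef, coeff_sum_monomial, coeff_zero, Finset.sum_eq_single_of_mem v₀] at this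
      · exact this
      · simp
      · intro v hv hne
        exfalso
        apply hne
        simp only [Finset.mem_filter] at hv
        exact Subtype.ext (Finsupp.single_left_injective one_ne_zero hv.2)
    obtain ⟨v, -, hv⟩ := support_sum_monomial (MonomialOrder.degLex.degree_mem_support k0)
    exact hstd v v.2 k hkI k0 hv.symm
  simpa using hli.fintype_card_le_finrank

/-- The elements of the reduced Gröbner basis depend on a bounded number of variables. -/
theorem IsReducedIn.card_vars_le (hf : IsDualDiscriminator nabla) (hS : ClosedUnder nabla S)
    {g : MvPolynomial (Fin n) ℚ} (hg : IsReducedIn ((solIdeal S).restrictScalars ℚ) g) :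
    g.vars.card ≤ D.card + 2 := by
  classical
  rcases S.eq_empty_or_nonempty with rfl | hne
  · have h1 : (1 : MvPolynomial (Fin n) ℚ) ∈ solIdeal (∅ : Set (Fin n → D)) :=
      mem_solIdeal.2 (by simp)
    have : g.vars = ∅ := by
      rw [Finset.eq_empty_iff_forall_notMem]
      intro v hv
      obtain ⟨α, hα, hvα⟩ := (mem_vars_iff_mem_support v).1 hv
      have := hg.2.2 1 h1 one_ne_zero α hα (by rw [lm, MonomialOrder.degree_one]; exact zero_le)
      rw [this.1, ← this.2, lm, MonomialOrder.degree_one] at hvα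
      simp at hvα
    simp [this]
  · have g0 := hg.isTailReduced.ne_zero
    obtain ⟨h, hh, hle⟩ := exists_isLocalElem_le hf hS hne hg.1 g0
    have hmem := MonomialOrder.degLex.degree_mem_support g0
    have hlm := (hg.2.2 h hh.1 hh.2.1 _ hmem hle).2
    have hdiv : ∀ k ∈ solIdeal S, k ≠ 0 → lm k ≤ lm g → lm k = lm g := fun k hk k0 hkg =>
      (hg.2.2 k hk k0 _ hmem hkg).2
    rcases hh.2.2 with ⟨i, hi⟩ | ⟨i, j, p, q, rfl⟩
    · -- the element of the block with the same leading monomial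
      set V : Submodule ℚ (MvPolynomial (Fin n) ℚ) := (solIdeal S).restrictScalars ℚ ⊓
        Subalgebra.toSubmodule (supported ℚ {v | SameBlock S i v}) with hV
      have hmemV : ∀ k, k ∈ V ↔ k ∈ solIdeal S ∧ ∀ v ∈ k.vars, SameBlock S i v := by
        intro k
        rw [hV, Submodule.mem_inf, Subalgebra.mem_toSubmodule, mem_supported]
        exact Iff.rfl
      obtain ⟨b, hb, hbh⟩ := exists_isTailReduced V ((hmemV h).2 ⟨hh.1, hi⟩) hh.2.1
      -- Reduction within the block is enough: a leading monomial of the ideal that occurs in `b` is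
      -- a multiple of that of a local element, which then lives on the same block and has a
      -- multiple there with exactly this leading monomial.
      have hbI : IsTailReduced ((solIdeal S).restrictScalars ℚ) b := by
        refine ⟨((hmemV b).1 hb.1).1, hb.2.1, ?_⟩
        rintro α hα hne' k hk k0 rfl
        obtain ⟨l, hl, hlk⟩ := exists_isLocalElem_le hf hS hne hk k0
        have hB : ∀ v, lm l v ≠ 0 → SameBlock S i v := fun v hv =>
          ((hmemV b).1 hb.1).2 v ((mem_vars_iff_mem_support v).2
            ⟨_, hα, Finsupp.mem_support_iff.2 (fun e => hv (Nat.le_zero.1 (e ▸ hlk v)))⟩)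
        have hlB : ∀ v ∈ l.vars, SameBlock S i v := by
          rcases hl.2.2 with ⟨i', hi'⟩ | ⟨a, a', p, q, rfl⟩
          -- A nonzero constant does not vanish on the nonempty `S`, so `l` has a leading variable,
          -- and this ties its block to that of `i`.
          · have hl0 : lm l ≠ 0 := by
              intro e
              have := MonomialOrder.degLex.eq_C_of_degree_eq_zero e
              have h1 := hl.1
              rw [this] at h1
              have h2 := C_notMem_solIdeal hne h1
              exact hl.2.1 (MonomialOrder.degLex.leadingCoeff_eq_zero_iff.1 h2)
            obtain ⟨u, hu⟩ := Finsupp.ne_iff.1 hl0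
            have hu' := hi' u ((mem_vars_iff_mem_support u).2
              ⟨_, MonomialOrder.degLex.degree_mem_support hl.2.1, Finsupp.mem_support_iff.2 hu⟩)
            intro v hv φ hφ ψ hψ
            rw [hB u hu φ hφ ψ hψ, ← hu' φ hφ ψ hψ, hi' v hv φ hφ ψ hψ]
          · rw [lm_mul_X_sub_C] at hB
            intro v hv
            rcases mem_or_mem_of_mem_vars_mul hv with rfl | rfl
            · exact hB v (by simp)
            · exact hB v (by simp)
        have hX : (monomial (lm k - lm l) (1 : ℚ)) ≠ 0 := by simp
        refine hb.2.2 (lm k) hα hne' (monomial (lm k - lm l) 1 * l) ((hmemV _).2 ⟨?_, ?_⟩)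
          (mul_ne_zero hX hl.2.1) ?_
        · exact (solIdeal S).mul_mem_left _ hl.1
        · intro v hv
          rcases Finset.mem_union.1 (vars_mul _ _ hv) with hv | hv
          · rw [vars_monomial one_ne_zero, Finsupp.mem_support_iff, Finsupp.tsub_apply] at hv
            refine ((hmemV b).1 hb.1).2 v ((mem_vars_iff_mem_support v).2
              ⟨_, hα, Finsupp.mem_support_iff.2 fun e => hv (by rw [e, zero_tsub])⟩)
          · exact hlB v hv
        · rw [lm, MonomialOrder.degree_mul hX hl.2.1, MonomialOrder.degree_monomial,
            if_neg one_ne_zero]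
          exact tsub_add_cancel_of_le hlk
      have hgb : g = b := hg.isTailReduced.eq hbI (by rw [hbh, hlm])
      have hgB : ∀ v ∈ g.vars, SameBlock S i v := by
        rw [hgb]; exact ((hmemV b).1 hb.1).2
      -- If the variable `x_v` is a leading monomial of the ideal and divides a monomial of `g`,
      -- reducedness forces `lm g = x_v`. Thus all variables of `g` but at most one fall under the
      -- linear independence bound.
      have hT : (g.vars.filter fun v => lm g ≠ Finsupp.single v 1).card ≤ D.card := by
        refine card_le_of_block (i := i) (S := S) _
          (fun v hv => hgB v (Finset.mem_filter.1 hv).1) fun v hv k hk k0 e => ?_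
        rw [Finset.mem_filter] at hv
        obtain ⟨α, hα, hvα⟩ := (mem_vars_iff_mem_support v).1 hv.1
        refine hv.2 ?_
        rw [← e]
        refine ((hg.2.2 k hk k0 α hα ?_).2).symm
        rw [e]
        intro u
        rw [Finsupp.single_apply]
        split_ifs with h'
        · subst h'
          exact Nat.one_le_iff_ne_zero.2 (Finsupp.mem_support_iff.1 hvα)
        · exact Nat.zero_le _
      have hT' : (g.vars.filter fun v => ¬ lm g ≠ Finsupp.single v 1).card ≤ 1 := by
        refine Finset.card_le_one.2 fun u hu v hv => ?_
        simp only [ne_eq, not_not, Finset.mem_filter] at hu hv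
        exact Finsupp.single_left_injective one_ne_zero (hu.2.symm.trans hv.2)
      have := Finset.card_filter_add_card_filter_not (s := g.vars)
        (fun v => lm g ≠ Finsupp.single v 1)
      omega
    · have hlc : ((X i - C p) * (X j - C q) : MvPolynomial (Fin n) ℚ).coeff
          (lm ((X i - C p) * (X j - C q))) = 1 := by
        have hl : ∀ (i : Fin n) (p : ℚ),
            MonomialOrder.degLex.leadingCoeff (X i - C p : MvPolynomial (Fin n) ℚ) = 1 := by
          intro i p
          rw [MonomialOrder.leadingCoeff_sub_of_lt, MonomialOrder.leadingCoeff_X]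
          rw [MonomialOrder.degree_C, MonomialOrder.degree_X]
          exact zero_lt_syn_single i
        change MonomialOrder.degLex.leadingCoeff _ = 1
        rw [MonomialOrder.leadingCoeff_mul, hl, hl, one_mul]
      have hgh : g = (X i - C p) * (X j - C q) := by
        -- All monomials of the product divide `x_i x_j = lm g`, and no leading monomial properly
        -- divides `lm g`; so the product is already tail-reduced and equals `g`.
        refine hg.isTailReduced.eq ⟨hh.1, hlc, ?_⟩ hlm.symm
        rintro α hα hne' k hk k0 rfl
        apply hne'
        rw [hlm]
        refine hdiv k hk k0 ?_
        rw [← hlm, lm_mul_X_sub_C]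
        exact support_mul_X_sub_C_le hα
      have : g.vars ⊆ {i, j} := by
        intro v hv
        rw [hgh] at hv
        simpa using mem_or_mem_of_mem_vars_mul hv
      have := (Finset.card_le_card this).trans Finset.card_le_two
      omega

end VarsBound

/-! ### Reducedness among polynomials in few variables -/

section Injective

variable {τ : Type} {n n' : ℕ}

theorem mapDomain_le_iff {e : τ → Fin n} (he : e.Injective) {α β : τ →₀ ℕ} :
    α.mapDomain e ≤ β.mapDomain e ↔ α ≤ β := by
  constructor
  · intro h t
    have := h (e t)
    rwa [Finsupp.mapDomain_apply he, Finsupp.mapDomain_apply he] at this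
  · intro h v
    by_cases hv : v ∈ Set.range e
    · obtain ⟨t, rfl⟩ := hv
      rw [Finsupp.mapDomain_apply he, Finsupp.mapDomain_apply he]
      exact h t
    · rw [Finsupp.mapDomain_of_notMem_range _ _ hv]
      exact Nat.zero_le _

theorem syn_mapDomain_lt_iff {e : τ → Fin n} (he : e.Injective) {α β : τ →₀ ℕ} :
    syn (α.mapDomain e) < syn (β.mapDomain e) ↔ α.degree < β.degree ∨
      α.degree = β.degree ∧ ∃ t, (∀ t', e t' < e t → α t' = β t') ∧ α t < β t := by
  rw [MonomialOrder.degLex_lt_iff, Finsupp.DegLex.lt_iff, ofDegLex_toDegLex, ofDegLex_toDegLex,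
    Finsupp.degree_mapDomain, Finsupp.degree_mapDomain, Finsupp.Lex.lt_iff]
  refine or_congr Iff.rfl (and_congr Iff.rfl ?_)
  constructor
  · rintro ⟨v, h₁, h₂⟩
    have hv : v ∈ Set.range e := by
      by_contra hv
      change α.mapDomain e v < β.mapDomain e v at h₂
      rw [Finsupp.mapDomain_of_notMem_range _ _ hv, Finsupp.mapDomain_of_notMem_range _ _ hv] at h₂
      exact lt_irrefl _ h₂
    obtain ⟨t, rfl⟩ := hv
    refine ⟨t, fun t' ht' => ?_, ?_⟩
    · have := h₁ (e t') ht'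
      change α.mapDomain e (e t') = β.mapDomain e (e t') at this
      rwa [Finsupp.mapDomain_apply he, Finsupp.mapDomain_apply he] at this
    · change α.mapDomain e (e t) < β.mapDomain e (e t) at h₂
      rwa [Finsupp.mapDomain_apply he, Finsupp.mapDomain_apply he] at h₂
  · rintro ⟨t, h₁, h₂⟩
    refine ⟨e t, fun v hv => ?_, ?_⟩
    · change α.mapDomain e v = β.mapDomain e v
      by_cases hv' : v ∈ Set.range e
      · obtain ⟨t', rfl⟩ := hv'
        rw [Finsupp.mapDomain_apply he, Finsupp.mapDomain_apply he]
        exact h₁ t' hv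
      · rw [Finsupp.mapDomain_of_notMem_range _ _ hv', Finsupp.mapDomain_of_notMem_range _ _ hv']
    · change α.mapDomain e (e t) < β.mapDomain e (e t)
      rwa [Finsupp.mapDomain_apply he, Finsupp.mapDomain_apply he]

/-- The leading monomial of a renamed polynomial depends on the order of the new names only. -/
theorem exists_lm_rename {h : MvPolynomial τ ℚ} (h0 : h ≠ 0) {e : τ → Fin n}
    {e' : τ → Fin n'} (he : e.Injective) (he' : e'.Injective)
    (hlt : ∀ t t', e t < e t' ↔ e' t < e' t') :
    ∃ γ ∈ h.support, lm (rename e h) = γ.mapDomain e ∧ lm (rename e' h) = γ.mapDomain e' := by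
  classical
  have hr : ∀ {m : ℕ} {a : τ → Fin m}, a.Injective → rename a h ≠ 0 := fun ha h' =>
    h0 ((rename_eq_zero_iff_of_injective _ ha).1 h')
  have hmem := MonomialOrder.degLex.degree_mem_support (hr he)
  rw [support_rename_of_injective he, Finset.mem_image] at hmem
  obtain ⟨γ, hγ, e₁⟩ := hmem
  refine ⟨γ, hγ, e₁.symm, ?_⟩
  have hmem' := MonomialOrder.degLex.degree_mem_support (hr he')
  rw [support_rename_of_injective he', Finset.mem_image] at hmem'
  obtain ⟨δ, hδ, e₂⟩ := hmem'
  rw [lm, ← e₂]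
  by_contra hne
  have h1 : syn (γ.mapDomain e') < syn (δ.mapDomain e') := by
    refine lt_of_le_of_ne ?_ fun h => hne (syn_inj.1 h).symm
    rw [e₂]
    refine MonomialOrder.degLex.le_degree ?_
    rw [support_rename_of_injective he']
    exact Finset.mem_image_of_mem _ hγ
  have h2 : syn (γ.mapDomain e) < syn (δ.mapDomain e) := by
    rw [syn_mapDomain_lt_iff he'] at h1
    rw [syn_mapDomain_lt_iff he]
    simpa only [hlt] using h1
  rw [e₁] at h2
  refine not_le_of_gt h2 (MonomialOrder.degLex.le_degree ?_)
  rw [support_rename_of_injective he]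
  exact Finset.mem_image_of_mem _ hδ

end Injective

/-! ### Reducedness as a property of patterns of tuples -/

section Local

variable {D : Finset ℚ} {N n : ℕ}

/-- The members of the vanishing ideal of `S` in the variables listed by `w`. -/
noncomputable def localSpace (S : Set (Fin n → D)) (w : Fin N → Fin n) :
    Submodule ℚ (MvPolynomial (Fin n) ℚ) :=
  (solIdeal S).restrictScalars ℚ ⊓ Subalgebra.toSubmodule (rename (R := ℚ) w).range

theorem mem_localSpace {S : Set (Fin n → D)} {w : Fin N → Fin n} {h : MvPolynomial (Fin n) ℚ} :
    h ∈ localSpace S w ↔ h ∈ solIdeal S ∧ ∃ h₀, rename w h₀ = h := by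
  rw [localSpace, Submodule.mem_inf, Subalgebra.mem_toSubmodule, AlgHom.mem_range]
  exact Iff.rfl

theorem rename_mem_solIdeal {S : Set (Fin n → D)} {w : Fin N → Fin n}
    {h₀ : MvPolynomial (Fin N) ℚ} :
    rename w h₀ ∈ solIdeal S ↔ ∀ a ∈ (fun φ => φ ∘ w) '' S, eval (toPt a) h₀ = 0 := by
  simp only [mem_solIdeal, Set.forall_mem_image, eval_rename]
  rfl

/-- The tuple `w` of variables has the order pattern `O`, and the projection of `S` to it is `P`. -/
def Realizes (O : Fin N → Fin N → Prop) (P : Set (Fin N → D)) (S : Set (Fin n → D))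
    (w : Fin N → Fin n) : Prop :=
  (∀ l l', O l l' ↔ w l' < w l) ∧ Set.image (fun φ => φ ∘ w) S = P

/-- Reducedness among the polynomials in the variables `w` depends only on the order pattern of
`w` and on the projection of the set of points. -/
theorem Realizes.isReducedIn {n' : ℕ} {O : Fin N → Fin N → Prop} {P : Set (Fin N → D)}
    {S : Set (Fin n → D)} {w : Fin N → Fin n} {S' : Set (Fin n' → D)} {w' : Fin N → Fin n'}
    (h : Realizes O P S w) (h' : Realizes O P S' w') {g : MvPolynomial (Fin N) ℚ}
    (hg : IsReducedIn (localSpace S w) (rename w g)) :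
    IsReducedIn (localSpace S' w') (rename w' g) ∧
      ∀ t : Fin N →₀ ℕ, lm (rename w g) = t.mapDomain w → lm (rename w' g) = t.mapDomain w' := by
  classical
  have hlt : ∀ l l', w l < w l' ↔ w' l < w' l' := fun l l' => by rw [← h.1, ← h'.1]
  have heq : ∀ l l', w l = w l' ↔ w' l = w' l' := by
    intro l l'
    rw [le_antisymm_iff, le_antisymm_iff, ← not_lt, ← not_lt, ← not_lt, ← not_lt, hlt, hlt]
  -- Tuples may repeat variables. Keeping the first occurrence of each variable factors `w` and `w'`
  -- through the same surjection, followed by injections `e` and `e'` that order their arguments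
  -- alike.
  let T := {l : Fin N // ∀ l', l' < l → w l' ≠ w l}
  have hρ : ∀ l : Fin N, ∃ t : T, w t = w l := by
    intro l
    obtain ⟨m, hm, hmin⟩ := WellFounded.has_min (wellFounded_lt (α := Fin N))
      {l' | w l' = w l} ⟨l, rfl⟩
    exact ⟨⟨m, fun l' hl' e => hmin l' (e.trans hm) hl'⟩, hm⟩
  choose ρ hρ using hρ
  have hρ' : ∀ l, w' (ρ l) = w' l := fun l => (heq _ _).1 (hρ l)
  let e : T → Fin n := fun t => w t
  let e' : T → Fin n' := fun t => w' t
  have he : e.Injective := by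
    intro t t' htt
    rcases lt_trichotomy t.1 t'.1 with hl | hl | hl
    · exact absurd htt (t'.2 _ hl)
    · exact Subtype.ext hl
    · exact absurd htt.symm (t.2 _ hl)
  have he' : e'.Injective := fun t t' htt => he ((heq _ _).2 htt)
  have hee : ∀ t t', e t < e t' ↔ e' t < e' t' := fun t t' => hlt _ _
  have hw : ∀ p : MvPolynomial (Fin N) ℚ, rename w p = rename e (rename ρ p) := by
    intro p
    rw [rename_rename]
    congr 2
    funext l
    exact (hρ l).symm
  have hw' : ∀ p : MvPolynomial (Fin N) ℚ, rename w' p = rename e' (rename ρ p) := by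
    intro p
    rw [rename_rename]
    congr 2
    funext l
    exact (hρ' l).symm
  have hwt : ∀ t : Fin N →₀ ℕ, t.mapDomain w = (t.mapDomain ρ).mapDomain e := by
    intro t
    rw [← Finsupp.mapDomain_comp]
    congr 1
    funext l
    exact (hρ l).symm
  have hwt' : ∀ t : Fin N →₀ ℕ, t.mapDomain w' = (t.mapDomain ρ).mapDomain e' := by
    intro t
    rw [← Finsupp.mapDomain_comp]
    congr 1
    funext l
    exact (hρ' l).symm
  have hI : ∀ p : MvPolynomial (Fin N) ℚ, rename w p ∈ solIdeal S ↔ rename w' p ∈ solIdeal S' := by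
    intro p
    rw [rename_mem_solIdeal, rename_mem_solIdeal, h.2, h'.2]
  have g0 : rename ρ g ≠ 0 := by
    intro e0
    have := hg.isTailReduced.ne_zero
    rw [hw, e0, map_zero] at this
    exact this rfl
  obtain ⟨γ, hγ, hγe, hγe'⟩ := exists_lm_rename g0 he he' hee
  refine ⟨⟨mem_localSpace.2 ⟨(hI g).1 (mem_localSpace.1 hg.1).1, g, rfl⟩, ?_, ?_⟩, ?_⟩
  · have := hg.2.1
    rw [hw, hγe, coeff_rename_mapDomain _ he] at this
    rw [hw', hγe', coeff_rename_mapDomain _ he', this]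
  · intro k hk k0 α hα hle
    obtain ⟨hkI, k₁, rfl⟩ := mem_localSpace.1 hk
    rw [hw'] at k0
    have k0' : rename ρ k₁ ≠ 0 := by
      intro e0
      rw [e0, map_zero] at k0
      exact k0 rfl
    obtain ⟨δ, hδ, hδe, hδe'⟩ := exists_lm_rename k0' he he' hee
    rw [hw', support_rename_of_injective he', Finset.mem_image] at hα
    obtain ⟨β, hβ, rfl⟩ := hα
    rw [hw', hδe', mapDomain_le_iff he'] at hle
    have h2 := hg.2.2 (rename w k₁) (mem_localSpace.2 ⟨(hI k₁).2 hkI, k₁, rfl⟩)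
      (by rw [hw]; exact fun e0 => k0' ((rename_eq_zero_iff_of_injective _ he).1 e0))
      (β.mapDomain e) (by
        rw [hw, support_rename_of_injective he]
        exact Finset.mem_image_of_mem _ hβ)
      (by rw [hw, hδe, mapDomain_le_iff he]; exact hle)
    rw [hw g, hw k₁, hγe, hδe] at h2
    rw [hw' g, hw' k₁, hγe', hδe', Finsupp.mapDomain_injective he h2.1,
      Finsupp.mapDomain_injective he h2.2]
    exact ⟨rfl, rfl⟩
  · intro t ht
    rw [hw, hγe, hwt] at ht
    rw [hw', hγe', hwt', Finsupp.mapDomain_injective he ht]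

/-- `g` is reduced among the polynomials in the variables of a tuple with the given pattern. -/
def LocallyReduced (O : Fin N → Fin N → Prop) (P : Set (Fin N → D))
    (g : MvPolynomial (Fin N) ℚ) : Prop :=
  ∃ (n : ℕ) (S : Set (Fin n → D)) (w : Fin N → Fin n), Realizes O P S w ∧
    IsReducedIn (localSpace S w) (rename w g)

theorem Realizes.locallyReduced_iff {O : Fin N → Fin N → Prop} {P : Set (Fin N → D)}
    {S : Set (Fin n → D)} {w : Fin N → Fin n} (h : Realizes O P S w)
    {g : MvPolynomial (Fin N) ℚ} :
    LocallyReduced O P g ↔ IsReducedIn (localSpace S w) (rename w g) :=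
  ⟨fun ⟨_, _, _, h', hg⟩ => (h'.isReducedIn h hg).1, fun hg => ⟨n, S, w, h, hg⟩⟩

theorem exists_rename_of_vars [NeZero N] (w : Fin N → Fin n) :
    ∃ s : Fin n → Fin N, ∀ v ∈ Set.range w, w (s v) = v := by
  classical
  refine ⟨fun v => if h : v ∈ Set.range w then h.choose else 0, fun v hv => ?_⟩
  simp only [dif_pos hv]
  exact hv.choose_spec

theorem rename_section {w : Fin N → Fin n} {s : Fin n → Fin N}
    (hs : ∀ v ∈ Set.range w, w (s v) = v) {p : MvPolynomial (Fin n) ℚ}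
    (hp : ∀ v ∈ p.vars, v ∈ Set.range w) : rename w (rename s p) = p := by
  rw [rename_rename]
  conv_rhs => rw [← rename_id_apply p]
  rw [rename_eq_aeval, rename_eq_aeval]
  exact eval₂Hom_congr' rfl (fun v hv _ => by simp [hs v (hp v hv)]) rfl

theorem domainPoly_mem_solIdeal (S : Set (Fin n → D)) (v : Fin n) :
    domainPoly D v ∈ solIdeal S := by
  refine mem_solIdeal.2 fun φ _ => ?_
  rw [domainPoly, map_prod]
  exact Finset.prod_eq_zero (φ v).2 (by simp [toPt])

theorem lm_domainPoly (v : Fin n) : lm (domainPoly D v) = Finsupp.single v D.card := by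
  rw [lm, domainPoly, MonomialOrder.degree_prod fun ρ _ => X_sub_C_ne_zero' v ρ]
  rw [Finset.sum_congr rfl fun ρ _ => lm_X_sub_C v ρ]
  simp

theorem domainPoly_ne_zero (v : Fin n) : domainPoly D v ≠ 0 :=
  Finset.prod_ne_zero_iff.2 fun ρ _ => X_sub_C_ne_zero' v ρ

theorem IsReducedIn.lm_le_card {S : Set (Fin n → D)} {g : MvPolynomial (Fin n) ℚ}
    (hg : IsReducedIn ((solIdeal S).restrictScalars ℚ) g) (v : Fin n) : lm g v ≤ D.card := by
  by_contra hcon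
  push Not at hcon
  have := hg.2.2 _ (domainPoly_mem_solIdeal S v) (domainPoly_ne_zero v) _
    (MonomialOrder.degLex.degree_mem_support hg.isTailReduced.ne_zero) (by
      rw [lm_domainPoly]
      intro u
      rw [Finsupp.single_apply]
      split_ifs with h
      · subst h; exact hcon.le
      · exact Nat.zero_le _)
  have h2 := DFunLike.congr_fun this.2 v
  rw [lm_domainPoly, Finsupp.single_eq_same] at h2
  omega

/-- For every pattern there are finitely many polynomials among which the elements of the reduced
Gröbner basis in the corresponding variables are found. -/
theorem exists_candidates [NeZero N] (O : Fin N → Fin N → Prop) (P : Set (Fin N → D)) :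
    ∃ L : List (MvPolynomial (Fin N) ℚ), (∀ g ∈ L, ∀ a ∈ P, eval (toPt a) g = 0) ∧
      ∀ (n : ℕ) (S : Set (Fin n → D)) (w : Fin N → Fin n), Realizes O P S w →
        ∀ g, IsReducedIn ((solIdeal S).restrictScalars ℚ) g → (∀ v ∈ g.vars, v ∈ Set.range w) →
          ∃ g₀ ∈ L, rename w g₀ = g := by
  classical
  -- One candidate is chosen per leading exponent `t`, from any realization of the pattern. By
  -- uniqueness of tail-reduced elements it serves all realizations. Finitely many exponents
  -- suffice: domain polynomials bound each exponent by `|D|`, and there are at most `N` distinct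
  -- variables.
  let Q : (Fin N → Fin (N * D.card + 1)) → MvPolynomial (Fin N) ℚ → Prop := fun t g₀ =>
    ∃ (n : ℕ) (S : Set (Fin n → D)) (w : Fin N → Fin n), Realizes O P S w ∧
      IsReducedIn (localSpace S w) (rename w g₀) ∧
      lm (rename w g₀) = (Finsupp.equivFunOnFinite.symm fun l => (t l : ℕ)).mapDomain w
  let c : (Fin N → Fin (N * D.card + 1)) → MvPolynomial (Fin N) ℚ := fun t =>
    if h : ∃ g₀, Q t g₀ then h.choose else 0
  have hc : ∀ t, (∃ g₀, Q t g₀) → Q t (c t) := fun t h => by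
    simp only [c, dif_pos h]
    exact h.choose_spec
  refine ⟨Finset.univ.toList.map c, ?_, ?_⟩
  · intro g hg a ha
    obtain ⟨t, -, rfl⟩ := List.mem_map.1 hg
    by_cases h : ∃ g₀, Q t g₀
    · obtain ⟨n, S, w, hr, hred, -⟩ := hc t h
      have := (mem_localSpace.1 hred.1).1
      rw [rename_mem_solIdeal, hr.2] at this
      exact this a ha
    · simp only [c, dif_neg h, map_zero]
  · intro n S w hr g hg hv
    obtain ⟨s, hs⟩ := exists_rename_of_vars w
    have hgs := rename_section hs hv
    have hsupp : ∀ v ∈ (lm g).support, v ∈ Set.range w := fun v hv' =>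
      hv v ((mem_vars_iff_mem_support v).2
        ⟨_, MonomialOrder.degLex.degree_mem_support hg.isTailReduced.ne_zero, hv'⟩)
    have hdeg : (lm g).degree ≤ N * D.card := by
      have h1 : (lm g).support.card ≤ N := by
        have : (lm g).support ⊆ Finset.univ.image w := fun v hv' => by
          obtain ⟨l, rfl⟩ := hsupp v hv'
          exact Finset.mem_image_of_mem _ (Finset.mem_univ l)
        simpa using (Finset.card_le_card this).trans Finset.card_image_le
      calc (lm g).degree ≤ (lm g).support.card * D.card :=
            Finset.sum_le_card_nsmul _ _ _ fun v _ => hg.lm_le_card v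
        _ ≤ N * D.card := Nat.mul_le_mul_right _ h1
    let t₀ : Fin N →₀ ℕ := (lm g).mapDomain s
    have ht₀ : ∀ l, t₀ l < N * D.card + 1 := fun l => by
      have : t₀ l ≤ t₀.degree := Finsupp.le_degree l t₀
      rw [Finsupp.degree_mapDomain] at this
      omega
    have hlm : t₀.mapDomain w = lm g := by
      rw [← Finsupp.mapDomain_comp]
      conv_rhs => rw [← Finsupp.mapDomain_id (v := lm g)]
      exact Finsupp.mapDomain_congr fun v hv' => hs v (hsupp v hv')
    have hred : IsReducedIn (localSpace S w) g := hg.mono inf_le_left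
      (mem_localSpace.2 ⟨hg.1, _, hgs⟩)
    let t : Fin N → Fin (N * D.card + 1) := fun l => ⟨t₀ l, ht₀ l⟩
    have ht : (Finsupp.equivFunOnFinite.symm fun l => (t l : ℕ)) = t₀ := by
      ext l
      rfl
    have hQ : ∃ g₀, Q t g₀ := ⟨rename s g, n, S, w, hr, by rw [hgs]; exact hred, by
      rw [hgs, ht, hlm]⟩
    obtain ⟨n', S', w', hr', hred', hlm'⟩ := hc t hQ
    have h2 := hr'.isReducedIn hr hred'
    refine ⟨c t, List.mem_map.2 ⟨t, by simp, rfl⟩, ?_⟩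
    refine h2.1.isTailReduced.eq hred.isTailReduced ?_
    rw [h2.2 _ hlm', ht, hlm]

theorem exists_tuple_of_card_le {K : ℕ} {A : Finset (Fin n)} (hA : A.card ≤ K)
    (u : Fin K → Fin n) : ∃ v : Fin K → Fin n, ∀ x ∈ A, x ∈ Set.range v := by
  by_cases he : A = ∅
  · exact ⟨u, by simp [he]⟩
  · have hne : A.card ≠ 0 := fun h => he (Finset.card_eq_zero.1 h)
    -- The list of `A` is padded to length `K` by repeating its last element; the given `u` serves
    -- when `A` is empty.
    refine ⟨fun l => A.equivFin.symm ⟨min l (A.card - 1), by omega⟩, fun x hx => ?_⟩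
    set i := A.equivFin ⟨x, hx⟩ with hi
    refine ⟨⟨i, lt_of_lt_of_le i.2 hA⟩, ?_⟩
    have : (⟨min i (A.card - 1), by omega⟩ : Fin A.card) = i := by
      ext
      have := i.2
      simp only []
      omega
    simp only []
    rw [this, hi, Equiv.symm_apply_apply]

/-- Global reducedness is a condition on tuples of bounded length. -/
theorem isReducedIn_iff_forall {K : ℕ} [NeZero K] {S : Set (Fin n → D)}
    (hK : ∀ g, IsReducedIn ((solIdeal S).restrictScalars ℚ) g → g.vars.card ≤ K)
    (u : Fin K → Fin n) (g₀ : MvPolynomial (Fin K) ℚ) :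
    IsReducedIn ((solIdeal S).restrictScalars ℚ) (rename u g₀) ↔
      ∀ v : Fin K → Fin n, IsReducedIn (localSpace S (Fin.append u v)) (rename u g₀) := by
  have hu : ∀ v : Fin K → Fin n, rename (Fin.append u v) (rename (Fin.castAdd K) g₀) =
      rename u g₀ := by
    intro v
    rw [rename_rename]
    congr 2
    funext l
    simp
  constructor
  · intro hg v
    exact hg.mono inf_le_left (mem_localSpace.2 ⟨hg.1, _, hu v⟩)
  · intro hg
    refine ⟨(mem_localSpace.1 (hg u).1).1, (hg u).2.1, fun h hh h0 α hα hle => ?_⟩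
    -- A witness `h` against reducedness may be replaced by a reduced element, whose at most `K`
    -- variables fit into a tuple `v`.
    obtain ⟨k, hk, hkh⟩ := exists_isReducedIn_le (solIdeal S) hh h0
    obtain ⟨v, hv⟩ := exists_tuple_of_card_le (hK k hk) u
    obtain ⟨s, hs⟩ := exists_rename_of_vars v
    have hkv : k ∈ localSpace S (Fin.append u v) := by
      refine mem_localSpace.2 ⟨hk.1, rename (Fin.natAdd K) (rename s k), ?_⟩
      rw [rename_rename]
      conv_rhs => rw [← rename_section hs hv]
      congr 2
      funext l
      exact Fin.append_right u v l
    have h2 := (hg v).2.2 k hkv hk.isTailReduced.ne_zero α hα (hkh.trans hle)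
    refine ⟨h2.1, le_antisymm (h2.1 ▸ hle) (h2.2 ▸ hkh)⟩

end Local

/-! ### Path consistency -/

section Consistency

variable {D : Finset ℚ} {Γ : ConstraintLanguage D} {n : ℕ}

/-- The solutions of an instance as points of `D ^ n`. -/
def CSPInstance.solSet (𝒞 : CSPInstance Γ n) : Set (Fin n → D) :=
  {φ | ∀ c ∈ 𝒞.constraints, (fun j => φ (c.scope j)) ∈ Γ.rel c.rel}

theorem CSPInstance.combinatorialIdeal_eq (𝒞 : CSPInstance Γ n) :
    𝒞.combinatorialIdeal = solIdeal 𝒞.solSet := by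
  rw [combinatorialIdeal, solIdeal]
  congr 1
  ext x
  constructor
  · rintro ⟨φ, h, rfl⟩
    exact ⟨φ, h, rfl⟩
  · rintro ⟨φ, h, rfl⟩
    exact ⟨φ, h, rfl⟩

theorem IsPolymorphism.closedUnder {nabla : D → D → D → D}
    (hpol : IsPolymorphism Γ (fun v : Fin 3 → D => nabla (v 0) (v 1) (v 2))) (i : Fin Γ.size) :
    ClosedUnder nabla (Γ.rel i) := by
  intro φ hφ ψ hψ χ hχ
  refine hpol i ![φ, ψ, χ] fun l => ?_
  fin_cases l
  · exact hφ
  · exact hψ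
  · exact hχ

theorem CSPInstance.closedUnder_solSet {nabla : D → D → D → D}
    (hpol : IsPolymorphism Γ (fun v : Fin 3 → D => nabla (v 0) (v 1) (v 2)))
    (𝒞 : CSPInstance Γ n) : ClosedUnder nabla 𝒞.solSet :=
  fun _ hφ _ hψ _ hχ c hc => hpol.closedUnder c.rel _ (hφ c hc) _ (hψ c hc) _ (hχ c hc)

/-- The assignments to a tuple `w` of variables that are compatible with a family `F` of excluded
pairs. -/
def localSols {N : ℕ} (F : Fin n → Fin n → D → D → Prop) (w : Fin N → Fin n) :
    Set (Fin N → D) :=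
  {a | (∀ l m, ¬ F (w l) (w m) (a l) (a m)) ∧ ∀ l m, w l = w m → a l = a m}

/-- The family `F` of excluded pairs contains every pair that cannot be extended to the tuple
`w`. -/
def IsSaturatedAt {N : ℕ} (F : Fin n → Fin n → D → D → Prop) (w : Fin N → Fin n) : Prop :=
  ∀ l m a b, ¬ F (w l) (w m) a b → ∃ t ∈ localSols F w, t l = a ∧ t m = b

/-- The pairs generated by the pairs that are not excluded. -/
inductive PairClosure (nabla : D → D → D → D) (F : Fin n → Fin n → D → D → Prop) :
    Fin n → Fin n → D → D → Prop where
  | base {i j a b} : ¬ F i j a b → PairClosure nabla F i j a b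
  | step {i j a b a' b' a'' b''} : PairClosure nabla F i j a b → PairClosure nabla F i j a' b' →
      PairClosure nabla F i j a'' b'' → PairClosure nabla F i j (nabla a a' a'') (nabla b b' b'')

variable {nabla : D → D → D → D} {F : Fin n → Fin n → D → D → Prop}

namespace PairClosure

/-- Saturation at the tuple `(i, j, k, k, …)` yields path consistency, symmetry and the diagonal
condition together. All three then pass to `PairClosure`; the closure is formed because the pairs
that are not excluded need not be preserved by the operation, as the next extension argument
requires. -/
theorem exists_triangle {K : ℕ} (hK : 3 ≤ K)
    (hF : ∀ w : Fin K → Fin n, IsSaturatedAt F w)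
    {i j : Fin n} {a b : D} (h : ¬ F i j a b) (k : Fin n) :
    ∃ c, ¬ F i k a c ∧ ¬ F j k b c ∧ ¬ F j i b a ∧ (i = j → a = b) := by
  obtain ⟨t, ⟨h₁, h₂⟩, rfl, rfl⟩ := hF
    (fun l => if l.val = 0 then i else if l.val = 1 then j else k)
    ⟨0, by omega⟩ ⟨1, by omega⟩ a b (by simpa using h)
  refine ⟨t ⟨2, by omega⟩, ?_, ?_, ?_, ?_⟩
  · simpa using h₁ ⟨0, by omega⟩ ⟨2, by omega⟩
  · simpa using h₁ ⟨1, by omega⟩ ⟨2, by omega⟩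
  · simpa using h₁ ⟨1, by omega⟩ ⟨0, by omega⟩
  · intro e
    exact h₂ _ _ (by simpa using e)

theorem symm {K : ℕ} (hK : 3 ≤ K)
    (hF : ∀ w : Fin K → Fin n, IsSaturatedAt F w)
    {i j : Fin n} {a b : D} (h : PairClosure nabla F i j a b) :
    PairClosure nabla F j i b a := by
  induction h with
  | base h =>
    obtain ⟨c, -, -, h, -⟩ := exists_triangle hK hF h ‹_›
    exact base h
  | step _ _ _ h₁ h₂ h₃ => exact step h₁ h₂ h₃

theorem diag {K : ℕ} (hK : 3 ≤ K)
    (hF : ∀ w : Fin K → Fin n, IsSaturatedAt F w)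
    {i j : Fin n} {a b : D} (h : PairClosure nabla F i j a b) (e : i = j) :
    a = b := by
  induction h with
  | base h =>
    obtain ⟨c, -, -, -, h⟩ := exists_triangle hK hF h ‹_›
    exact h e
  | step _ _ _ h₁ h₂ h₃ => rw [h₁, h₂, h₃]

theorem triangle {K : ℕ} (hK : 3 ≤ K)
    (hF : ∀ w : Fin K → Fin n, IsSaturatedAt F w)
    {i j : Fin n} {a b : D} (h : PairClosure nabla F i j a b) (k : Fin n) :
    ∃ c, PairClosure nabla F i k a c ∧ PairClosure nabla F j k b c := by
  induction h with
  | base h =>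
    obtain ⟨c, h₁, h₂, -⟩ := exists_triangle hK hF h k
    exact ⟨c, base h₁, base h₂⟩
  | step _ _ _ h₁ h₂ h₃ =>
    obtain ⟨c₁, h₁, h₁'⟩ := h₁
    obtain ⟨c₂, h₂, h₂'⟩ := h₂
    obtain ⟨c₃, h₃, h₃'⟩ := h₃
    exact ⟨_, step h₁ h₂ h₃, step h₁' h₂' h₃'⟩

theorem left {K : ℕ} (hK : 3 ≤ K)
    (hF : ∀ w : Fin K → Fin n, IsSaturatedAt F w)
    {i j : Fin n} {a b : D} (h : PairClosure nabla F i j a b) :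
    PairClosure nabla F i i a a := by
  obtain ⟨c, h₁, -⟩ := triangle hK hF h i
  have := diag hK hF h₁ rfl
  rwa [← this] at h₁

/-- The assignments to `T` that have a common extension to `k` are closed under the majority
operation, so it suffices to match `φ` at two coordinates. A triangle over these two gives the value
`c`, and the remaining coordinates take any values compatible with `c`. -/
theorem exists_extension {K : ℕ} (hK : 3 ≤ K)
    (hF : ∀ w : Fin K → Fin n, IsSaturatedAt F w) (hmaj : IsMajority nabla)
    (T : Finset (Fin n)) (hT : T.Nonempty)
    (φ : Fin n → D) (hφ : ∀ i ∈ T, ∀ j ∈ T, PairClosure nabla F i j (φ i) (φ j)) (k : Fin n) :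
    ∃ c, ∀ i ∈ T, PairClosure nabla F i k (φ i) c := by
  let R : Set (T → D) := {t | ∃ c, ∀ i : T, PairClosure nabla F i k (t i) c}
  have hR : ClosedUnder nabla R := by
    rintro t₁ ⟨c₁, h₁⟩ t₂ ⟨c₂, h₂⟩ t₃ ⟨c₃, h₃⟩
    exact ⟨_, fun i => step (h₁ i) (h₂ i) (h₃ i)⟩
  have hpair : ∀ i j : T, ∃ t ∈ R, t i = φ i ∧ t j = φ j := by
    intro i j
    obtain ⟨c, h₁, h₂⟩ := triangle hK hF (hφ i i.2 j j.2) k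
    have hc := left hK hF (symm hK hF h₁)
    have hd : ∀ x : T, ∃ d, PairClosure nabla F x k d c := fun x => by
      obtain ⟨d, hd, -⟩ := triangle hK hF hc x
      exact ⟨d, symm hK hF hd⟩
    choose d hd using hd
    classical
    refine ⟨fun x => if x = i ∨ x = j then φ x else d x, ⟨c, fun x => ?_⟩, by simp, by simp⟩
    dsimp only
    split_ifs with hx
    · rcases hx with rfl | rfl
      · exact h₁
      · exact h₂
    · exact hd x
  obtain ⟨i₀, hi₀⟩ := hT
  obtain ⟨t, ht, -⟩ := hpair ⟨i₀, hi₀⟩ ⟨i₀, hi₀⟩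
  obtain ⟨c, hc⟩ := hR.mem_of_pairs hmaj ⟨t, ht⟩ (fun i => φ i) hpair
  exact ⟨c, fun i hi => hc ⟨i, hi⟩⟩

/-- A consistent pair is extended by one variable at a time, without backtracking. -/
theorem exists_global {K : ℕ} (hK : 3 ≤ K)
    (hF : ∀ w : Fin K → Fin n, IsSaturatedAt F w) (hmaj : IsMajority nabla) {i j : Fin n} {a b : D}
    (h : PairClosure nabla F i j a b) : ∃ φ : Fin n → D, φ i = a ∧ φ j = b ∧
      ∀ x y, PairClosure nabla F x y (φ x) (φ y) := by
  classical
  have key : ∀ T : Finset (Fin n), ∃ φ : Fin n → D, φ i = a ∧ φ j = b ∧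
      ∀ x ∈ insert i (insert j T), ∀ y ∈ insert i (insert j T),
        PairClosure nabla F x y (φ x) (φ y) := by
    intro T
    induction T using Finset.induction_on with
    | empty =>
      by_cases e : i = j
      · have := diag hK hF h e
        subst e this
        refine ⟨fun _ => a, rfl, rfl, ?_⟩
        intro x hx y hy
        simp only [insert_empty_eq, Finset.mem_insert, Finset.mem_singleton, or_self] at hx hy
        rw [hx, hy]
        exact h
      · refine ⟨fun x => if x = i then a else b, by simp, by simp [Ne.symm e], ?_⟩
        have hj := left hK hF (symm hK hF h)
        have hi := left hK hF h
        intro x hx y hy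
        simp only [insert_empty_eq, Finset.mem_insert, Finset.mem_singleton] at hx hy
        rcases hx with rfl | rfl <;> rcases hy with rfl | rfl <;>
          simp only [if_true, Ne.symm e, if_false]
        · exact hi
        · exact h
        · exact symm hK hF h
        · exact hj
    | insert k T _ ih =>
      obtain ⟨φ, h₁, h₂, h₃⟩ := ih
      by_cases hk : k ∈ insert i (insert j T)
      · refine ⟨φ, h₁, h₂, ?_⟩
        have : insert i (insert j (insert k T)) = insert i (insert j T) := by
          rw [Finset.insert_comm j, Finset.insert_comm i, Finset.insert_eq_of_mem hk]
        rwa [this]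
      · obtain ⟨c, hc⟩ := exists_extension hK hF hmaj _ ⟨i, by simp⟩ φ h₃ k
        have hki : i ≠ k := fun e => hk (by simp [e])
        have hkj : j ≠ k := fun e => hk (by simp [e])
        have hcc := left hK hF (symm hK hF (hc i (by simp)))
        refine ⟨Function.update φ k c, by simp [hki, h₁], by simp [hkj, h₂], ?_⟩
        rw [Finset.insert_comm j, Finset.insert_comm i]
        intro x hx y hy
        rw [Finset.mem_insert] at hx hy
        by_cases ex : x = k <;> by_cases ey : y = k
        · subst ex ey
          simpa using hcc
        · subst ex
          simpa [ey] using symm hK hF (hc y (hy.resolve_left ey))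
        · subst ey
          simpa [ex] using hc x (hx.resolve_left ex)
        · simpa [ex, ey] using h₃ x (hx.resolve_left ex) y (hy.resolve_left ey)
  obtain ⟨φ, h₁, h₂, h₃⟩ := key Finset.univ
  exact ⟨φ, h₁, h₂, fun x y => h₃ x (by simp) y (by simp)⟩

end PairClosure

/-- A saturated family of excluded pairs describes all projections of the set of solutions. -/
theorem image_solSet_eq_localSols {K : ℕ} (hK : 3 ≤ K)
    (hF : ∀ w : Fin K → Fin n, IsSaturatedAt F w) (hmaj : IsMajority nabla)
    (hpol : IsPolymorphism Γ (fun v : Fin 3 → D => nabla (v 0) (v 1) (v 2)))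
    {𝒞 : CSPInstance Γ n} (hne : ∀ c ∈ 𝒞.constraints, (Γ.rel c.rel).Nonempty)
    (hbase : ∀ c ∈ 𝒞.constraints, ∀ j j' a b, (¬ ∃ t ∈ Γ.rel c.rel, t j = a ∧ t j' = b) →
      F (c.scope j) (c.scope j') a b)
    (hsound : ∀ φ ∈ 𝒞.solSet, ∀ i j, ¬ F i j (φ i) (φ j)) {N : ℕ} [NeZero N]
    (w : Fin N → Fin n) : (fun φ => φ ∘ w) '' 𝒞.solSet = localSols F w := by
  have hext : ∀ i j a b, ¬ F i j a b → ∃ φ ∈ 𝒞.solSet, φ i = a ∧ φ j = b := by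
    intro i j a b h
    obtain ⟨φ, h₁, h₂, h₃⟩ :=
      PairClosure.exists_global hK hF hmaj (.base h : PairClosure nabla F i j a b)
    refine ⟨φ, fun c hc => ?_, h₁, h₂⟩
    have hcl := hpol.closedUnder c.rel
    refine hcl.mem_of_pairs hmaj (hne c hc) _ fun j j' => ?_
    -- Pairs not excluded occur in the relation by `hbase`, and the binary projections of the
    -- relation are closed under the operation, so closure pairs occur as well. The indices are
    -- generalized for the induction.
    have : ∀ i' k' a b, PairClosure nabla F i' k' a b → i' = c.scope j → k' = c.scope j' →
        ∃ t ∈ Γ.rel c.rel, t j = a ∧ t j' = b := by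
      intro i' k' a b h
      induction h with
      | base h =>
        rintro rfl rfl
        by_contra hcon
        exact h (hbase c hc j j' _ _ hcon)
      | step _ _ _ h₁ h₂ h₃ =>
        intro e e'
        obtain ⟨t₁, m₁, rfl, rfl⟩ := h₁ e e'
        obtain ⟨t₂, m₂, rfl, rfl⟩ := h₂ e e'
        obtain ⟨t₃, m₃, rfl, rfl⟩ := h₃ e e'
        exact ⟨_, hcl _ m₁ _ m₂ _ m₃, rfl, rfl⟩
    exact this _ _ _ _ (h₃ (c.scope j) (c.scope j')) rfl rfl
  apply Set.Subset.antisymm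
  · rintro _ ⟨φ, hφ, rfl⟩
    exact ⟨fun l l' => hsound φ hφ _ _, fun l l' e => congrArg φ e⟩
  · rintro a ⟨h₁, -⟩
    have hcl : ClosedUnder nabla ((fun φ => φ ∘ w) '' 𝒞.solSet) := by
      rintro _ ⟨φ, hφ, rfl⟩ _ ⟨ψ, hψ, rfl⟩ _ ⟨χ, hχ, rfl⟩
      exact ⟨_, 𝒞.closedUnder_solSet hpol φ hφ ψ hψ χ hχ, rfl⟩
    have hp : ∀ l l', ∃ t ∈ (fun φ => φ ∘ w) '' 𝒞.solSet, t l = a l ∧ t l' = a l' := by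
      intro l l'
      obtain ⟨φ, hφ, e₁, e₂⟩ := hext _ _ _ _ (h₁ l l')
      exact ⟨_, ⟨φ, hφ, rfl⟩, e₁, e₂⟩
    -- A slot is needed to see that there is a solution at all: the empty assignment is compatible
    -- with every table.
    obtain ⟨t, ht, -⟩ := hp 0 0
    exact hcl.mem_of_pairs hmaj ⟨t, ht⟩ a hp

end Consistency

/-! ### Derivations in Polynomial Calculus -/

section PC

variable {D : Finset ℚ} {n : ℕ}

/-- `x` follows from the lines `π` by one inference of Polynomial Calculus. -/
def PCStep (D : Finset ℚ) (P : Set (MvPolynomial (Fin n) ℚ)) (π : List (MvPolynomial (Fin n) ℚ))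
    (x : MvPolynomial (Fin n) ℚ) : Prop :=
  x ∈ P ∨ (∃ v, x = domainPoly D v) ∨ (∃ y ∈ π, ∃ z ∈ π, ∃ a b : ℚ, x = C a * y + C b * z) ∨
    ∃ y ∈ π, ∃ v, x = X v * y

/-- Derivations, built line by line. -/
inductive PCList (D : Finset ℚ) (P : Set (MvPolynomial (Fin n) ℚ)) :
    List (MvPolynomial (Fin n) ℚ) → Prop where
  | nil : PCList D P []
  | snoc {π x} : PCList D P π → PCStep D P π x → PCList D P (π ++ [x])

variable {P Q : Set (MvPolynomial (Fin n) ℚ)} {π ℓ : List (MvPolynomial (Fin n) ℚ)}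

theorem PCStep.mono {x : MvPolynomial (Fin n) ℚ} (h : PCStep D P π x) (hπ : ∀ y ∈ π, y ∈ ℓ) :
    PCStep D P ℓ x := by
  rcases h with h | h | ⟨y, hy, z, hz, a, b, e⟩ | ⟨y, hy, v, e⟩
  · exact Or.inl h
  · exact Or.inr (Or.inl h)
  · exact Or.inr (Or.inr (Or.inl ⟨y, hπ y hy, z, hπ z hz, a, b, e⟩))
  · exact Or.inr (Or.inr (Or.inr ⟨y, hπ y hy, v, e⟩))

theorem PCList.step_take (h : PCList D P π) (i : ℕ) (hi : i < π.length) :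
    PCStep D P (π.take i) π[i] := by
  induction h with
  | nil => simp at hi
  | @snoc π x _ hx ih =>
    by_cases h : i < π.length
    · rw [List.getElem_append_left h, List.take_append_of_le_length h.le]
      exact ih h
    · have : i = π.length := by
        rw [List.length_append, List.length_singleton] at hi
        omega
      subst this
      simpa using hx

theorem PCList.isPCDerivation (h : PCList D P π) : IsPCDerivation D P π := by
  intro i
  have hmem : ∀ y ∈ π.take i, ∃ j < i, π.get j = y := by
    intro y hy
    obtain ⟨j, hj, e⟩ := List.mem_take_iff_getElem.1 hy
    exact ⟨⟨j, by omega⟩, by rw [Fin.lt_def]; exact (lt_min_iff.1 hj).1, e⟩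
  rcases h.step_take i i.2 with h | h | ⟨y, hy, z, hz, a, b, e⟩ | ⟨y, hy, v, e⟩
  · exact Or.inl h
  · exact Or.inr (Or.inl h)
  · obtain ⟨j, hj, rfl⟩ := hmem y hy
    obtain ⟨k, hk, rfl⟩ := hmem z hz
    exact Or.inr (Or.inr (Or.inl ⟨j, hj, k, hk, a, b, e⟩))
  · obtain ⟨j, hj, rfl⟩ := hmem y hy
    exact Or.inr (Or.inr (Or.inr ⟨j, hj, v, e⟩))

/-- Soundness of the calculus. It shows that the table excludes only pairs taken by no solution, so
soundness is not tracked separately along the run. -/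
theorem PCList.eval_eq_zero (h : PCList D P π) {φ : Fin n → D}
    (hP : ∀ p ∈ P, eval (toPt φ) p = 0) : ∀ p ∈ π, eval (toPt φ) p = 0 := by
  induction h with
  | nil => simp
  | @snoc π x _ hx ih =>
    intro p hp
    rw [List.mem_append, List.mem_singleton] at hp
    rcases hp with hp | rfl
    · exact ih p hp
    rcases hx with h | ⟨v, rfl⟩ | ⟨y, hy, z, hz, a, b, rfl⟩ | ⟨y, hy, v, rfl⟩
    · exact hP _ h
    · exact mem_solIdeal.1 (domainPoly_mem_solIdeal Set.univ v) φ trivial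
    · simp [ih y hy, ih z hz]
    · simp [ih y hy]

/-- A derivation may be continued by one that uses its lines, and zero, as premises. -/
theorem PCList.append (h : PCList D P π) (hne : π ≠ [])
    (hℓ : PCList D (P ∪ {x | x ∈ π ∨ x = 0}) ℓ) : PCList D P (π ++ ℓ) := by
  induction hℓ with
  | nil => simpa using h
  | @snoc ℓ x _ hx ih =>
    rw [← List.append_assoc]
    refine .snoc ih ?_
    obtain ⟨y₀, hy₀⟩ := List.exists_mem_of_ne_nil π hne
    rcases hx with (h | h | rfl) | hx
    · exact Or.inl h
    · exact Or.inr (Or.inr (Or.inl ⟨x, by simp [h], x, by simp [h], 1, 0, by simp⟩))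
    · exact Or.inr (Or.inr (Or.inl ⟨y₀, by simp [hy₀], y₀, by simp [hy₀], 0, 0, by simp⟩))
    · have : PCStep D P ℓ x := Or.inr hx
      exact this.mono fun y hy => List.mem_append_right _ hy

theorem PCList.mono_premises (hPQ : P ⊆ Q) (h : PCList D P π) : PCList D Q π := by
  induction h with
  | nil => exact .nil
  | snoc _ hx ih =>
    exact .snoc ih (hx.imp_left fun h => hPQ h)

theorem PCList.append_same (h : PCList D P π) (hℓ : PCList D P ℓ) : PCList D P (π ++ ℓ) := by
  rcases eq_or_ne π [] with rfl | hne
  · simpa using hℓ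
  · exact h.append hne (hℓ.mono_premises Set.subset_union_left)

theorem rename_domainPoly {N : ℕ} (w : Fin N → Fin n) (v : Fin N) :
    rename w (domainPoly D v) = domainPoly D (w v) := by
  simp [domainPoly, map_prod]

theorem PCList.rename {N : ℕ} {P : Set (MvPolynomial (Fin N) ℚ)}
    {π : List (MvPolynomial (Fin N) ℚ)} (h : PCList D P π) (w : Fin N → Fin n) :
    PCList D (MvPolynomial.rename w '' P) (π.map (MvPolynomial.rename w)) := by
  induction h with
  | nil => exact .nil
  | @snoc π x _ hx ih =>
    rw [List.map_append, List.map_singleton]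
    refine .snoc ih ?_
    rcases hx with h | ⟨v, rfl⟩ | ⟨y, hy, z, hz, a, b, rfl⟩ | ⟨y, hy, v, rfl⟩
    · exact Or.inl (Set.mem_image_of_mem _ h)
    · exact Or.inr (Or.inl ⟨w v, rename_domainPoly w v⟩)
    · exact Or.inr (Or.inr (Or.inl ⟨_, List.mem_map_of_mem hy, _, List.mem_map_of_mem hz, a, b,
        by simp⟩))
    · exact Or.inr (Or.inr (Or.inr ⟨_, List.mem_map_of_mem hy, w v, by simp⟩))

/-- The members of the ideal generated by the premises and the domain polynomials are derivable. -/
theorem exists_pcList_of_mem_span {g₀ : MvPolynomial (Fin n) ℚ}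
    (hg₀ : g₀ ∈ P ∪ Set.range (domainPoly D)) {g : MvPolynomial (Fin n) ℚ}
    (hg : g ∈ Ideal.span (P ∪ Set.range (domainPoly D))) : ∃ π, PCList D P π ∧ g ∈ π := by
  have hmem : ∀ x ∈ P ∪ Set.range (domainPoly D), ∃ π, PCList D P π ∧ x ∈ π := by
    rintro x (h | ⟨v, rfl⟩)
    · exact ⟨[x], .snoc .nil (Or.inl h), by simp⟩
    · exact ⟨[domainPoly D v], .snoc .nil (Or.inr (Or.inl ⟨v, rfl⟩)), by simp⟩
  have hlin : ∀ (a b : ℚ) (x y : MvPolynomial (Fin n) ℚ), (∃ π, PCList D P π ∧ x ∈ π) →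
      (∃ π, PCList D P π ∧ y ∈ π) → ∃ π, PCList D P π ∧ C a * x + C b * y ∈ π := by
    rintro a b x y ⟨π₁, h₁, m₁⟩ ⟨π₂, h₂, m₂⟩
    exact ⟨π₁ ++ π₂ ++ [C a * x + C b * y], .snoc (h₁.append_same h₂)
      (Or.inr (Or.inr (Or.inl ⟨x, by simp [m₁], y, by simp [m₂], a, b, rfl⟩))), by simp⟩
  have hX : ∀ (v : Fin n) (x : MvPolynomial (Fin n) ℚ), (∃ π, PCList D P π ∧ x ∈ π) →
      ∃ π, PCList D P π ∧ X v * x ∈ π := by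
    rintro v x ⟨π, h, m⟩
    exact ⟨π ++ [X v * x], .snoc h (Or.inr (Or.inr (Or.inr ⟨x, m, v, rfl⟩))), by simp⟩
  refine Submodule.span_induction (p := fun x _ => ∃ π, PCList D P π ∧ x ∈ π) hmem ?_ ?_ ?_ hg
  · simpa using hlin 0 0 _ _ (hmem g₀ hg₀) (hmem g₀ hg₀)
  · intro x y _ _ hx hy
    simpa using hlin 1 1 _ _ hx hy
  · intro p x _ hx
    rw [smul_eq_mul]
    induction p using MvPolynomial.induction_on with
    | C a => simpa using hlin a 0 _ _ hx hx
    | add p q hp hq =>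
      rw [add_mul]
      simpa using hlin 1 1 _ _ hp hq
    | mul_X p v hp =>
      rw [mul_comm p, mul_assoc]
      exact hX v _ hp

/-- The polynomial `∏ (x_i - ρ)` over all `ρ ≠ a` in the domain. -/
noncomputable def deltaPoly (a : D) (i : Fin n) : MvPolynomial (Fin n) ℚ :=
  ∏ ρ ∈ D.erase a, (X i - C ρ)

theorem eval_deltaPoly (a : D) (i : Fin n) (φ : Fin n → D) :
    eval (toPt φ) (deltaPoly a i) ≠ 0 ↔ φ i = a := by
  rw [deltaPoly, map_prod, Finset.prod_ne_zero_iff]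
  simp only [map_sub, eval_X, eval_C, toPt, sub_ne_zero]
  constructor
  · intro h
    by_contra hne
    exact h (φ i) (Finset.mem_erase.2 ⟨fun e => hne (Subtype.ext e), (φ i).2⟩) rfl
  · rintro rfl ρ hρ e
    exact (Finset.mem_erase.1 hρ).1 e.symm

/-- The polynomial that excludes the values `a` of `x_i` and `b` of `x_j` at the same time. -/
noncomputable def factPoly (i j : Fin n) (a b : D) : MvPolynomial (Fin n) ℚ :=
  deltaPoly a i * deltaPoly b j

theorem eval_factPoly (i j : Fin n) (a b : D) (φ : Fin n → D) :
    eval (toPt φ) (factPoly i j a b) = 0 ↔ ¬ (φ i = a ∧ φ j = b) := by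
  rw [← eval_deltaPoly, ← eval_deltaPoly, factPoly, map_mul, mul_eq_zero]
  tauto

theorem rename_factPoly {N : ℕ} (w : Fin N → Fin n) (i j : Fin N) (a b : D) :
    rename w (factPoly i j a b) = factPoly (w i) (w j) a b := by
  simp [factPoly, deltaPoly, map_prod]

/-- Hilbert's Nullstellensatz over the grid `D ^ n`. -/
theorem mem_span_of_vanishing {g : MvPolynomial (Fin n) ℚ}
    (hg : ∀ φ : Fin n → D, (∀ p ∈ P, eval (toPt φ) p = 0) → eval (toPt φ) g = 0) :
    g ∈ Ideal.span (P ∪ Set.range (domainPoly D)) := by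
  classical
  set I := Ideal.span (P ∪ Set.range (domainPoly (n := n) D)) with hI
  -- The combinatorial Nullstellensatz needs a nonempty grid. For empty `D` a domain polynomial is
  -- `1`, unless there are no variables and all polynomials are constants.
  rcases D.eq_empty_or_nonempty with rfl | hD
  · rcases isEmpty_or_nonempty (Fin n) with he | ⟨⟨v⟩⟩
    · obtain ⟨c, rfl⟩ := C_surjective (R := ℚ) (Fin n) g
      by_cases hc : c = 0
      · rw [hc, map_zero]
        exact I.zero_mem
      · have : ∃ p ∈ P, eval (toPt (fun v => he.elim v : Fin n → (∅ : Finset ℚ))) p ≠ 0 := by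
          by_contra hcon
          push Not at hcon
          exact hc (by simpa using hg _ hcon)
        obtain ⟨p, hp, hp0⟩ := this
        obtain ⟨d, rfl⟩ := C_surjective (R := ℚ) (Fin n) p
        rw [eval_C] at hp0
        have : (C c : MvPolynomial (Fin n) ℚ) = C (c / d) * C d := by
          rw [← C_mul, div_mul_cancel₀ _ hp0]
        rw [this]
        exact I.mul_mem_left _ (Ideal.subset_span (Or.inl hp))
    · have h1 : (1 : MvPolynomial (Fin n) ℚ) ∈ I :=
        Ideal.subset_span (Or.inr ⟨v, by simp [domainPoly]⟩)
      rw [(Ideal.eq_top_iff_one I).2 h1]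
      trivial
  have hvan : ∀ f : MvPolynomial (Fin n) ℚ, (∀ φ : Fin n → D, eval (toPt φ) f = 0) → f ∈ I := by
    intro f hf
    obtain ⟨h, -, e⟩ := combinatorial_nullstellensatz_exists_linearCombination (fun _ => D)
      (fun _ => hD) f fun x hx => hf fun v => ⟨x v, hx v⟩
    rw [e, Finsupp.linearCombination_apply]
    exact I.sum_mem fun v _ => I.mul_mem_left _ (Ideal.subset_span (Or.inr ⟨v, rfl⟩))
  -- Interpolation inside the ideal: where `g` is nonzero some premise `p` is too, and a scaled
  -- indicator of the point times `p` has the value of `g` there. Subtracting all these from `g`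
  -- leaves a polynomial vanishing on the whole grid.
  have hpt : ∀ ψ : Fin n → D, ∃ r ∈ I, eval (toPt ψ) r = eval (toPt ψ) g ∧
      ∀ φ : Fin n → D, φ ≠ ψ → eval (toPt φ) r = 0 := by
    intro ψ
    by_cases h0 : eval (toPt ψ) g = 0
    · exact ⟨0, I.zero_mem, by simp [h0], by simp⟩
    · have : ∃ p ∈ P, eval (toPt ψ) p ≠ 0 := by
        by_contra hcon
        push Not at hcon
        exact h0 (hg ψ hcon)
      obtain ⟨p, hp, hp0⟩ := this
      set δ : MvPolynomial (Fin n) ℚ := ∏ v, deltaPoly (ψ v) v with hδ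
      have hδψ : eval (toPt ψ) δ ≠ 0 := by
        rw [hδ, map_prod]
        exact Finset.prod_ne_zero_iff.2 fun v _ => (eval_deltaPoly _ _ _).2 rfl
      refine ⟨C (eval (toPt ψ) g / (eval (toPt ψ) δ * eval (toPt ψ) p)) * δ * p,
        I.mul_mem_left _ (Ideal.subset_span (Or.inl hp)), ?_, fun φ hφ => ?_⟩
      · rw [map_mul, map_mul, eval_C]
        field_simp
      · obtain ⟨v, hv⟩ := Function.ne_iff.1 hφ
        have : eval (toPt φ) δ = 0 := by
          rw [hδ, map_prod]
          refine Finset.prod_eq_zero (Finset.mem_univ v) ?_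
          by_contra h
          exact hv ((eval_deltaPoly _ _ _).1 h)
        rw [map_mul, map_mul, this, mul_zero, zero_mul]
  choose r hrI hr hr' using hpt
  have hsum : ∑ ψ, r ψ ∈ I := I.sum_mem fun ψ _ => hrI ψ
  have hdiff : g - ∑ ψ, r ψ ∈ I := by
    refine hvan _ fun φ => ?_
    rw [map_sub, map_sum, Finset.sum_eq_single φ (fun ψ _ hne => hr' ψ φ hne.symm) (by simp), hr,
      sub_self]
  have := I.add_mem hdiff hsum
  rwa [sub_add_cancel] at this

/-! ### Sums of terms -/

theorem SparsePoly.exists_toPoly (p : MvPolynomial (Fin n) ℚ) :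
    ∃ s : SparsePoly n, s.toPoly = p := by
  induction p using MvPolynomial.induction_on with
  | C a => exact ⟨[(a, [])], by simp [toPoly]⟩
  | add p q hp hq =>
    obtain ⟨s, rfl⟩ := hp
    obtain ⟨t, rfl⟩ := hq
    exact ⟨s ++ t, by simp [toPoly]⟩
  | mul_X p v hp =>
    obtain ⟨s, rfl⟩ := hp
    refine ⟨s.map fun t => (t.1, v :: t.2), ?_⟩
    rw [toPoly, toPoly, List.map_map, ← List.sum_map_mul_right]
    congr 1
    refine List.map_congr_left fun t _ => ?_
    simp only [Function.comp_apply, List.map_cons, List.prod_cons]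
    ring

/-- Some way to write a polynomial as a sum of terms. -/
noncomputable def sparse (p : MvPolynomial (Fin n) ℚ) : SparsePoly n :=
  (SparsePoly.exists_toPoly p).choose

@[simp] theorem toPoly_sparse (p : MvPolynomial (Fin n) ℚ) : (sparse p).toPoly = p :=
  (SparsePoly.exists_toPoly p).choose_spec

/-- Renaming of the variables of a sum of terms. -/
def SparsePoly.ren {N : ℕ} (w : Fin N → Fin n) (s : SparsePoly N) : SparsePoly n :=
  s.map fun t => (t.1, t.2.map w)

theorem SparsePoly.toPoly_ren {N : ℕ} (w : Fin N → Fin n) (s : SparsePoly N) :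
    (s.ren w).toPoly = rename w s.toPoly := by
  rw [toPoly, toPoly, ren, List.map_map, map_list_sum, List.map_map]
  congr 1
  refine List.map_congr_left fun t _ => ?_
  simp [map_list_prod, Function.comp_def]

/-- Derivation of finitely many consequences, written out. -/
theorem exists_sparse_derivation {g₀ : MvPolynomial (Fin n) ℚ}
    (hg₀ : g₀ ∈ P ∪ Set.range (domainPoly D)) (L : List (MvPolynomial (Fin n) ℚ))
    (hL : ∀ g ∈ L, ∀ φ : Fin n → D, (∀ p ∈ P, eval (toPt φ) p = 0) → eval (toPt φ) g = 0) :
    ∃ ℓ : List (SparsePoly n), PCList D P (ℓ.map SparsePoly.toPoly) ∧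
      ∀ g ∈ L, g ∈ ℓ.map SparsePoly.toPoly := by
  have : ∃ π, PCList D P π ∧ ∀ g ∈ L, g ∈ π := by
    induction L with
    | nil => exact ⟨[], .nil, by simp⟩
    | cons g L ih =>
      obtain ⟨π, h₁, h₂⟩ := ih fun g hg => hL g (List.mem_cons_of_mem _ hg)
      obtain ⟨ℓ, h₃, h₄⟩ := exists_pcList_of_mem_span hg₀
        (mem_span_of_vanishing (hL g List.mem_cons_self))
      refine ⟨π ++ ℓ, h₁.append_same h₃, fun g' hg' => ?_⟩
      rcases List.mem_cons.1 hg' with rfl | h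
      · exact List.mem_append_right _ h₄
      · exact List.mem_append_left _ (h₂ g' h)
  obtain ⟨π, h₁, h₂⟩ := this
  have e : (π.map sparse).map SparsePoly.toPoly = π := by
    rw [List.map_map]
    conv_rhs => rw [← List.map_id π]
    exact List.map_congr_left fun p _ => toPoly_sparse p
  exact ⟨π.map sparse, by rwa [e], by rwa [e]⟩

end PC

/-! ### Programs of the random access machine -/

namespace RAM

theorem Memory.write_same (s : Memory) (a i x : ℕ) : s.write a i x a i = x := by
  simp [Memory.write]

theorem Memory.write_of_ne_index (s : Memory) (a : ℕ) {i j : ℕ} (x : ℕ) (h : j ≠ i) :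
    s.write a i x a j = s a j := by
  simp [Memory.write, h]

theorem Memory.write_of_ne (s : Memory) {a b : ℕ} (i x : ℕ) (h : b ≠ a) :
    s.write a i x b = s b := by
  simp [Memory.write, h]

/-- The program assigns only to arrays in `A`, and it changes the output pointer, cell `0` of
array `3`, only by incrementing it. -/
def Prog.Ok (A : Set ℕ) : Prog → Prop
  | .assign a i e => a ∈ A ∧
      (a = 3 → i = .const 0 ∧ e = .add (.read 3 (.const 0)) (.const 1))
  | .seq p q => p.Ok A ∧ q.Ok A
  | .ite _ p q => p.Ok A ∧ q.Ok A
  | .loop _ p => p.Ok A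

theorem Prog.Ok.mono {A B : Set ℕ} (hAB : A ⊆ B) {p : Prog} (h : p.Ok A) : p.Ok B := by
  induction p with
  | assign a i e => exact ⟨hAB h.1, h.2⟩
  | seq p q hp hq => exact ⟨hp h.1, hq h.2⟩
  | ite e p q hp hq => exact ⟨hp h.1, hq h.2⟩
  | loop e p hp => exact hp h

/-- Arrays have fixed roles, so disjointness of array numbers gives noninterference: `0` input, `1`
output, `2` the number `n`, `3` output pointer, `4` multiples of `n`, `5` input position, `6` flag
for an empty relation, `7` test flag, `9` scratch, `10 + 2r` loop registers, `11 + 2c` excluded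
pairs. -/
theorem Runs.frame {A : Set ℕ} {p : Prog} {s s' : Memory} {t : ℕ} (h : Runs p s s' t)
    (hp : p.Ok A) {a : ℕ} (ha : a ∉ A) : s' a = s a := by
  induction h with
  | assign b i e s => exact Memory.write_of_ne _ _ _ fun hab => ha (hab ▸ hp.1)
  | seq _ _ h₁ h₂ => rw [h₂ hp.2, h₁ hp.1]
  | ite_true _ _ h => exact h hp.1
  | ite_false _ _ h => exact h hp.2
  | loop_true _ _ _ h₁ h₂ => rw [h₂ hp, h₁ hp]
  | loop_false _ => rfl

/-- The pointer grows by at most one per step, so the time bound also bounds the length of the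
output. -/
theorem Runs.pointer_le {A : Set ℕ} {p : Prog} {s s' : Memory} {t : ℕ} (h : Runs p s s' t)
    (hp : p.Ok A) : s' 3 0 ≤ s 3 0 + t := by
  induction h with
  | assign b i e s =>
    by_cases hb : b = 3
    · subst hb
      obtain ⟨rfl, rfl⟩ := hp.2 rfl
      simp [Expr.eval, Memory.write_same]
    · rw [Memory.write_of_ne _ _ _ (Ne.symm hb)]
      omega
  | seq _ _ h₁ h₂ =>
    have h₁ := h₁ hp.1
    have h₂ := h₂ hp.2
    omega
  | ite_true _ _ h => have := h hp.1; omega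
  | ite_false _ _ h => have := h hp.2; omega
  | loop_true _ _ _ h₁ h₂ =>
    have h₁ := h₁ hp
    have h₂ := h₂ hp
    omega
  | loop_false _ => omega

/-- `p` takes `s` to `s'` in at most `T` steps. -/
def Exec (p : Prog) (s s' : Memory) (T : ℕ) : Prop := ∃ t ≤ T, Runs p s s' t

namespace Exec

variable {p q : Prog} {s s' s'' : Memory} {T T' : ℕ}

theorem mono (h : Exec p s s' T) (hT : T ≤ T') : Exec p s s' T' :=
  let ⟨t, ht, hr⟩ := h
  ⟨t, ht.trans hT, hr⟩

theorem frame {A : Set ℕ} (h : Exec p s s' T) (hp : p.Ok A) {a : ℕ} (ha : a ∉ A) : s' a = s a :=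
  let ⟨_, _, hr⟩ := h
  hr.frame hp ha

theorem assign (a : ℕ) (i e : Expr) (s : Memory) :
    Exec (.assign a i e) s (s.write a (i.eval s) (e.eval s)) 1 :=
  ⟨1, le_rfl, .assign a i e s⟩

theorem seq (h : Exec p s s' T) (h' : Exec q s' s'' T') : Exec (.seq p q) s s'' (T + T') :=
  let ⟨_, ht, hr⟩ := h
  let ⟨_, ht', hr'⟩ := h'
  ⟨_, add_le_add ht ht', .seq hr hr'⟩

theorem ite_true {e : Expr} (he : e.eval s ≠ 0) (h : Exec p s s' T) :
    Exec (.ite e p q) s s' (T + 1) :=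
  let ⟨_, ht, hr⟩ := h
  ⟨_, Nat.succ_le_succ ht, .ite_true he hr⟩

theorem ite_false {e : Expr} (he : e.eval s = 0) (h : Exec q s s' T) :
    Exec (.ite e p q) s s' (T + 1) :=
  let ⟨_, ht, hr⟩ := h
  ⟨_, Nat.succ_le_succ ht, .ite_false he hr⟩

theorem loop_true {e : Expr} (he : e.eval s ≠ 0) (h : Exec p s s' T)
    (h' : Exec (.loop e p) s' s'' T') : Exec (.loop e p) s s'' (T + T' + 1) :=
  let ⟨_, ht, hr⟩ := h
  let ⟨_, ht', hr'⟩ := h'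
  ⟨_, Nat.succ_le_succ (add_le_add ht ht'), .loop_true he hr hr'⟩

theorem loop_false {e : Expr} (he : e.eval s = 0) : Exec (.loop e p) s s 1 :=
  ⟨1, le_rfl, .loop_false he⟩

end Exec

/-! #### Expressions -/

/-- The arrays that an expression reads. -/
def Expr.Uses : Expr → ℕ → Prop
  | .const _, _ => False
  | .read a i, b => b = a ∨ i.Uses b
  | .add e₁ e₂, b => e₁.Uses b ∨ e₂.Uses b
  | .sub e₁ e₂, b => e₁.Uses b ∨ e₂.Uses b

theorem Expr.eval_congr {s s' : Memory} {e : Expr} (h : ∀ a, e.Uses a → s' a = s a) :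
    e.eval s' = e.eval s := by
  induction e with
  | const k => rfl
  | read a i ih =>
    rw [eval, eval, ih fun b hb => h b (Or.inr hb), h a (Or.inl rfl)]
  | add e₁ e₂ h₁ h₂ =>
    rw [eval, eval, h₁ fun b hb => h b (Or.inl hb), h₂ fun b hb => h b (Or.inr hb)]
  | sub e₁ e₂ h₁ h₂ =>
    rw [eval, eval, h₁ fun b hb => h b (Or.inl hb), h₂ fun b hb => h b (Or.inr hb)]

/-! #### Straight-line programs -/

/-- A program that does nothing of importance. -/
def skip : Prog := .assign 9 (.const 0) (.const 0)

theorem ok_skip {A : Set ℕ} (hA : 9 ∈ A) : skip.Ok A := ⟨hA, by norm_num⟩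

/-- Append the values of expressions to the output. -/
def emit : List Expr → Prog
  | [] => skip
  | e :: es => .seq (.assign 1 (.read 3 (.const 0)) e)
      (.seq (.assign 3 (.const 0) (.add (.read 3 (.const 0)) (.const 1))) (emit es))

theorem ok_emit {A : Set ℕ} (h1 : 1 ∈ A) (h3 : 3 ∈ A) (h9 : 9 ∈ A) (es : List Expr) :
    (emit es).Ok A := by
  induction es with
  | nil => exact ok_skip h9
  | cons e es ih => exact ⟨⟨h1, by norm_num⟩, ⟨h3, fun _ => ⟨rfl, rfl⟩⟩, ih⟩

/-- The output written so far. -/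
def OutIs (s : Memory) (o : List ℕ) : Prop := (∀ i, s 1 i = o.getD i 0) ∧ s 3 0 = o.length

theorem OutIs.congr {s s' : Memory} {o : List ℕ} (h : OutIs s o) (h1 : s' 1 = s 1)
    (h3 : s' 3 = s 3) : OutIs s' o := by
  rw [OutIs, h1, h3]
  exact h

theorem exec_emit (es : List Expr)
    (hes : ∀ e ∈ es, ¬ e.Uses 1 ∧ ¬ e.Uses 3 ∧ ¬ e.Uses 9) :
    ∀ (s : Memory) (o : List ℕ), OutIs s o →
      ∃ s', Exec (emit es) s s' (2 * es.length + 1) ∧ OutIs s' (o ++ es.map (Expr.eval s)) := by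
  induction es with
  | nil =>
    intro s o h
    refine ⟨_, Exec.assign _ _ _ _, ?_⟩
    simpa using h.congr (Memory.write_of_ne _ _ _ (by norm_num))
      (Memory.write_of_ne _ _ _ (by norm_num))
  | cons e es ih =>
    intro s o h
    set s₁ := s.write 1 ((Expr.read 3 (.const 0)).eval s) (e.eval s) with hs₁
    set s₂ := s₁.write 3 ((Expr.const 0).eval s₁)
      ((Expr.add (.read 3 (.const 0)) (.const 1)).eval s₁) with hs₂
    have hfr : ∀ a, a ≠ 1 → a ≠ 3 → s₂ a = s a := fun a h1 h3 => by
      rw [hs₂, Memory.write_of_ne _ _ _ h3, hs₁, Memory.write_of_ne _ _ _ h1]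
    have h3 : s₁ 3 = s 3 := Memory.write_of_ne _ _ _ (by norm_num)
    have hout : OutIs s₂ (o ++ [e.eval s]) := by
      refine ⟨fun i => ?_, ?_⟩
      · rw [hs₂, Memory.write_of_ne _ _ _ (by norm_num), hs₁]
        simp only [Expr.eval, h.2]
        by_cases hi : i = o.length
        · subst hi
          rw [Memory.write_same]
          simp
        · rw [Memory.write_of_ne_index _ _ _ hi, h.1]
          rcases lt_or_gt_of_ne hi with hlt | hgt
          · rw [List.getD_append _ _ _ _ hlt]
          · rw [List.getD_eq_default _ _ hgt.le, List.getD_eq_default]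
            simpa using hgt
      · rw [hs₂]
        simp only [Expr.eval]
        rw [Memory.write_same, h3, h.2]
        simp
    obtain ⟨s', hex, ho⟩ := ih (fun e he => hes e (List.mem_cons_of_mem _ he)) s₂ _ hout
    refine ⟨s', ?_, ?_⟩
    · refine ((Exec.assign _ _ _ _).seq ((Exec.assign _ _ _ _).seq hex)).mono ?_
      rw [List.length_cons]
      omega
    · have : es.map (Expr.eval s₂) = es.map (Expr.eval s) := by
        refine List.map_congr_left fun e' he' => Expr.eval_congr fun a ha => ?_
        have := hes e' (List.mem_cons_of_mem _ he')
        exact hfr a (fun h => this.1 (h ▸ ha)) (fun h => this.2.1 (h ▸ ha))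
      rw [this, List.append_assoc] at ho
      simpa using ho

/-- Set the given cells to one. -/
def setOnes : List (ℕ × Expr) → Prog
  | [] => skip
  | w :: ws => .seq (.assign w.1 w.2 (.const 1)) (setOnes ws)

theorem ok_setOnes {A : Set ℕ} (h9 : 9 ∈ A) (ws : List (ℕ × Expr))
    (h : ∀ w ∈ ws, w.1 ∈ A ∧ w.1 ≠ 3) : (setOnes ws).Ok A := by
  induction ws with
  | nil => exact ok_skip h9
  | cons w ws ih =>
    have hw := h w List.mem_cons_self
    exact ⟨⟨hw.1, fun h3 => absurd h3 hw.2⟩, ih fun w hw => h w (List.mem_cons_of_mem _ hw)⟩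

open Classical in
theorem exec_setOnes (ws : List (ℕ × Expr))
    (h : ∀ w ∈ ws, ∀ w' ∈ ws, ¬ w'.2.Uses w.1) :
    ∀ s : Memory, ∃ s', Exec (setOnes ws) s s' (ws.length + 1) ∧
      ∀ a i, a ≠ 9 → s' a i = if ∃ w ∈ ws, w.1 = a ∧ w.2.eval s = i then 1 else s a i := by
  induction ws with
  | nil =>
    intro s
    refine ⟨_, Exec.assign _ _ _ _, fun a i ha => ?_⟩
    rw [Memory.write_of_ne _ _ _ ha]
    simp
  | cons w ws ih =>
    intro s
    obtain ⟨s', hex, hs'⟩ := ih (fun w hw w' hw' => h w (List.mem_cons_of_mem _ hw) w'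
      (List.mem_cons_of_mem _ hw')) (s.write w.1 (w.2.eval s) 1)
    refine ⟨s', ((Exec.assign _ _ _ _).seq hex).mono (by rw [List.length_cons]; omega),
      fun a i ha => ?_⟩
    have hev : ∀ w' ∈ ws, w'.2.eval (s.write w.1 (w.2.eval s) 1) = w'.2.eval s := by
      intro w' hw'
      refine Expr.eval_congr fun b hb => Memory.write_of_ne _ _ _ ?_
      rintro rfl
      exact h w List.mem_cons_self w' (List.mem_cons_of_mem _ hw') hb
    rw [hs' a i ha]
    have hiff : (∃ w' ∈ ws, w'.1 = a ∧ w'.2.eval (s.write w.1 (w.2.eval s) 1) = i) ↔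
        ∃ w' ∈ ws, w'.1 = a ∧ w'.2.eval s = i :=
      ⟨fun ⟨w', h₁, h₂, h₃⟩ => ⟨w', h₁, h₂, by rwa [hev w' h₁] at h₃⟩,
        fun ⟨w', h₁, h₂, h₃⟩ => ⟨w', h₁, h₂, by rwa [hev w' h₁]⟩⟩
    simp only [hiff, List.exists_mem_cons_iff]
    by_cases h1 : ∃ w' ∈ ws, w'.1 = a ∧ w'.2.eval s = i
    · simp [h1]
    · simp only [h1, if_false, or_false]
      by_cases h2 : w.1 = a
      · subst h2
        by_cases h3 : w.2.eval s = i
        · subst h3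
          simp [Memory.write_same]
        · rw [Memory.write_of_ne_index _ _ _ (Ne.symm h3)]
          simp [h3]
      · rw [Memory.write_of_ne _ _ _ (Ne.symm h2)]
        simp [h2]

/-! #### Case distinctions -/

/-- Test the expressions `e i` for the `i` in the list and continue with the program that belongs
to the set of those `i` for which `e i` is nonzero. -/
def branchOn {ι : Type} (e : ι → Expr) : List ι → (Set ι → Prog) → Prog
  | [], k => k ∅
  | i :: l, k => .ite (e i) (branchOn e l fun S => k (insert i S)) (branchOn e l k)

theorem ok_branchOn {ι : Type} {A : Set ℕ} (e : ι → Expr) (l : List ι) (k : Set ι → Prog)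
    (h : ∀ S, (k S).Ok A) : (branchOn e l k).Ok A := by
  induction l generalizing k with
  | nil => exact h _
  | cons i l ih => exact ⟨ih _ fun S => h _, ih _ h⟩

theorem exec_branchOn {ι : Type} (e : ι → Expr) (l : List ι) {s s' : Memory} {T : ℕ} :
    ∀ k : Set ι → Prog, Exec (k {i | i ∈ l ∧ (e i).eval s ≠ 0}) s s' T →
      Exec (branchOn e l k) s s' (T + l.length) := by
  induction l with
  | nil =>
    intro k h
    simpa [branchOn] using h
  | cons i l ih =>
    intro k h
    by_cases hi : (e i).eval s = 0
    · refine (Exec.ite_false hi (ih k ?_)).mono (by rw [List.length_cons]; omega)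
      convert h using 2
      ext j
      simp only [Set.mem_ofPred_eq, List.mem_cons]
      constructor
      · exact fun h => ⟨Or.inr h.1, h.2⟩
      · rintro ⟨rfl | h, h'⟩
        · exact absurd hi h'
        · exact ⟨h, h'⟩
    · refine (Exec.ite_true hi (ih _ ?_)).mono (by rw [List.length_cons]; omega)
      convert h using 2
      ext j
      simp only [Set.mem_ofPred_eq, List.mem_cons, Set.mem_insert_iff]
      constructor
      · rintro (rfl | h)
        · exact ⟨Or.inl rfl, hi⟩
        · exact ⟨Or.inr h.1, h.2⟩
      · rintro ⟨rfl | h, hj⟩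
        · exact Or.inl rfl
        · exact Or.inr ⟨h, hj⟩

/-- Test all expressions of a finite family. -/
noncomputable def branchAll {ι : Type} [Fintype ι] (e : ι → Expr) (k : Set ι → Prog) : Prog :=
  branchOn e Finset.univ.toList k

theorem ok_branchAll {ι : Type} [Fintype ι] {A : Set ℕ} (e : ι → Expr) (k : Set ι → Prog)
    (h : ∀ S, (k S).Ok A) : (branchAll e k).Ok A := ok_branchOn _ _ _ h

/-- The program is a decision tree whose leaves may depend on the set of answers in any way,
computable or not, while the cost is one test per question. Through it the chosen tables enter the
program. -/
theorem exec_branchAll {ι : Type} [Fintype ι] (e : ι → Expr) {s s' : Memory} {T : ℕ}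
    (k : Set ι → Prog) {S : Set ι} (hS : ∀ i, i ∈ S ↔ (e i).eval s ≠ 0) (h : Exec (k S) s s' T) :
    Exec (branchAll e k) s s' (T + Fintype.card ι) := by
  have : S = {i | i ∈ Finset.univ.toList ∧ (e i).eval s ≠ 0} := by
    ext i
    simp [hS i]
  rw [this] at h
  simpa [branchAll] using exec_branchOn e Finset.univ.toList k h

/-! #### Loops over tuples -/

/-- The loop registers. -/
def reg (r : ℕ) : ℕ := 10 + 2 * r

/-- Run the body with the register `r` (cell `0` of array `r`) ranging over `0, …, n - 1`, where
`n` is stored in array `2`. -/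
def forN (r : ℕ) (body : Prog) : Prog :=
  .seq (.assign r (.const 0) (.const 0))
    (.loop (.sub (.read 2 (.const 0)) (.read r (.const 0)))
      (.seq body (.assign r (.const 0) (.add (.read r (.const 0)) (.const 1)))))

theorem ok_forN {A : Set ℕ} {r : ℕ} {body : Prog} (hr : r ∈ A) (hr3 : r ≠ 3) (h : body.Ok A) :
    (forN r body).Ok A :=
  ⟨⟨hr, fun h => absurd h hr3⟩, h, hr, fun h => absurd h hr3⟩

theorem exec_forN {A : Set ℕ} {r n T : ℕ} {body : Prog} (hbody : body.Ok A) (hrA : r ∉ A)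
    (h2A : 2 ∉ A) (hr2 : r ≠ 2) (Inv : ℕ → Memory → Prop)
    (hstab : ∀ i s x, Inv i s → Inv i (s.write r 0 x))
    (hstep : ∀ i < n, ∀ s, Inv i s → s 2 0 = n → s r 0 = i →
      ∃ s', Exec body s s' T ∧ Inv (i + 1) s') (s : Memory) (h0 : Inv 0 s) (hn : s 2 0 = n) :
    ∃ s', Exec (forN r body) s s' (n * (T + 2) + 2) ∧ Inv n s' := by
  have key : ∀ k i, i + k = n → ∀ s, Inv i s → s 2 0 = n → s r 0 = i →
      ∃ s', Exec (.loop (.sub (.read 2 (.const 0)) (.read r (.const 0)))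
        (.seq body (.assign r (.const 0) (.add (.read r (.const 0)) (.const 1)))))
          s s' (k * (T + 2) + 1) ∧ Inv n s' := by
    intro k
    induction k with
    | zero =>
      intro i hi s hs hn hr
      obtain rfl : i = n := by omega
      exact ⟨s, (Exec.loop_false (by simp [Expr.eval, hn, hr])).mono (by omega), hs⟩
    | succ k ih =>
      intro i hi s hs hn hr
      obtain ⟨s₁, h₁, hs₁⟩ := hstep i (by omega) s hs hn hr
      have hr₁ : s₁ r 0 = i := by rw [h₁.frame hbody hrA, hr]
      have hn₁ : s₁ 2 0 = n := by rw [h₁.frame hbody h2A, hn]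
      obtain ⟨s', h', hs'⟩ := ih (i + 1) (by omega) (s₁.write r 0 (i + 1)) (hstab _ _ _ hs₁)
        (by rw [Memory.write_of_ne _ _ _ hr2.symm, hn₁]) (Memory.write_same _ _ _ _)
      refine ⟨s', (Exec.loop_true ?_ (h₁.seq ?_) h').mono (T := T + 1 + (k * (T + 2) + 1) + 1) ?_,
        hs'⟩
      · simp only [Expr.eval, hn, hr]
        omega
      · have := Exec.assign r (.const 0) (.add (.read r (.const 0)) (.const 1)) s₁
        simpa only [Expr.eval, hr₁] using this
      · rw [Nat.succ_mul]
        omega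
  obtain ⟨s', h', hfin⟩ := key n 0 (by omega) (s.write r 0 0) (hstab _ _ _ h0)
    (by rw [Memory.write_of_ne _ _ _ hr2.symm, hn]) (Memory.write_same _ _ _ _)
  exact ⟨s', ((Exec.assign r (.const 0) (.const 0) s).seq h').mono (by omega), hfin⟩

/-- Run the body for all values of the registers `r, …, r + k - 1`. -/
def forTuples (r : ℕ) : ℕ → Prog → Prog
  | 0, body => body
  | k + 1, body => forN (reg r) (forTuples (r + 1) k body)

/-- All tuples, in the order in which `forTuples` visits them. -/
def tuples (n : ℕ) : (k : ℕ) → List (Fin k → Fin n)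
  | 0 => [Fin.elim0]
  | k + 1 => (List.finRange n).flatMap fun i => (tuples n k).map (Fin.cons i)

theorem mem_tuples (n : ℕ) : ∀ (k : ℕ) (u : Fin k → Fin n), u ∈ tuples n k
  | 0, u => by simp [tuples, Subsingleton.elim u Fin.elim0]
  | k + 1, u => by
    refine List.mem_flatMap.2 ⟨u 0, List.mem_finRange _, List.mem_map.2
      ⟨Fin.tail u, mem_tuples n k _, Fin.cons_self_tail u⟩⟩

theorem length_tuples (n k : ℕ) : (tuples n k).length = n ^ k := by
  induction k with
  | zero => simp [tuples]
  | succ k ih => simp [tuples, ih, pow_succ, mul_comm]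

/-- Running time of `forTuples`. -/
def tuplesCost (n T : ℕ) : ℕ → ℕ
  | 0 => T
  | k + 1 => n * (tuplesCost n T k + 2) + 2

/-- The registers from `r` on. -/
def regsFrom (r : ℕ) : Set ℕ := {a | ∃ j, r ≤ j ∧ a = reg j}

theorem ok_forTuples {A : Set ℕ} {body : Prog} (h : body.Ok A) :
    ∀ k r, (∀ j, r ≤ j → reg j ∈ A) → (forTuples r k body).Ok A
  | 0, _, _ => h
  | k + 1, r, hA => ok_forN (hA r le_rfl) (by unfold reg; omega)
      (ok_forTuples h k (r + 1) fun j hj => hA j (by omega))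

theorem reg_inj {i j : ℕ} : reg i = reg j ↔ i = j := by
  unfold reg
  omega

theorem ok_forTuples_range {A : Set ℕ} {body : Prog} (h : body.Ok A) :
    ∀ k r, (forTuples r k body).Ok (A ∪ {a | ∃ j, r ≤ j ∧ j < r + k ∧ a = reg j})
  | 0, _ => h.mono Set.subset_union_left
  | k + 1, r => ok_forN (Or.inr ⟨r, le_rfl, by omega, rfl⟩) (by unfold reg; omega)
      ((ok_forTuples_range h k (r + 1)).mono (Set.union_subset_union_right _ (by
        rintro a ⟨j, h₁, h₂, h₃⟩
        exact ⟨j, by omega, by omega, h₃⟩)))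

/-- The invariant refers to the list of tuples already visited and must not depend on the registers
used by the loops. -/
theorem exec_forTuples {A : Set ℕ} {n T : ℕ} {body : Prog} (hbody : body.Ok A) (h2A : 2 ∉ A) :
    ∀ (k r : ℕ), (∀ j, r ≤ j → j < r + k → reg j ∉ A) →
    ∀ (Inv : List (Fin k → Fin n) → Memory → Prop),
    (∀ L s s', (∀ a, a ∉ regsFrom r → s' a = s a) → Inv L s → Inv L s') →
    (∀ L u s, Inv L s → s 2 0 = n → (∀ l : Fin k, s (reg (r + l)) 0 = u l) →
      ∃ s', Exec body s s' T ∧ Inv (L ++ [u]) s') →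
    ∀ s, Inv [] s → s 2 0 = n →
      ∃ s', Exec (forTuples r k body) s s' (tuplesCost n T k) ∧ Inv (tuples n k) s' := by
  intro k
  induction k with
  | zero =>
    intro r _ Inv _ hstep s h0 hn
    exact hstep [] Fin.elim0 s h0 hn fun l => l.elim0
  | succ k ih =>
    intro r hA Inv hstab hstep s h0 hn
    -- The tuples completed when the outer register has reached `i`: those with first entry below
    -- `i`.
    let E : ℕ → List (Fin (k + 1) → Fin n) := fun i =>
      ((List.finRange n).take i).flatMap fun x => (tuples n k).map (Fin.cons x)
    have hE : ∀ (i : ℕ) (hi : i < n), E (i + 1) = E i ++ (tuples n k).map (Fin.cons ⟨i, hi⟩) := by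
      intro i hi
      simp only [E]
      rw [List.take_succ_eq_append_getElem (by simpa using hi), List.flatMap_append]
      simp
    have hEn : E n = tuples n (k + 1) := by
      simp only [E]
      rw [List.take_of_length_le (by simp)]
      rfl
    have hok := ok_forTuples_range hbody k (r + 1)
    obtain ⟨s', h', hs'⟩ := exec_forN (r := reg r) (n := n) (T := tuplesCost n T k) hok
      (by
        rintro (h | ⟨j, h₁, -, h₃⟩)
        · exact hA r le_rfl (by omega) h
        · rw [reg_inj] at h₃
          omega)
      (by
        rintro (h | ⟨j, h₁, -, h₃⟩)
        · exact h2A h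
        · unfold reg at h₃
          omega)
      (by unfold reg; omega) (fun i s => Inv (E i) s)
      (fun i s x h => hstab _ s _ (fun a ha => Memory.write_of_ne _ _ _ fun e =>
        ha ⟨r, le_rfl, e⟩) h)
      (by
        intro i hi s hs hn hr
        obtain ⟨s', h', hs'⟩ := ih (r + 1) (fun j h₁ h₂ => hA j (by omega) (by omega))
          (fun L s => Inv (E i ++ L.map (Fin.cons ⟨i, hi⟩)) s ∧ s (reg r) 0 = i)
          (by
            rintro L s s' hss ⟨h₁, h₂⟩
            refine ⟨hstab _ s s' (fun a ha => hss a ?_) h₁, ?_⟩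
            · rintro ⟨j, h₁, h₂⟩
              exact ha ⟨j, by omega, h₂⟩
            · rw [hss, h₂]
              rintro ⟨j, h₁, h₂⟩
              rw [reg_inj] at h₂
              omega)
          (by
            rintro L u s ⟨h₁, h₂⟩ hn hu
            obtain ⟨s', h', hs'⟩ := hstep (E i ++ L.map (Fin.cons ⟨i, hi⟩)) (Fin.cons ⟨i, hi⟩ u) s
              h₁ hn (by
                intro l
                refine Fin.cases ?_ (fun l => ?_) l
                · simpa using h₂
                · have := hu l
                  rw [Fin.cons_succ, ← this]
                  congr 2
                  simp only [Fin.val_succ]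
                  omega)
            refine ⟨s', h', ?_, ?_⟩
            · rw [List.map_append, List.map_singleton, ← List.append_assoc]
              exact hs'
            · rw [h'.frame hbody (hA r le_rfl (by omega)), h₂])
          s ⟨by simpa using hs, hr⟩ hn
        refine ⟨s', h', ?_⟩
        rw [hE i hi]
        exact hs'.1)
      s (by simpa [E] using h0) hn
    exact ⟨s', h', hEn ▸ hs'⟩

end RAM

/-! ### Polynomial bounds -/

/-- `f` is bounded by a polynomial. -/
def PolyBdd (f : ℕ → ℕ) : Prop := ∃ C k, ∀ n, f n ≤ C * (n + 1) ^ k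

namespace PolyBdd

theorem const (c : ℕ) : PolyBdd fun _ => c := ⟨c, 0, fun n => by simp⟩

theorem id : PolyBdd fun n => n := ⟨1, 1, fun n => by simp⟩

theorem add {f g : ℕ → ℕ} (hf : PolyBdd f) (hg : PolyBdd g) : PolyBdd fun n => f n + g n := by
  obtain ⟨C, k, h⟩ := hf
  obtain ⟨C', k', h'⟩ := hg
  refine ⟨C + C', k + k', fun n => ?_⟩
  have h1 : (n + 1) ^ k ≤ (n + 1) ^ (k + k') := Nat.pow_le_pow_right (by omega) (by omega)
  have h2 : (n + 1) ^ k' ≤ (n + 1) ^ (k + k') := Nat.pow_le_pow_right (by omega) (by omega)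
  calc f n + g n ≤ C * (n + 1) ^ k + C' * (n + 1) ^ k' := add_le_add (h n) (h' n)
    _ ≤ C * (n + 1) ^ (k + k') + C' * (n + 1) ^ (k + k') :=
        add_le_add (Nat.mul_le_mul_left _ h1) (Nat.mul_le_mul_left _ h2)
    _ = (C + C') * (n + 1) ^ (k + k') := by ring

theorem mul {f g : ℕ → ℕ} (hf : PolyBdd f) (hg : PolyBdd g) : PolyBdd fun n => f n * g n := by
  obtain ⟨C, k, h⟩ := hf
  obtain ⟨C', k', h'⟩ := hg
  refine ⟨C * C', k + k', fun n => ?_⟩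
  calc f n * g n ≤ (C * (n + 1) ^ k) * (C' * (n + 1) ^ k') := Nat.mul_le_mul (h n) (h' n)
    _ = C * C' * (n + 1) ^ (k + k') := by ring

theorem pow {f : ℕ → ℕ} (hf : PolyBdd f) (k : ℕ) : PolyBdd fun n => f n ^ k := by
  induction k with
  | zero => simpa using const 1
  | succ k ih => simpa only [pow_succ] using ih.mul hf

theorem sum {ι : Type} (s : Finset ι) {f : ι → ℕ → ℕ} (hf : ∀ i, PolyBdd (f i)) :
    PolyBdd fun n => ∑ i ∈ s, f i n := by
  classical
  induction s using Finset.induction_on with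
  | empty => simpa using const 0
  | insert i s hi ih => simpa only [Finset.sum_insert hi] using (hf i).add ih

theorem tuplesCost {T : ℕ → ℕ} (hT : PolyBdd T) (k : ℕ) :
    PolyBdd fun n => RAM.tuplesCost n (T n) k := by
  induction k with
  | zero => exact hT
  | succ k ih => exact (id.mul (ih.add (const 2))).add (const 2)

theorem exists_pow_bound {f : ℕ → ℕ} (hf : PolyBdd f) : ∃ c, ∀ n, f n ≤ n ^ c + c := by
  obtain ⟨C, k, h⟩ := hf
  -- For `n < 2` the additive constant `C * 2 ^ k` is enough; for `n ≥ 2` one has `C ≤ n ^ C` and `n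
  -- + 1 ≤ n ^ 2`.
  refine ⟨C * 2 ^ k + C + 2 * k, fun n => (h n).trans ?_⟩
  rcases Nat.lt_or_ge n 2 with hn | hn
  · have : (n + 1) ^ k ≤ 2 ^ k := Nat.pow_le_pow_left (by omega) k
    have := Nat.mul_le_mul_left C this
    omega
  · have h1 : C ≤ n ^ C := (Nat.lt_pow_self (by omega)).le
    have h2 : (n + 1) ^ k ≤ n ^ (2 * k) := by
      rw [pow_mul]
      exact Nat.pow_le_pow_left (by nlinarith) k
    calc C * (n + 1) ^ k ≤ n ^ C * n ^ (2 * k) := Nat.mul_le_mul h1 h2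
      _ = n ^ (C + 2 * k) := by rw [pow_add]
      _ ≤ n ^ (C * 2 ^ k + C + 2 * k) := Nat.pow_le_pow_right (by omega) (by omega)
      _ ≤ _ := by omega

end PolyBdd

/-! ### Printing polynomials -/

section Text

variable {N n : ℕ}

/-- The expressions whose values encode a sum of terms, the variables being given by expressions. -/
def polyExpr (x : Fin N → Expr) (p : SparsePoly N) : List Expr :=
  p.flatMap (fun t => .const 1 :: ((encodeRat t.1).map .const ++
    (t.2.flatMap (fun v => [.const 1, x v]) ++ [.const 0]))) ++ [.const 0]

theorem eval_polyExpr {x : Fin N → Expr} {s : Memory} {w : Fin N → Fin n}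
    (hx : ∀ l, (x l).eval s = w l) (p : SparsePoly N) :
    (polyExpr x p).map (Expr.eval s) = encodePoly (p.ren w) := by
  simp [polyExpr, encodePoly, encodeList, SparsePoly.ren, List.map_flatMap, List.flatMap_map,
    Expr.eval, hx, Function.comp_def]

theorem uses_polyExpr {x : Fin N → Expr} {p : SparsePoly N} {e : Expr} (he : e ∈ polyExpr x p)
    {a : ℕ} (ha : e.Uses a) : ∃ l, (x l).Uses a := by
  simp only [polyExpr, List.mem_append, List.mem_flatMap, List.mem_cons, List.mem_map,
    List.not_mem_nil, or_false] at he
  rcases he with ⟨t, -, rfl | ⟨k, -, rfl⟩ | ⟨v, -, rfl | rfl⟩ | rfl⟩ | rfl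
  · exact ha.elim
  · exact ha.elim
  · exact ha.elim
  · exact ⟨v, ha⟩
  · exact ha.elim
  · exact ha.elim

/-- The expressions for a list of polynomials, without the end marker. -/
def linesExpr (x : Fin N → Expr) (ℓ : List (SparsePoly N)) : List Expr :=
  ℓ.flatMap fun p => .const 1 :: polyExpr x p

/-- The encoding of a list of polynomials, without the end marker. -/
def encodeLines (π : List (SparsePoly n)) : List ℕ := π.flatMap fun p => 1 :: encodePoly p

theorem eval_linesExpr {x : Fin N → Expr} {s : Memory} {w : Fin N → Fin n}
    (hx : ∀ l, (x l).eval s = w l) (ℓ : List (SparsePoly N)) :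
    (linesExpr x ℓ).map (Expr.eval s) = encodeLines (ℓ.map (SparsePoly.ren w)) := by
  simp only [linesExpr, encodeLines, List.map_flatMap, List.flatMap_map, List.map_cons,
    eval_polyExpr hx, Expr.eval]

theorem uses_linesExpr {x : Fin N → Expr} {ℓ : List (SparsePoly N)} {e : Expr}
    (he : e ∈ linesExpr x ℓ) {a : ℕ} (ha : e.Uses a) : ∃ l, (x l).Uses a := by
  obtain ⟨p, -, h⟩ := List.mem_flatMap.1 he
  rcases List.mem_cons.1 h with rfl | h
  · exact ha.elim
  · exact uses_polyExpr h ha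

end Text

/-! ### The table of excluded pairs -/

section Table

variable {D : Finset ℚ} {N n : ℕ}

/-- The array that stores the excluded pairs with values `a` and `b`. -/
noncomputable def factArr (a b : D) : ℕ := 11 + 2 * (Fintype.equivFin (D × D) (a, b) : ℕ)

theorem factArr_inj {a b a' b' : D} : factArr a b = factArr a' b' ↔ a = a' ∧ b = b' := by
  constructor
  · intro h
    have h' : (Fintype.equivFin (D × D) (a, b) : ℕ) = Fintype.equivFin (D × D) (a', b') := by
      unfold factArr at h
      omega
    exact Prod.mk.inj ((Fintype.equivFin (D × D)).injective (Fin.ext h'))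
  · rintro ⟨rfl, rfl⟩
    rfl

/-- The arrays that are changed by printing and by excluding pairs. -/
def actArrays : Set ℕ := {a | a = 1 ∨ a = 3 ∨ a = 9 ∨ ∃ c, a = 11 + 2 * c}

theorem factArr_mem (a b : D) : factArr a b ∈ actArrays := Or.inr (Or.inr (Or.inr ⟨_, rfl⟩))

theorem factArr_ne_three (a b : D) : factArr a b ≠ 3 := by
  unfold factArr
  omega

theorem reg_notMem_actArrays (r : ℕ) : reg r ∉ actArrays := by
  rintro (h | h | h | ⟨c, h⟩) <;> unfold reg at h <;> omega

theorem notMem_actArrays {a : ℕ} (ha : a < 9) (h1 : a ≠ 1) (h3 : a ≠ 3) : a ∉ actArrays := by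
  rintro (h | h | h | ⟨c, h⟩) <;> omega

theorem mul_add_inj {i j i' j' : Fin n} :
    (i : ℕ) * n + j = i' * n + j' ↔ i = i' ∧ j = j' := by
  constructor
  · intro h
    have : finProdFinEquiv (i, j) = finProdFinEquiv (i', j') := by
      ext
      simp only [finProdFinEquiv_apply_val]
      linarith
    exact Prod.mk.inj (finProdFinEquiv.injective this)
  · rintro ⟨rfl, rfl⟩
    rfl

/-- The memory holds `n`, the multiples of `n`, and the table of the excluded pairs `F`. -/
structure MemOk (F : Fin n → Fin n → D → D → Prop) (s : Memory) : Prop where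
  size : s 2 0 = n
  row : ∀ i : Fin n, s 4 i = i * n
  facts : ∀ (i j : Fin n) (a b : D), s (factArr a b) (i * n + j) ≠ 0 ↔ F i j a b

theorem MemOk.congr {F : Fin n → Fin n → D → D → Prop} {s s' : Memory} (h : MemOk F s)
    (h2 : s' 2 = s 2) (h4 : s' 4 = s 4) (hf : ∀ a b : D, s' (factArr a b) = s (factArr a b)) :
    MemOk F s' :=
  ⟨by rw [h2, h.size], fun i => by rw [h4, h.row], fun i j a b => by rw [hf, h.facts]⟩

/-- The excluded pairs `F` together with those in the list `W`, whose variables are slots of the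
tuple `w`. -/
def addFacts (F : Fin n → Fin n → D → D → Prop) (w : Fin N → Fin n)
    (W : List (Fin N × Fin N × D × D)) (i j : Fin n) (a b : D) : Prop :=
  F i j a b ∨ ∃ y ∈ W, w y.1 = i ∧ w y.2.1 = j ∧ y.2.2.1 = a ∧ y.2.2.2 = b

/-- The cells of the table for a list of pairs. -/
noncomputable def factCells (x : Fin N → Expr) (W : List (Fin N × Fin N × D × D)) :
    List (ℕ × Expr) :=
  W.map fun y => (factArr y.2.2.1 y.2.2.2, .add (.read 4 (x y.1)) (x y.2.1))

/-- Print the lines `ℓ` and exclude the pairs in `W`. -/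
noncomputable def act (x : Fin N → Expr) (ℓ : List (SparsePoly N))
    (W : List (Fin N × Fin N × D × D)) : Prog :=
  .seq (emit (linesExpr x ℓ)) (setOnes (factCells x W))

theorem ok_act (x : Fin N → Expr) (ℓ : List (SparsePoly N)) (W : List (Fin N × Fin N × D × D)) :
    (act x ℓ W).Ok actArrays := by
  refine ⟨ok_emit (Or.inl rfl) (Or.inr (Or.inl rfl)) (Or.inr (Or.inr (Or.inl rfl))) _,
    ok_setOnes (Or.inr (Or.inr (Or.inl rfl))) _ fun c hc => ?_⟩
  obtain ⟨y, -, rfl⟩ := List.mem_map.1 hc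
  exact ⟨factArr_mem _ _, factArr_ne_three _ _⟩

/-- Running time of `act`. -/
def actCost (x : Fin N → Expr) (ℓ : List (SparsePoly N)) (W : List (Fin N × Fin N × D × D)) : ℕ :=
  2 * (linesExpr x ℓ).length + 1 + (W.length + 1)

/-- The expressions for the slots read no array that is written, so they denote the same tuple `w`
throughout. Cell `(i, j)` of a table is found at `i * n + j`, with `i * n` looked up in array `4`
because the machine does not multiply. -/
theorem exec_act {x : Fin N → Expr} (hx : ∀ l a, (x l).Uses a → a ∉ actArrays)
    (ℓ : List (SparsePoly N)) (W : List (Fin N × Fin N × D × D)) {s : Memory}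
    {w : Fin N → Fin n} (hw : ∀ l, (x l).eval s = w l) {F : Fin n → Fin n → D → D → Prop}
    (hM : MemOk F s) {o : List ℕ} (ho : OutIs s o) :
    ∃ s', Exec (act x ℓ W) s s' (actCost x ℓ W) ∧ MemOk (addFacts F w W) s' ∧
      OutIs s' (o ++ encodeLines (ℓ.map (SparsePoly.ren w))) := by
  obtain ⟨s₁, h₁, ho₁⟩ := exec_emit (linesExpr x ℓ) (fun e he => by
    refine ⟨fun h => ?_, fun h => ?_, fun h => ?_⟩ <;> obtain ⟨l, hl⟩ := uses_linesExpr he h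
    · exact hx l _ hl (Or.inl rfl)
    · exact hx l _ hl (Or.inr (Or.inl rfl))
    · exact hx l _ hl (Or.inr (Or.inr (Or.inl rfl)))) s o ho
  rw [eval_linesExpr hw] at ho₁
  have hfr : ∀ a, a ≠ 1 → a ≠ 3 → a ≠ 9 → s₁ a = s a := fun a h1 h3 h9 =>
    h₁.frame (A := {1, 3, 9}) (ok_emit (by simp) (by simp) (by simp) _) (by simp [h1, h3, h9])
  have hw₁ : ∀ l, (x l).eval s₁ = w l := fun l => by
    rw [Expr.eval_congr fun a ha => ?_, hw l]
    have := hx l a ha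
    exact hfr a (fun h => this (Or.inl h)) (fun h => this (Or.inr (Or.inl h)))
      (fun h => this (Or.inr (Or.inr (Or.inl h))))
  have hM₁ : MemOk F s₁ := hM.congr (hfr 2 (by norm_num) (by norm_num) (by norm_num))
    (hfr 4 (by norm_num) (by norm_num) (by norm_num)) fun a b =>
      hfr _ (by unfold factArr; omega) (by unfold factArr; omega) (by unfold factArr; omega)
  obtain ⟨s₂, h₂, hs₂⟩ := exec_setOnes (factCells x W) (by
    intro c hc c' hc' hu
    obtain ⟨y, -, rfl⟩ := List.mem_map.1 hc
    obtain ⟨y', -, rfl⟩ := List.mem_map.1 hc'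
    have hmem := factArr_mem y.2.2.1 y.2.2.2
    rcases hu with (hu | hu) | hu
    · rw [show factArr y.2.2.1 y.2.2.2 = 4 from hu] at hmem
      exact notMem_actArrays (by norm_num) (by norm_num) (by norm_num) hmem
    · exact hx _ _ hu hmem
    · exact hx _ _ hu hmem) s₁
  have hother : ∀ a, a ≠ 9 → (∀ b b' : D, a ≠ factArr b b') → s₂ a = s₁ a := by
    intro a h9 ha
    funext i
    rw [hs₂ a i h9, if_neg]
    rintro ⟨c, hc, rfl, -⟩
    obtain ⟨y, -, rfl⟩ := List.mem_map.1 hc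
    exact ha _ _ rfl
  have hlow : ∀ a, a < 9 → s₂ a = s₁ a := fun a ha =>
    hother a (by omega) (fun b b' => by unfold factArr; omega)
  refine ⟨s₂, (h₁.seq h₂).mono (by simp [actCost, factCells]), ⟨?_, ?_, ?_⟩,
    ho₁.congr (hlow 1 (by norm_num)) (hlow 3 (by norm_num))⟩
  · rw [hlow 2 (by norm_num), hM₁.size]
  · intro i
    rw [hlow 4 (by norm_num), hM₁.row]
  · intro i j a b
    rw [hs₂ _ _ (by unfold factArr; omega)]
    have hiff : (∃ c ∈ factCells x W, c.1 = factArr a b ∧ c.2.eval s₁ = i * n + j) ↔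
        ∃ y ∈ W, w y.1 = i ∧ w y.2.1 = j ∧ y.2.2.1 = a ∧ y.2.2.2 = b := by
      simp only [factCells, List.mem_map, exists_exists_and_eq_and]
      refine exists_congr fun y => and_congr_right fun _ => ?_
      rw [factArr_inj, Expr.eval, Expr.eval, hw₁, hw₁, hM₁.row, mul_add_inj]
      tauto
    simp only [hiff, addFacts]
    split_ifs with h
    · exact ⟨fun _ => Or.inr h, fun _ => one_ne_zero⟩
    · rw [hM₁.facts]
      exact ⟨Or.inl, fun h' => h'.resolve_right h⟩

end Table

/-! ### Patterns -/

section Patterns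

variable {D : Finset ℚ} {N n : ℕ}

/-- The questions asked about a tuple of variables: which pairs of values are excluded for which
pairs of slots, and how the slots are ordered. -/
abbrev PatIdx (D : Finset ℚ) (N : ℕ) : Type := (Fin N × Fin N × D × D) ⊕ (Fin N × Fin N)

/-- The answers for the tuple `w`. -/
def pat (F : Fin n → Fin n → D → D → Prop) (w : Fin N → Fin n) : Set (PatIdx D N) :=
  {q | match q with
    | .inl y => F (w y.1) (w y.2.1) y.2.2.1 y.2.2.2
    | .inr y => w y.2 < w y.1}

/-- The order of the slots. -/
def patOrd (β : Set (PatIdx D N)) (l m : Fin N) : Prop := .inr (l, m) ∈ β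

/-- The assignments to the slots that are compatible with a pattern. -/
def patSols (β : Set (PatIdx D N)) : Set (Fin N → D) :=
  {a | (∀ l l', .inl (l, l', a l, a l') ∉ β) ∧
    ∀ l l', ¬ patOrd β l l' → ¬ patOrd β l' l → a l = a l'}

theorem patSols_pat (F : Fin n → Fin n → D → D → Prop) (w : Fin N → Fin n) :
    patSols (pat F w) = localSols F w := by
  ext a
  refine and_congr Iff.rfl (forall₂_congr fun l l' => ?_)
  change (¬ w l' < w l → ¬ w l < w l' → a l = a l') ↔ (w l = w l' → a l = a l')
  rw [not_lt, not_lt, ← and_imp, ← le_antisymm_iff]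

/-- The expressions that answer the questions, when the variables are given by expressions. -/
noncomputable def patExpr (x : Fin N → Expr) : PatIdx D N → Expr
  | .inl y => .read (factArr y.2.2.1 y.2.2.2) (.add (.read 4 (x y.1)) (x y.2.1))
  | .inr y => .sub (x y.1) (x y.2)

theorem mem_pat_iff {x : Fin N → Expr} {s : Memory} {w : Fin N → Fin n}
    (hw : ∀ l, (x l).eval s = w l) {F : Fin n → Fin n → D → D → Prop} (hM : MemOk F s)
    (q : PatIdx D N) : q ∈ pat F w ↔ (patExpr x q).eval s ≠ 0 := by
  rcases q with y | y
  · simp only [patExpr, Expr.eval, hw, hM.row]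
    exact (hM.facts _ _ _ _).symm
  · simp only [patExpr, Expr.eval, hw]
    change w y.2 < w y.1 ↔ _
    rw [Fin.lt_def]
    omega

open Classical in
/-- The pairs that a pattern excludes. -/
noncomputable def newFacts (β : Set (PatIdx D N)) : List (Fin N × Fin N × D × D) :=
  (Finset.univ.filter fun y : Fin N × Fin N × D × D =>
    ¬ ∃ t ∈ patSols β, t y.1 = y.2.2.1 ∧ t y.2.1 = y.2.2.2).toList

theorem mem_newFacts {β : Set (PatIdx D N)} {y : Fin N × Fin N × D × D} :
    y ∈ newFacts β ↔ ¬ ∃ t ∈ patSols β, t y.1 = y.2.2.1 ∧ t y.2.1 = y.2.2.2 := by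
  simp [newFacts]

/-- Saturation is thus a fixed-point condition on the table, which the counting of rounds exploits.
-/
theorem isSaturatedAt_iff {F : Fin n → Fin n → D → D → Prop} {w : Fin N → Fin n} :
    IsSaturatedAt F w ↔ addFacts F w (newFacts (pat F w)) = F := by
  constructor
  · intro h
    funext i j a b
    apply propext
    constructor
    · rintro (h' | ⟨y, hy, rfl, rfl, rfl, rfl⟩)
      · exact h'
      · by_contra hF
        rw [mem_newFacts, patSols_pat] at hy
        exact hy (h _ _ _ _ hF)
    · exact Or.inl
  · intro h l l' a b hF
    by_contra hcon
    apply hF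
    rw [← h]
    refine Or.inr ⟨(l, l', a, b), ?_, rfl, rfl, rfl, rfl⟩
    rw [mem_newFacts, patSols_pat]
    exact hcon

/-- The polynomials that express a pattern. -/
noncomputable def patPrem (β : Set (PatIdx D N)) : Set (MvPolynomial (Fin N) ℚ) :=
  {p | (∃ l l' a b, .inl (l, l', a, b) ∈ β ∧ p = factPoly l l' a b) ∨
    ∃ l l', ¬ patOrd β l l' ∧ ¬ patOrd β l' l ∧ p = X l - X l'}

theorem mem_patSols_of_patPrem {β : Set (PatIdx D N)} {a : Fin N → D}
    (h : ∀ p ∈ patPrem β, eval (toPt a) p = 0) : a ∈ patSols β := by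
  constructor
  · intro l l' hβ
    have := h _ (Or.inl ⟨l, l', _, _, hβ, rfl⟩)
    rw [eval_factPoly] at this
    exact this ⟨rfl, rfl⟩
  · intro l l' h₁ h₂
    have := h _ (Or.inr ⟨l, l', h₁, h₂, rfl⟩)
    rw [map_sub, eval_X, eval_X, sub_eq_zero] at this
    exact Subtype.ext this

/-- A pattern has a derivation of any finite set of consequences which is uniform in the tuples
with that pattern. -/
theorem exists_template [NeZero N] (β : Set (PatIdx D N)) (L : List (MvPolynomial (Fin N) ℚ))
    (hL : ∀ g ∈ L, ∀ a ∈ patSols β, eval (toPt a) g = 0) :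
    ∃ ℓ : List (SparsePoly N), (∀ g ∈ L, g ∈ ℓ.map SparsePoly.toPoly) ∧
      ∀ (n : ℕ) (F : Fin n → Fin n → D → D → Prop) (w : Fin N → Fin n)
        (P : Set (MvPolynomial (Fin n) ℚ)) (π : List (SparsePoly n)), β = pat F w →
        PCList D P (π.map SparsePoly.toPoly) →
        (∀ i j a b, F i j a b → factPoly i j a b ∈ π.map SparsePoly.toPoly) →
        PCList D P ((π ++ ℓ.map (SparsePoly.ren w)).map SparsePoly.toPoly) := by
  obtain ⟨ℓ, h₁, h₂⟩ := exists_sparse_derivation (D := D) (P := patPrem β)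
    (g₀ := domainPoly D (0 : Fin N)) (Or.inr ⟨0, rfl⟩) L
    (fun g hg φ hφ => hL g hg φ (mem_patSols_of_patPrem hφ))
  -- Under `w`, the premises `X l - X l'` for slots holding the same variable become zero. The
  -- leading domain polynomial ensures that a line is available from which zero can be derived.
  refine ⟨sparse (domainPoly D 0) :: ℓ, fun g hg => List.mem_cons_of_mem _ (h₂ g hg), ?_⟩
  rintro n F w P π rfl hπ hF
  have hdom : PCList D P (π.map SparsePoly.toPoly ++ [domainPoly D (w 0)]) :=
    hπ.snoc (Or.inr (Or.inl ⟨_, rfl⟩))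
  have hmap : (ℓ.map (SparsePoly.ren w)).map SparsePoly.toPoly =
      (ℓ.map SparsePoly.toPoly).map (rename w) := by
    simp [List.map_map, Function.comp_def, SparsePoly.toPoly_ren]
  have := hdom.append (by simp) (ℓ := (ℓ.map SparsePoly.toPoly).map (rename w))
    ((h₁.rename w).mono_premises (by
      rintro _ ⟨p, ⟨l, l', a, b, hβ, rfl⟩ | ⟨l, l', ho, ho', rfl⟩, rfl⟩
      · right
        left
        rw [rename_factPoly]
        exact List.mem_append_left _ (hF _ _ _ _ hβ)
      · right
        right
        have e : w l = w l' := le_antisymm (not_lt.1 ho) (not_lt.1 ho')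
        simp [e]))
  rw [List.map_append, List.map_cons, List.map_cons, hmap, SparsePoly.toPoly_ren, toPoly_sparse,
    rename_domainPoly]
  simpa using this

end Patterns

/-! ### Saturation -/

section Passes

variable {D : Finset ℚ} {K n : ℕ}

/-- The polynomials in the variables of a tuple with a given pattern that may belong to the reduced
Gröbner basis. -/
noncomputable def cand [NeZero K] (β : Set (PatIdx D K)) : List (MvPolynomial (Fin K) ℚ) :=
  (exists_candidates (patOrd β) (patSols β)).choose

theorem eval_cand [NeZero K] {β : Set (PatIdx D K)} {g : MvPolynomial (Fin K) ℚ} (hg : g ∈ cand β)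
    {a : Fin K → D} (ha : a ∈ patSols β) : eval (toPt a) g = 0 :=
  (exists_candidates (patOrd β) (patSols β)).choose_spec.1 g hg a ha

theorem exists_mem_cand [NeZero K] {β : Set (PatIdx D K)} {S : Set (Fin n → D)} {w : Fin K → Fin n}
    (h : Realizes (patOrd β) (patSols β) S w) {g : MvPolynomial (Fin n) ℚ}
    (hg : IsReducedIn ((solIdeal S).restrictScalars ℚ) g) (hv : ∀ v ∈ g.vars, v ∈ Set.range w) :
    ∃ g₀ ∈ cand β, rename w g₀ = g :=
  (exists_candidates (patOrd β) (patSols β)).choose_spec.2 n S w h g hg hv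

/-- What is derived for a tuple with a given pattern. -/
noncomputable def targets [NeZero K] (β : Set (PatIdx D K)) : List (MvPolynomial (Fin K) ℚ) :=
  (newFacts β).map (fun y => factPoly y.1 y.2.1 y.2.2.1 y.2.2.2) ++ cand β

theorem eval_targets [NeZero K] {β : Set (PatIdx D K)} :
    ∀ g ∈ targets β, ∀ a ∈ patSols β, eval (toPt a) g = 0 := by
  intro g hg a ha
  rcases List.mem_append.1 hg with hg | hg
  · obtain ⟨y, hy, rfl⟩ := List.mem_map.1 hg
    rw [eval_factPoly]
    exact fun h => mem_newFacts.1 hy ⟨a, ha, h⟩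
  · exact eval_cand hg ha

/-- The derivation of the targets. -/
noncomputable def template [NeZero K] (β : Set (PatIdx D K)) : List (SparsePoly K) :=
  (exists_template β (targets β) eval_targets).choose

theorem mem_template [NeZero K] {β : Set (PatIdx D K)} {g : MvPolynomial (Fin K) ℚ}
    (hg : g ∈ targets β) : g ∈ (template β).map SparsePoly.toPoly :=
  (exists_template β (targets β) eval_targets).choose_spec.1 g hg

/-- The excluded pairs `F` are stored, the lines `π` are printed; they form a derivation from `P`
in which the exclusions occur. -/
structure DerivOk (P : Set (MvPolynomial (Fin n) ℚ)) (F : Fin n → Fin n → D → D → Prop)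
    (π : List (SparsePoly n)) (s : Memory) : Prop where
  mem : MemOk F s
  out : OutIs s (encodeLines π)
  pc : PCList D P (π.map SparsePoly.toPoly)
  lines : ∀ i j a b, F i j a b → factPoly i j a b ∈ π.map SparsePoly.toPoly

theorem DerivOk.congr {P : Set (MvPolynomial (Fin n) ℚ)} {F : Fin n → Fin n → D → D → Prop}
    {π : List (SparsePoly n)} {s s' : Memory} (h : DerivOk P F π s)
    (hs : ∀ a, (a < 5 ∨ ∃ c, a = 11 + 2 * c) → s' a = s a) : DerivOk P F π s' :=
  ⟨h.mem.congr (hs 2 (by simp)) (hs 4 (by simp)) fun _ _ => hs _ (Or.inr ⟨_, rfl⟩),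
    h.out.congr (hs 1 (by simp)) (hs 3 (by simp)), h.pc, h.lines⟩

theorem DerivOk.congr_regs {P : Set (MvPolynomial (Fin n) ℚ)} {F : Fin n → Fin n → D → D → Prop}
    {π : List (SparsePoly n)} {s s' : Memory} (h : DerivOk P F π s) {r : ℕ}
    (hs : ∀ a, a ∉ regsFrom r → s' a = s a) : DerivOk P F π s' := by
  refine h.congr fun a ha => hs a ?_
  rintro ⟨j, -, rfl⟩
  unfold reg at ha
  omega

theorem DerivOk.exec_act {N : ℕ} {P : Set (MvPolynomial (Fin n) ℚ)}
    {F : Fin n → Fin n → D → D → Prop}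
    {π : List (SparsePoly n)} {s : Memory} (h : DerivOk P F π s) {x : Fin N → Expr}
    (hx : ∀ l a, (x l).Uses a → a ∉ actArrays) {w : Fin N → Fin n}
    (hw : ∀ l, (x l).eval s = w l) {ℓ : List (SparsePoly N)}
    (hpc : PCList D P ((π ++ ℓ.map (SparsePoly.ren w)).map SparsePoly.toPoly))
    {W : List (Fin N × Fin N × D × D)}
    (hW : ∀ y ∈ W, factPoly y.1 y.2.1 y.2.2.1 y.2.2.2 ∈ ℓ.map SparsePoly.toPoly) :
    ∃ s', Exec (act x ℓ W) s s' (actCost x ℓ W) ∧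
      DerivOk P (addFacts F w W) (π ++ ℓ.map (SparsePoly.ren w)) s' := by
  obtain ⟨s', h₁, h₂, h₃⟩ := _root_.exec_act hx ℓ W hw h.mem h.out
  refine ⟨s', h₁, h₂, ?_, hpc, ?_⟩
  · simpa [encodeLines] using h₃
  · rintro i j a b (hF | ⟨y, hy, rfl, rfl, rfl, rfl⟩)
    · rw [List.map_append]
      exact List.mem_append_left _ (h.lines _ _ _ _ hF)
    · rw [List.map_append]
      refine List.mem_append_right _ ?_
      obtain ⟨p, hp, e⟩ := List.mem_map.1 (hW y hy)
      refine List.mem_map.2 ⟨p.ren w, List.mem_map_of_mem hp, ?_⟩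
      rw [SparsePoly.toPoly_ren, e, rename_factPoly]

/-- The value of the loop register `l`. -/
def regExpr {N : ℕ} (l : Fin N) : Expr := .read (reg l) (.const 0)

theorem uses_regExpr {N : ℕ} (l : Fin N) (a : ℕ) (h : (regExpr l).Uses a) : a ∉ actArrays := by
  rcases h with rfl | h
  · exact reg_notMem_actArrays _
  · exact h.elim

variable (D K) in
/-- Derive the targets for the tuple in the registers and, if `wr`, exclude the new pairs. -/
noncomputable def passBody [NeZero K] (wr : Bool) : Prog :=
  branchAll (patExpr (D := D) (regExpr (N := K))) fun β =>
    act regExpr (template β) (if wr then newFacts β else [])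

variable (D K) in
/-- Running time of `passBody`. -/
noncomputable def passBodyCost [NeZero K] (wr : Bool) : ℕ :=
  (Finset.univ.sup fun β : Set (PatIdx D K) =>
    actCost regExpr (template β) (if wr then newFacts β else [])) + Fintype.card (PatIdx D K)

theorem ok_passBody [NeZero K] (wr : Bool) : (passBody D K wr).Ok actArrays :=
  ok_branchAll _ _ fun _ => ok_act _ _ _

theorem exec_passBody [NeZero K] (wr : Bool) {P : Set (MvPolynomial (Fin n) ℚ)}
    {F : Fin n → Fin n → D → D → Prop} {π : List (SparsePoly n)} {s : Memory}
    (h : DerivOk P F π s) {u : Fin K → Fin n} (hu : ∀ l : Fin K, s (reg l) 0 = u l) :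
    ∃ s', Exec (passBody D K wr) s s' (passBodyCost D K wr) ∧
      DerivOk P (addFacts F u (if wr then newFacts (pat F u) else []))
        (π ++ (template (pat F u)).map (SparsePoly.ren u)) s' := by
  have hu' : ∀ l, (regExpr (N := K) l).eval s = u l := fun l => by
    simpa [regExpr, Expr.eval] using hu l
  obtain ⟨s', h₁, h₂⟩ := h.exec_act uses_regExpr hu'
    (ℓ := template (pat F u)) (W := if wr then newFacts (pat F u) else [])
    ((exists_template (pat F u) (targets (pat F u)) eval_targets).choose_spec.2 n F u P π rfl
      h.pc h.lines)
    (by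
      intro y hy
      refine mem_template (List.mem_append_left _ (List.mem_map.2 ⟨y, ?_, rfl⟩))
      cases wr
      · simp at hy
      · simpa using hy)
  refine ⟨s', (exec_branchAll _ _ (mem_pat_iff hu' h.mem) h₁).mono ?_, h₂⟩
  exact Nat.add_le_add_right (Finset.le_sup
    (f := fun β : Set (PatIdx D K) => actCost regExpr (template β)
      (if wr then newFacts β else [])) (Finset.mem_univ _)) _

variable (D K) in
/-- Treat all tuples. -/
noncomputable def pass [NeZero K] (wr : Bool) : Prog := forTuples 0 K (passBody D K wr)

theorem ok_pass [NeZero K] (wr : Bool) :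
    (pass D K wr).Ok (actArrays ∪ {a | ∃ j, 0 ≤ j ∧ j < 0 + K ∧ a = reg j}) :=
  ok_forTuples_range (ok_passBody wr) _ _

/-- One round of the saturation. -/
theorem exec_pass_true [NeZero K] {P : Set (MvPolynomial (Fin n) ℚ)}
    {F₀ : Fin n → Fin n → D → D → Prop} {π₀ : List (SparsePoly n)} {s : Memory}
    (h : DerivOk P F₀ π₀ s) :
    ∃ s', Exec (pass D K true) s s' (tuplesCost n (passBodyCost D K true) K) ∧
      ∃ F π, DerivOk P F π s' ∧ F₀ ≤ F ∧ π₀ ⊆ π ∧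
        (F = F₀ ↔ ∀ u : Fin K → Fin n, IsSaturatedAt F₀ u) := by
  obtain ⟨s', h₁, F, π, h₂, h₃, h₄, h₅, h₆⟩ := exec_forTuples (n := n) (T := passBodyCost D K true)
    (ok_passBody (D := D) (K := K) true)
    (notMem_actArrays (by norm_num) (by norm_num) (by norm_num)) K 0
    (fun j _ _ => reg_notMem_actArrays j)
    (fun L s => ∃ F π, DerivOk P F π s ∧ F₀ ≤ F ∧ π₀ ⊆ π ∧
      (F = F₀ → ∀ u ∈ L, IsSaturatedAt F₀ u) ∧
      ((∀ u : Fin K → Fin n, IsSaturatedAt F₀ u) → F = F₀))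
    (by
      rintro L s s' hs ⟨F, π, h₁, h₂⟩
      exact ⟨F, π, h₁.congr_regs hs, h₂⟩)
    (by
      rintro L u s ⟨F, π, h₁, h₂, h₃, h₄, h₅⟩ hn hu
      obtain ⟨s', h', hs'⟩ := exec_passBody (K := K) true h₁ (u := u) (by simpa using hu)
      rw [if_pos rfl] at hs'
      have hle : F ≤ addFacts F u (newFacts (pat F u)) := fun i j a b => Or.inl
      refine ⟨s', h', _, _, hs', h₂.trans hle, fun p hp => List.mem_append_left _ (h₃ hp), ?_, ?_⟩
      · intro e
        -- The table only grows, so if it is unchanged at the end it was unchanged at every tuple.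
        have eF : F = F₀ := le_antisymm (hle.trans e.le) h₂
        intro v hv
        rcases List.mem_append.1 hv with hv | hv
        · exact h₄ eF v hv
        · obtain rfl := List.mem_singleton.1 hv
          subst eF
          exact isSaturatedAt_iff.2 e
      · intro hsat
        have eF := h₅ hsat
        subst eF
        exact isSaturatedAt_iff.1 (hsat u))
    s ⟨F₀, π₀, h, le_rfl, fun _ h => h, by simp, fun _ => rfl⟩ h.mem.size
  exact ⟨s', h₁, F, π, h₂, h₃, h₄, fun e u => h₅ e u (mem_tuples n K u), h₆⟩

/-- The last round, which derives the candidates. -/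
theorem exec_pass_false [NeZero K] {P : Set (MvPolynomial (Fin n) ℚ)}
    {F : Fin n → Fin n → D → D → Prop} {π₀ : List (SparsePoly n)} {s : Memory}
    (h : DerivOk P F π₀ s) :
    ∃ s', Exec (pass D K false) s s' (tuplesCost n (passBodyCost D K false) K) ∧
      ∃ π, DerivOk P F π s' ∧ π₀ ⊆ π ∧ ∀ u : Fin K → Fin n, ∀ g ∈ cand (pat F u),
        rename u g ∈ π.map SparsePoly.toPoly := by
  obtain ⟨s', h₁, π, h₂, h₃, h₄⟩ := exec_forTuples (n := n) (T := passBodyCost D K false)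
    (ok_passBody (D := D) (K := K) false)
    (notMem_actArrays (by norm_num) (by norm_num) (by norm_num)) K 0
    (fun j _ _ => reg_notMem_actArrays j)
    (fun L s => ∃ π, DerivOk P F π s ∧ π₀ ⊆ π ∧
      ∀ u ∈ L, ∀ g ∈ cand (pat F u), rename u g ∈ π.map SparsePoly.toPoly)
    (by
      rintro L s s' hs ⟨π, h₁, h₂⟩
      exact ⟨π, h₁.congr_regs hs, h₂⟩)
    (by
      rintro L u s ⟨π, h₁, h₂, h₃⟩ hn hu
      obtain ⟨s', h', hs'⟩ := exec_passBody (K := K) false h₁ (u := u) (by simpa using hu)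
      have e : addFacts F u (if false = true then newFacts (pat F u) else []) = F := by
        funext i j a b
        simp [addFacts]
      rw [e] at hs'
      refine ⟨s', h', _, hs', fun p hp => List.mem_append_left _ (h₂ hp), fun v hv g hg => ?_⟩
      rw [List.map_append]
      rcases List.mem_append.1 hv with hv | hv
      · exact List.mem_append_left _ (h₃ v hv g hg)
      · obtain rfl := List.mem_singleton.1 hv
        obtain ⟨p, hp, rfl⟩ := List.mem_map.1 (mem_template (List.mem_append_right _ hg))
        exact List.mem_append_right _ (List.mem_map.2
          ⟨p.ren v, List.mem_map_of_mem hp, SparsePoly.toPoly_ren _ _⟩))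
    s ⟨π₀, h, fun _ h => h, by simp⟩ h.mem.size
  exact ⟨s', h₁, π, h₂, h₃, fun u => h₄ u (mem_tuples n K u)⟩

/-- The number of excluded pairs. -/
noncomputable def factCount (F : Fin n → Fin n → D → D → Prop) : ℕ :=
  {y : Fin n × Fin n × D × D | F y.1 y.2.1 y.2.2.1 y.2.2.2}.ncard

theorem factCount_le (F : Fin n → Fin n → D → D → Prop) :
    factCount F ≤ n ^ 2 * D.card ^ 2 := by
  have := Set.ncard_le_card {y : Fin n × Fin n × D × D | F y.1 y.2.1 y.2.2.1 y.2.2.2}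
  simp only [Nat.card_eq_fintype_card, Fintype.card_prod, Fintype.card_fin,
    Fintype.card_coe] at this
  calc factCount F ≤ _ := this
    _ = n ^ 2 * D.card ^ 2 := by ring

theorem factCount_lt {F F' : Fin n → Fin n → D → D → Prop} (h : F ≤ F') (hne : F' ≠ F) :
    factCount F < factCount F' := by
  refine Set.ncard_lt_ncard ?_ (Set.toFinite _)
  refine ⟨fun y hy => h _ _ _ _ hy, fun hsub => hne (le_antisymm (fun i j a b hF => ?_) h)⟩
  exact hsub (show (i, j, a, b) ∈ _ from hF)

/-- Run a program a fixed number of times. -/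
def repeatProg (p : Prog) : ℕ → Prog
  | 0 => skip
  | m + 1 => .seq (repeatProg p m) p

theorem ok_repeatProg {A : Set ℕ} {p : Prog} (h9 : 9 ∈ A) (hp : p.Ok A) :
    ∀ m, (repeatProg p m).Ok A
  | 0 => ok_skip h9
  | m + 1 => ⟨ok_repeatProg h9 hp m, hp⟩

/-- After sufficiently many rounds the excluded pairs are saturated. -/
def RoundInv (K : ℕ) (P : Set (MvPolynomial (Fin n) ℚ)) (F₀ : Fin n → Fin n → D → D → Prop)
    (π₀ : List (SparsePoly n)) (m : ℕ) (s : Memory) : Prop :=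
  ∃ F π, DerivOk P F π s ∧ F₀ ≤ F ∧ π₀ ⊆ π ∧
    ((∀ u : Fin K → Fin n, IsSaturatedAt F u) ∨ m ≤ factCount F)

/-- A round that starts from an unsaturated table excludes at least one new pair, and a saturated
table no longer changes. -/
theorem exec_repeat_pass [NeZero K] {P : Set (MvPolynomial (Fin n) ℚ)}
    {F₀ : Fin n → Fin n → D → D → Prop} {π₀ : List (SparsePoly n)} (m₀ : ℕ) :
    ∀ (m : ℕ) (s : Memory), RoundInv K P F₀ π₀ m₀ s →
      ∃ s', Exec (repeatProg (pass D K true) m) s s'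
        (m * tuplesCost n (passBodyCost D K true) K + 1) ∧ RoundInv K P F₀ π₀ (m₀ + m) s' := by
  intro m
  induction m with
  | zero =>
    rintro s ⟨F, π, h₁, h₂⟩
    refine ⟨_, (Exec.assign _ _ _ _).mono (by omega), F, π, h₁.congr fun a ha => ?_, h₂⟩
    exact Memory.write_of_ne _ _ _ (by omega)
  | succ m ih =>
    intro s hs
    obtain ⟨s₁, h₁, F, π, h₂, h₃, h₄, h₅⟩ := ih s hs
    obtain ⟨s₂, h₆, F', π', h₇, h₈, h₉, h₁₀⟩ := exec_pass_true (K := K) h₂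
    refine ⟨s₂, (h₁.seq h₆).mono (by rw [Nat.succ_mul]; omega), F', π', h₇, h₃.trans h₈,
      fun p hp => h₉ (h₄ hp), ?_⟩
    by_cases hsat : ∀ u : Fin K → Fin n, IsSaturatedAt F u
    · left
      rw [h₁₀.2 hsat]
      exact hsat
    · right
      have := factCount_lt h₈ fun e => hsat (h₁₀.1 e)
      have := h₅.resolve_left hsat
      omega

variable (D K) in
/-- All rounds. -/
noncomputable def saturate [NeZero K] : Prog :=
  forTuples (K + K) 2 (repeatProg (pass D K true) (D.card ^ 2 + 1))

/-- The arrays changed by the passes. -/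
def passArrays (K : ℕ) : Set ℕ := actArrays ∪ {a | ∃ j, 0 ≤ j ∧ j < 0 + K ∧ a = reg j}

theorem ok_repeat_pass [NeZero K] (m : ℕ) :
    (repeatProg (pass D K true) m).Ok (passArrays K) :=
  ok_repeatProg (Or.inl (Or.inr (Or.inr (Or.inl rfl)))) (ok_pass true) m

theorem notMem_passArrays {a : ℕ} (ha : a < 9) (h1 : a ≠ 1) (h3 : a ≠ 3) : a ∉ passArrays K := by
  rintro (h | ⟨j, -, -, h⟩)
  · exact notMem_actArrays ha h1 h3 h
  · unfold reg at h
    omega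

theorem exec_saturate [NeZero K] {P : Set (MvPolynomial (Fin n) ℚ)}
    {F₀ : Fin n → Fin n → D → D → Prop} {π₀ : List (SparsePoly n)} {s : Memory}
    (h : DerivOk P F₀ π₀ s) :
    ∃ s', Exec (saturate D K) s s' (tuplesCost n
        ((D.card ^ 2 + 1) * tuplesCost n (passBodyCost D K true) K + 1) 2) ∧
      ∃ F π, DerivOk P F π s' ∧ F₀ ≤ F ∧ π₀ ⊆ π ∧ ∀ u : Fin K → Fin n, IsSaturatedAt F u := by
  obtain ⟨s', h₁, F, π, h₂, h₃, h₄, h₅⟩ := exec_forTuples (n := n)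
    (ok_repeat_pass (D := D) (K := K) (D.card ^ 2 + 1))
    (notMem_passArrays (by norm_num) (by norm_num) (by norm_num)) 2 (K + K)
    (by
      rintro j hj - (h | ⟨j', -, h₁, h₂⟩)
      · exact reg_notMem_actArrays j h
      · rw [reg_inj] at h₂
        omega)
    (fun L s => RoundInv K P F₀ π₀ ((D.card ^ 2 + 1) * L.length) s)
    (by
      rintro L s s' hs ⟨F, π, h₁, h₂⟩
      exact ⟨F, π, h₁.congr_regs hs, h₂⟩)
    (by
      intro L u s hs _ _
      obtain ⟨s', h', hs'⟩ := exec_repeat_pass _ (D.card ^ 2 + 1) s hs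
      exact ⟨s', h', by simpa [Nat.mul_add] using hs'⟩)
    s ⟨F₀, π₀, h, le_rfl, fun _ h => h, Or.inr (by simp)⟩ h.mem.size
  -- There were `n² (|D|² + 1)` rounds, the two outer registers only counting; this exceeds the
  -- maximal number `n² |D|²` of excluded pairs unless `n = 0`, when there are no `K`-tuples.
  refine ⟨s', h₁, F, π, h₂, h₃, h₄, h₅.elim id fun hc => ?_⟩
  rw [length_tuples] at hc
  have := hc.trans (factCount_le F)
  have hn : n = 0 := by
    by_contra hn
    have : 0 < n ^ 2 := Nat.pow_pos (Nat.pos_of_ne_zero hn)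
    nlinarith
  subst hn
  exact fun u => (u 0).elim0

end Passes

/-! ### Reading the instance -/

section Parsing

variable {D : Finset ℚ} {Γ : ConstraintLanguage D} {n : ℕ}

open Classical in
/-- The pairs of values that a relation of the language excludes. -/
noncomputable def relFacts (Γ : ConstraintLanguage D) (r : Fin Γ.size) :
    List (Fin (Γ.arity r) × Fin (Γ.arity r) × D × D) :=
  (Finset.univ.filter fun y : Fin (Γ.arity r) × Fin (Γ.arity r) × D × D =>
    ¬ ∃ t ∈ Γ.rel r, t y.1 = y.2.2.1 ∧ t y.2.1 = y.2.2.2).toList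

theorem mem_relFacts {r : Fin Γ.size} {y : Fin (Γ.arity r) × Fin (Γ.arity r) × D × D} :
    y ∈ relFacts Γ r ↔ ¬ ∃ t ∈ Γ.rel r, t y.1 = y.2.2.1 ∧ t y.2.1 = y.2.2.2 := by
  simp [relFacts]

/-- The pairs excluded by the constraint `c` belong to `F`. -/
def ExcludesPairs (F : Fin n → Fin n → D → D → Prop) (c : Constraint Γ n) : Prop :=
  ∀ j k a b, (¬ ∃ t ∈ Γ.rel c.rel, t j = a ∧ t k = b) → F (c.scope j) (c.scope k) a b

/-- `ℓ` derives from the polynomials of the language the pairs that the relations exclude, and a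
contradiction from those of the empty relations. -/
structure LangTemplate (Γ : ConstraintLanguage D)
    (f : (i : Fin Γ.size) → MvPolynomial (Fin (Γ.arity i)) ℚ)
    (ℓ : (i : Fin Γ.size) → List (SparsePoly (Γ.arity i))) : Prop where
  pc : ∀ r, PCList D {f r} ((ℓ r).map SparsePoly.toPoly)
  facts : ∀ r, ∀ y ∈ relFacts Γ r,
    factPoly y.1 y.2.1 y.2.2.1 y.2.2.2 ∈ (ℓ r).map SparsePoly.toPoly
  one : ∀ r, Γ.rel r = ∅ → 1 ∈ (ℓ r).map SparsePoly.toPoly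

theorem exists_langTemplate {f : (i : Fin Γ.size) → MvPolynomial (Fin (Γ.arity i)) ℚ}
    (hf : DefinesRelations Γ f) : ∃ ℓ, LangTemplate Γ f ℓ := by
  classical
  have key : ∀ r, ∃ ℓ : List (SparsePoly (Γ.arity r)), PCList D {f r} (ℓ.map SparsePoly.toPoly) ∧
      ∀ g ∈ (relFacts Γ r).map (fun y => factPoly y.1 y.2.1 y.2.2.1 y.2.2.2) ++
        (if Γ.rel r = ∅ then [1] else []), g ∈ ℓ.map SparsePoly.toPoly := by
    intro r
    refine exists_sparse_derivation (P := {f r}) (g₀ := f r) (Or.inl rfl) _ fun g hg φ hφ => ?_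
    have hmem : φ ∈ Γ.rel r := (hf r φ).1 (hφ _ rfl)
    rcases List.mem_append.1 hg with hg | hg
    · obtain ⟨y, hy, rfl⟩ := List.mem_map.1 hg
      rw [eval_factPoly]
      exact fun h => mem_relFacts.1 hy ⟨φ, hmem, h⟩
    · split_ifs at hg with he
      · rw [he] at hmem
        exact hmem.elim
      · simp at hg
  choose ℓ h₁ h₂ using key
  refine ⟨ℓ, h₁, fun r y hy => h₂ r _ (List.mem_append_left _ (List.mem_map.2 ⟨y, hy, rfl⟩)),
    fun r hr => h₂ r _ (List.mem_append_right _ ?_)⟩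
  simp [hr]

/-- The position of the relation index of the current constraint. -/
def ipExpr : Expr := .read 5 (.const 0)

/-- The variables of the current constraint. -/
def slotExpr {N : ℕ} (j : Fin N) : Expr := .read 0 (.add ipExpr (.const (1 + j)))

theorem uses_slotExpr {N : ℕ} (j : Fin N) (a : ℕ) (h : (slotExpr j).Uses a) : a ∉ actArrays := by
  have : a = 0 ∨ a = 5 := by
    simpa [slotExpr, ipExpr, Expr.Uses] using h
  rcases this with rfl | rfl <;> exact notMem_actArrays (by norm_num) (by norm_num) (by norm_num)

/-- Test whether the current relation has the index `r`. -/
def relTest (Γ : ConstraintLanguage D) (r : Fin Γ.size) : Expr :=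
  .sub (.const 1) (.add (.sub (.read 0 ipExpr) (.const r)) (.sub (.const r) (.read 0 ipExpr)))

open Classical in
/-- Treat a constraint with relation `r`. -/
noncomputable def parseRel (ℓ : (i : Fin Γ.size) → List (SparsePoly (Γ.arity i)))
    (r : Fin Γ.size) : Prog :=
  .seq (act slotExpr (ℓ r) (relFacts Γ r))
    (.seq (.assign 6 (.const 0) (if Γ.rel r = ∅ then .const 1 else .read 6 (.const 0)))
      (.assign 5 (.const 0) (.add ipExpr (.const (1 + Γ.arity r)))))

open Classical in
/-- Treat one constraint. -/
noncomputable def parseBody (ℓ : (i : Fin Γ.size) → List (SparsePoly (Γ.arity i))) : Prog :=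
  .seq (.assign 5 (.const 0) (.add ipExpr (.const 1)))
    (branchAll (relTest Γ) fun S => if h : S.Nonempty then parseRel ℓ h.choose else skip)

/-- Treat all constraints. -/
noncomputable def parse (ℓ : (i : Fin Γ.size) → List (SparsePoly (Γ.arity i))) : Prog :=
  .loop (.read 0 ipExpr) (parseBody ℓ)

/-- Running time of `parseBody`. -/
noncomputable def parseBodyCost (ℓ : (i : Fin Γ.size) → List (SparsePoly (Γ.arity i))) : ℕ :=
  (Finset.univ.sup fun r => actCost slotExpr (ℓ r) (relFacts Γ r)) + 3 + Γ.size

theorem ok_parse (ℓ : (i : Fin Γ.size) → List (SparsePoly (Γ.arity i))) :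
    (parse ℓ).Ok Set.univ := by
  refine ⟨⟨trivial, by norm_num⟩, ok_branchAll _ _ fun S => ?_⟩
  split_ifs
  · exact ⟨(ok_act _ _ _).mono (Set.subset_univ _), ⟨trivial, by norm_num⟩, trivial, by norm_num⟩
  · exact ok_skip trivial

open Classical in
theorem exec_parseBody {f : (i : Fin Γ.size) → MvPolynomial (Fin (Γ.arity i)) ℚ}
    {ℓ : (i : Fin Γ.size) → List (SparsePoly (Γ.arity i))} (hℓ : LangTemplate Γ f ℓ)
    {P : Set (MvPolynomial (Fin n) ℚ)} {F : Fin n → Fin n → D → D → Prop}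
    {π : List (SparsePoly n)} {s : Memory} (h : DerivOk P F π s) {c : Constraint Γ n}
    (hc : rename c.scope (f c.rel) ∈ P) {p : ℕ} (hp : s 5 0 = p) (hrel : s 0 (p + 1) = c.rel)
    (hscope : ∀ j : Fin (Γ.arity c.rel), s 0 (p + 2 + j) = c.scope j) :
    ∃ s', Exec (parseBody ℓ) s s' (parseBodyCost ℓ) ∧ s' 0 = s 0 ∧
      s' 5 0 = p + 2 + Γ.arity c.rel ∧ (s' 6 0 ≠ 0 ↔ s 6 0 ≠ 0 ∨ Γ.rel c.rel = ∅) ∧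
      DerivOk P (addFacts F c.scope (relFacts Γ c.rel))
        (π ++ (ℓ c.rel).map (SparsePoly.ren c.scope)) s' := by
  set s₁ := s.write 5 0 (p + 1) with hs₁
  have h5 : s₁ 5 0 = p + 1 := Memory.write_same _ _ _ _
  have h0 : s₁ 0 = s 0 := Memory.write_of_ne _ _ _ (by norm_num)
  have hex₁ : Exec (.assign 5 (.const 0) (.add ipExpr (.const 1))) s s₁ 1 := by
    simpa only [Expr.eval, ipExpr, hp] using
      Exec.assign 5 (.const 0) (.add ipExpr (.const 1)) s
  have hd₁ : DerivOk P F π s₁ := h.congr fun a ha => Memory.write_of_ne _ _ _ (by omega)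
  have hslot : ∀ j, (slotExpr (N := Γ.arity c.rel) j).eval s₁ = c.scope j := fun j => by
    rw [← hscope]
    simp only [slotExpr, ipExpr, Expr.eval, h5, h0]
    congr 1
    omega
  obtain ⟨s₂, hex₂, hd₂⟩ := hd₁.exec_act uses_slotExpr hslot (ℓ := ℓ c.rel)
    (W := relFacts Γ c.rel)
    (by
      rw [List.map_append]
      refine hd₁.pc.append_same ?_
      have : ((ℓ c.rel).map (SparsePoly.ren c.scope)).map SparsePoly.toPoly =
          ((ℓ c.rel).map SparsePoly.toPoly).map (rename c.scope) := by
        simp [List.map_map, Function.comp_def, SparsePoly.toPoly_ren]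
      rw [this]
      refine ((hℓ.pc c.rel).rename c.scope).mono_premises ?_
      rintro _ ⟨p, rfl, rfl⟩
      exact hc)
    (hℓ.facts c.rel)
  have hfr : ∀ a, a < 9 → a ≠ 1 → a ≠ 3 → s₂ a = s₁ a := fun a h₁ h₂ h₃ =>
    hex₂.frame (ok_act _ _ _) (notMem_actArrays h₁ h₂ h₃)
  have hex₃ := Exec.assign 6 (.const 0)
    (if Γ.rel c.rel = ∅ then .const 1 else .read 6 (.const 0)) s₂
  set s₃ := s₂.write 6 ((Expr.const 0).eval s₂)
    (Expr.eval s₂ (if Γ.rel c.rel = ∅ then .const 1 else .read 6 (.const 0))) with hs₃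
  have hex₄ := Exec.assign 5 (.const 0) (.add ipExpr (.const (1 + Γ.arity c.rel))) s₃
  set s₄ := s₃.write 5 ((Expr.const 0).eval s₃)
    ((Expr.add ipExpr (.const (1 + Γ.arity c.rel))).eval s₃) with hs₄
  refine ⟨s₄, ?_, ?_, ?_, ?_, ?_⟩
  -- With truncated subtraction, `1 - ((x - r) + (r - x))` is nonzero exactly when `x = r`, so the
  -- branch taken belongs to a singleton.
  · have hS : ∀ r, r ∈ ({c.rel} : Set (Fin Γ.size)) ↔ (relTest Γ r).eval s₁ ≠ 0 := by
      intro r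
      simp only [relTest, Expr.eval, ipExpr, h5, h0, hrel, Set.mem_singleton_iff, Fin.ext_iff]
      omega
    have hne : ({c.rel} : Set (Fin Γ.size)).Nonempty := Set.singleton_nonempty _
    have hch : hne.choose = c.rel := hne.choose_spec
    have hex := exec_branchAll (relTest Γ)
      (fun S => if h : S.Nonempty then parseRel ℓ h.choose else skip) hS (s' := s₄)
      (T := actCost slotExpr (ℓ c.rel) (relFacts Γ c.rel) + (1 + 1)) (by
        simp only [hne, dif_pos]
        rw [hch]
        exact hex₂.seq (hex₃.seq hex₄))
    refine (hex₁.seq hex).mono ?_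
    have := Finset.le_sup (f := fun r => actCost slotExpr (ℓ r) (relFacts Γ r))
      (Finset.mem_univ c.rel)
    simp only [Fintype.card_fin, parseBodyCost] at this ⊢
    omega
  · rw [hs₄, Memory.write_of_ne _ _ _ (by norm_num), hs₃, Memory.write_of_ne _ _ _ (by norm_num),
      hfr 0 (by norm_num) (by norm_num) (by norm_num), h0]
  · have : s₃ 5 0 = p + 1 := by
      rw [hs₃, Memory.write_of_ne _ _ _ (by norm_num),
        hfr 5 (by norm_num) (by norm_num) (by norm_num), h5]
    rw [hs₄]
    simp only [Expr.eval, ipExpr, this]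
    rw [Memory.write_same]
    omega
  · have h6 : s₂ 6 0 = s 6 0 := by
      rw [hfr 6 (by norm_num) (by norm_num) (by norm_num), hs₁,
        Memory.write_of_ne _ _ _ (by norm_num)]
    rw [hs₄, Memory.write_of_ne _ _ _ (by norm_num), hs₃, Expr.eval, Memory.write_same]
    split_ifs with he
    · simp [Expr.eval, he]
    · simp [Expr.eval, he, h6]
  · exact (hd₂.congr fun a ha => Memory.write_of_ne _ _ _ (by omega)).congr
      fun a ha => Memory.write_of_ne _ _ _ (by omega)

/-- The encoding of a constraint. -/
def Constraint.code (c : Constraint Γ n) : List ℕ :=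
  c.rel.val :: List.ofFn (fun j => (c.scope j).val)

/-- The list `pre` is the input already consumed, and the marker at the current position controls
the loop. Empty relations are flagged because the excluded pairs describe a relation only if it is
nonempty; a raised flag comes with a derivation of `1`. -/
theorem exec_parse {f : (i : Fin Γ.size) → MvPolynomial (Fin (Γ.arity i)) ℚ}
    {ℓ : (i : Fin Γ.size) → List (SparsePoly (Γ.arity i))} (hℓ : LangTemplate Γ f ℓ)
    {P : Set (MvPolynomial (Fin n) ℚ)} :
    ∀ (rest : List (Constraint Γ n)) (pre : List ℕ) (F : Fin n → Fin n → D → D → Prop)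
      (π : List (SparsePoly n)) (s : Memory), DerivOk P F π s →
      (∀ c ∈ rest, rename c.scope (f c.rel) ∈ P) → s 5 0 = pre.length →
      (∀ i, s 0 i = (pre ++ encodeList Constraint.code rest).getD i 0) →
      (s 6 0 ≠ 0 → 1 ∈ π.map SparsePoly.toPoly) →
      ∃ s', Exec (parse ℓ) s s' (rest.length * (parseBodyCost ℓ + 1) + 1) ∧
        ∃ F' π', DerivOk P F' π' s' ∧ F ≤ F' ∧ (∀ c ∈ rest, ExcludesPairs F' c) ∧
          (s' 6 0 ≠ 0 → 1 ∈ π'.map SparsePoly.toPoly) ∧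
          (s' 6 0 = 0 → s 6 0 = 0 ∧ ∀ c ∈ rest, (Γ.rel c.rel).Nonempty) := by
  intro rest
  induction rest with
  | nil =>
    intro pre F π s h _ h5 h0 h6
    refine ⟨s, (Exec.loop_false ?_).mono (by omega), F, π, h, le_rfl, by simp, h6, by simp⟩
    simp [Expr.eval, ipExpr, h5, h0, encodeList]
  | cons c rest ih =>
    intro pre F π s h hP h5 h0 h6
    have hin : pre ++ encodeList Constraint.code (c :: rest) =
        (pre ++ 1 :: c.code) ++ encodeList Constraint.code rest := by
      simp [encodeList]
    have hcell : ∀ i (hi : i < (1 :: c.code).length), s 0 (pre.length + i) = (1 :: c.code)[i] := by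
      intro i hi
      rw [h0, hin, List.getD_append _ _ _ _ (by simpa using hi),
        List.getD_append_right _ _ _ _ (by omega), Nat.add_sub_cancel_left,
        List.getD_eq_getElem _ _ hi]
    obtain ⟨s₁, hex₁, e0, e5, e6, hd₁⟩ := exec_parseBody hℓ h (hP c List.mem_cons_self) h5
      (by simpa [Constraint.code] using hcell 1 (by simp [Constraint.code]))
      (by
        intro j
        have := hcell (2 + j) (by simp [Constraint.code]; omega)
        rw [← add_assoc] at this
        rw [this]
        simp [Constraint.code, Nat.add_comm 2])
    obtain ⟨s₂, hex₂, F', π', hd₂, hF, hex, h1, hz⟩ := ih (pre ++ 1 :: c.code) _ _ s₁ hd₁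
      (fun c hc => hP c (List.mem_cons_of_mem _ hc))
      (by simp [e5, Constraint.code]; omega)
      (by rw [e0, ← hin]; exact h0)
      (by
        intro hne
        rw [List.map_append]
        rcases e6.1 hne with h' | h'
        · exact List.mem_append_left _ (h6 h')
        · obtain ⟨p, hp, e⟩ := List.mem_map.1 (hℓ.one c.rel h')
          exact List.mem_append_right _ (List.mem_map.2 ⟨p.ren c.scope, List.mem_map_of_mem hp,
            by rw [SparsePoly.toPoly_ren, e, map_one]⟩))
    refine ⟨s₂, (Exec.loop_true ?_ hex₁ hex₂).mono ?_, F', π', hd₂, ?_, ?_, h1, ?_⟩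
    · have := hcell 0 (by simp)
      simp only [Expr.eval, ipExpr, h5]
      simp only [List.getElem_cons_zero, add_zero] at this
      omega
    · rw [List.length_cons, Nat.succ_mul]
      omega
    · exact fun i j a b hF' => hF i j a b (Or.inl hF')
    · intro c' hc'
      rcases List.mem_cons.1 hc' with rfl | hc'
      · exact fun j j' a b hj => hF _ _ _ _ (Or.inr ⟨(j, j', a, b), mem_relFacts.2 hj,
          rfl, rfl, rfl, rfl⟩)
      · exact hex c' hc'
    · intro hz'
      obtain ⟨h₁, h₂⟩ := hz hz'
      have := (not_congr e6).1 (not_not.2 h₁)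
      rw [not_or, not_not] at this
      refine ⟨this.1, fun d hd => ?_⟩
      rcases List.mem_cons.1 hd with rfl | hd
      · exact Set.nonempty_iff_ne_empty.2 this.2
      · exact h₂ d hd

/-! ### Initialization -/

/-- Store the number of variables and its multiples. -/
def start : Prog :=
  .seq (.assign 2 (.const 0) (.read 0 (.const 0)))
    (.seq (.assign 5 (.const 0) (.const 1))
      (forN (reg 0) (.assign 4 (.add (.read (reg 0) (.const 0)) (.const 1))
        (.add (.read 4 (.read (reg 0) (.const 0))) (.read 2 (.const 0))))))

theorem ok_start : start.Ok Set.univ :=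
  ⟨⟨trivial, by norm_num⟩, ⟨trivial, by norm_num⟩,
    ok_forN trivial (by norm_num [reg]) ⟨trivial, by norm_num⟩⟩

/-- The multiples of `n` are built by repeated addition. The input position starts at `1`, behind
the number of variables. -/
theorem exec_start (P : Set (MvPolynomial (Fin n) ℚ)) (l : List ℕ) :
    ∃ s', Exec start (initial (n :: l)) s' (n * 3 + 4) ∧
      DerivOk P (fun _ _ (_ _ : D) => False) [] s' ∧ s' 0 = initial (n :: l) 0 ∧ s' 5 0 = 1 ∧
      s' 6 0 = 0 := by
  set s := initial (n :: l) with hs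
  set s₁ := s.write 2 0 n with hs₁
  set s₂ := s₁.write 5 0 1 with hs₂
  have hex₁ : Exec (.assign 2 (.const 0) (.read 0 (.const 0))) s s₁ 1 := by
    simpa [Expr.eval, hs, initial] using Exec.assign 2 (.const 0) (.read 0 (.const 0)) s
  have hex₂ : Exec (.assign 5 (.const 0) (.const 1)) s₁ s₂ 1 := Exec.assign _ _ _ _
  have hz : ∀ a, a ≠ 0 → a ≠ 2 → a ≠ 5 → s₂ a = fun _ => 0 := by
    intro a h0 h2 h5
    rw [hs₂, Memory.write_of_ne _ _ _ h5, hs₁, Memory.write_of_ne _ _ _ h2, hs]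
    funext i
    simp [initial, h0]
  have h2 : s₂ 2 0 = n := by
    rw [hs₂, Memory.write_of_ne _ _ _ (by norm_num), hs₁, Memory.write_same]
  obtain ⟨s₃, hex₃, h4, hfr⟩ := exec_forN (A := {4}) (r := reg 0) (n := n) (T := 1)
    (body := .assign 4 (.add (.read (reg 0) (.const 0)) (.const 1))
        (.add (.read 4 (.read (reg 0) (.const 0))) (.read 2 (.const 0))))
    ⟨rfl, by norm_num⟩ (by norm_num [reg]) (by norm_num) (by norm_num [reg])
    (fun i s => (∀ j ≤ i, s 4 j = j * n) ∧ ∀ a, a ≠ 4 → a ≠ reg 0 → s a = s₂ a)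
    (by
      rintro i s x ⟨h₁, h₂⟩
      refine ⟨fun j hj => ?_, fun a ha ha' => ?_⟩
      · rw [Memory.write_of_ne _ _ _ (by norm_num [reg]), h₁ j hj]
      · rw [Memory.write_of_ne _ _ _ ha', h₂ a ha ha'])
    (by
      rintro i hi s ⟨h₁, h₂⟩ hn hr
      refine ⟨_, Exec.assign _ _ _ _, fun j hj => ?_, fun a ha ha' => ?_⟩
      · simp only [Expr.eval, hr, hn, h₁ i le_rfl]
        by_cases hji : j = i + 1
        · subst hji
          rw [Memory.write_same]
          ring
        · rw [Memory.write_of_ne_index _ _ _ hji, h₁ j (by omega)]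
      · rw [Memory.write_of_ne _ _ _ ha, h₂ a ha ha'])
    s₂ ⟨by
      intro j hj
      rw [hz 4 (by norm_num) (by norm_num) (by norm_num)]
      simp [Nat.le_zero.1 hj], fun _ _ _ => rfl⟩ h2
  have hfr' : ∀ a, a ≠ 4 → a ≠ 10 → s₃ a = s₂ a := hfr
  refine ⟨s₃, (hex₁.seq (hex₂.seq hex₃)).mono (by omega), ⟨⟨?_, ?_, ?_⟩, ⟨?_, ?_⟩, .nil, ?_⟩,
    ?_, ?_, ?_⟩
  · rw [hfr' 2 (by norm_num) (by norm_num), h2]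
  · exact fun i => h4 i i.2.le
  · intro i j a b
    have : s₃ (factArr a b) = fun _ => 0 := by
      rw [hfr', hz] <;> unfold factArr <;> omega
    simp [this]
  · intro i
    rw [hfr' 1 (by norm_num) (by norm_num), hz 1 (by norm_num) (by norm_num) (by norm_num)]
    simp [encodeLines]
  · rw [hfr' 3 (by norm_num) (by norm_num), hz 3 (by norm_num) (by norm_num) (by norm_num)]
    simp [encodeLines]
  · simp
  · rw [hfr' 0 (by norm_num) (by norm_num), hs₂, Memory.write_of_ne _ _ _ (by norm_num), hs₁,
      Memory.write_of_ne _ _ _ (by norm_num)]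
  · rw [hfr' 5 (by norm_num) (by norm_num), hs₂, Memory.write_same]
  · rw [hfr' 6 (by norm_num) (by norm_num), hz 6 (by norm_num) (by norm_num) (by norm_num)]

end Parsing

/-! ### The number of constraints -/

/-- Constraints do not repeat, so their number, and with it the parsing time, is polynomial in `n`
alone. -/
theorem CSPInstance.length_constraints_le {D : Finset ℚ} {Γ : ConstraintLanguage D} {n : ℕ}
    (𝒞 : CSPInstance Γ n) : 𝒞.constraints.length ≤ ∑ r, n ^ Γ.arity r := by
  have hinj : Function.Injective
      (fun c : Constraint Γ n => (⟨c.rel, c.scope⟩ : Σ r, Fin (Γ.arity r) → Fin n)) := by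
    rintro ⟨r, w⟩ ⟨r', w'⟩ h
    simp only [Sigma.mk.injEq] at h
    obtain ⟨rfl, h⟩ := h
    obtain rfl := eq_of_heq h
    rfl
  have := (𝒞.nodup.map hinj).length_le_card
  simpa using this

/-! ### Printing the Gröbner basis -/

section Selection

variable {D : Finset ℚ} {K n : ℕ}

/-- The table holds `F`, and `o` has been printed. -/
def TableOut (F : Fin n → Fin n → D → D → Prop) (o : List ℕ) (s : Memory) : Prop :=
  MemOk F s ∧ OutIs s o

theorem TableOut.congr {F : Fin n → Fin n → D → D → Prop} {o : List ℕ} {s s' : Memory}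
    (h : TableOut F o s) (hs : ∀ a, (a < 5 ∨ ∃ c, a = 11 + 2 * c) → s' a = s a) :
    TableOut F o s' :=
  ⟨h.1.congr (hs 2 (by simp)) (hs 4 (by simp)) fun _ _ => hs _ (Or.inr ⟨_, rfl⟩),
    h.2.congr (hs 1 (by simp)) (hs 3 (by simp))⟩

theorem notMem_regsFrom {r a : ℕ} (ha : a < 10 ∨ ∃ c, a = 11 + 2 * c) : a ∉ regsFrom r := by
  rintro ⟨j, -, rfl⟩
  unfold reg at ha
  omega

/-- The test for a candidate `g` at the tuple `u` extended by `v`. -/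
def PassesAt (F : Fin n → Fin n → D → D → Prop) (u v : Fin K → Fin n)
    (g : MvPolynomial (Fin K) ℚ) : Prop :=
  LocallyReduced (patOrd (pat F (Fin.append u v))) (patSols (pat F (Fin.append u v)))
    (rename (Fin.castAdd K) g)

open Classical in
variable (D) in
/-- Clear the flag if the test fails for the tuple in the registers. -/
noncomputable def testBody (g : MvPolynomial (Fin K) ℚ) : Prog :=
  branchAll (patExpr (D := D) (regExpr (N := K + K))) fun β =>
    if LocallyReduced (patOrd β) (patSols β) (rename (Fin.castAdd K) g) then skip
    else .assign 7 (.const 0) (.const 0)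

theorem ok_testBody (g : MvPolynomial (Fin K) ℚ) : (testBody D g).Ok {7, 9} := by
  refine ok_branchAll _ _ fun β => ?_
  split_ifs
  · exact ok_skip (by simp)
  · exact ⟨by simp, by norm_num⟩

theorem exec_testBody (g : MvPolynomial (Fin K) ℚ) {F : Fin n → Fin n → D → D → Prop}
    {s : Memory} (h : MemOk F s) {u v : Fin K → Fin n}
    (hu : ∀ l : Fin K, s (reg l) 0 = u l) (hv : ∀ l : Fin K, s (reg (K + l)) 0 = v l) :
    ∃ s', Exec (testBody D g) s s' (1 + Fintype.card (PatIdx D (K + K))) ∧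
      (s' 7 0 ≠ 0 ↔ s 7 0 ≠ 0 ∧ PassesAt F u v g) := by
  classical
  have hw : ∀ l : Fin (K + K), (regExpr l).eval s = Fin.append u v l := by
    intro l
    refine Fin.addCases (fun l => ?_) (fun l => ?_) l
    · simpa [regExpr, Expr.eval] using hu l
    · rw [Fin.append_right]
      exact hv l
  by_cases hp : PassesAt F u v g
  · refine ⟨s.write 9 0 0, exec_branchAll _ _ (mem_pat_iff hw h) (T := 1) ?_, ?_⟩
    · rw [if_pos (show LocallyReduced _ _ _ from hp)]
      exact Exec.assign _ _ _ _
    · rw [Memory.write_of_ne _ _ _ (by norm_num)]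
      simp [hp]
  · refine ⟨s.write 7 0 0, exec_branchAll _ _ (mem_pat_iff hw h) (T := 1) ?_, ?_⟩
    · rw [if_neg (show ¬ LocallyReduced _ _ _ from hp)]
      exact Exec.assign _ _ _ _
    · rw [Memory.write_same]
      simp [hp]

variable (D) in
/-- Print the candidate `g`, renamed by the tuple in the registers, if it passes all tests. -/
noncomputable def select (g : MvPolynomial (Fin K) ℚ) : Prog :=
  .seq (.assign 7 (.const 0) (.const 1))
    (.seq (forTuples K K (testBody D g))
      (.ite (.read 7 (.const 0)) (emit (linesExpr regExpr [sparse g])) skip))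

variable (D n) in
/-- Running time of `select`. -/
noncomputable def selectCost (g : MvPolynomial (Fin K) ℚ) : ℕ :=
  1 + (tuplesCost n (1 + Fintype.card (PatIdx D (K + K))) K +
    (2 * (linesExpr regExpr [sparse g]).length + 1 + 1))

/-- The arrays changed by the selection. -/
def selectArrays (K : ℕ) : Set ℕ :=
  {a | a = 1 ∨ a = 3 ∨ a = 7 ∨ a = 9} ∪ {a | ∃ j, K ≤ j ∧ j < K + K ∧ a = reg j}

theorem ok_select (g : MvPolynomial (Fin K) ℚ) : (select D g).Ok (selectArrays K) := by
  have h9 : 9 ∈ selectArrays K := Or.inl (by simp)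
  refine ⟨⟨Or.inl (by simp), by norm_num⟩, (ok_forTuples_range (ok_testBody g) K K).mono ?_,
    ok_emit (Or.inl (by simp)) (Or.inl (by simp)) h9 _, ok_skip h9⟩
  refine Set.union_subset_union_left _ ?_
  rintro a (rfl | rfl)
  · simp
  · simp

theorem reg_notMem_selectArrays (l : Fin K) : reg l ∉ selectArrays K := by
  rintro (h | ⟨j, h₁, -, h₃⟩)
  · simp only [Set.mem_ofPred_eq] at h
    unfold reg at h
    omega
  · rw [reg_inj] at h₃
    omega

open Classical in
/-- The selected candidates at the tuple `u`. -/
noncomputable def selected (F : Fin n → Fin n → D → D → Prop) (u : Fin K → Fin n)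
    (L : List (MvPolynomial (Fin K) ℚ)) : List (SparsePoly n) :=
  (L.filter fun g => ∀ v, PassesAt F u v g).map fun g => (sparse g).ren u

/-- Flag `7` survives the inner loop over `v` exactly if every local test succeeds. The outer tuple
`u` stays in the registers below `K`; the inner loop uses the next `K`. -/
theorem exec_select (g : MvPolynomial (Fin K) ℚ) {F : Fin n → Fin n → D → D → Prop}
    {o : List ℕ} {s : Memory} (h : TableOut F o s) {u : Fin K → Fin n}
    (hu : ∀ l : Fin K, s (reg l) 0 = u l) :
    ∃ s', Exec (select D g) s s' (selectCost D n g) ∧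
      TableOut F (o ++ encodeLines (selected F u [g])) s' := by
  classical
  set s₁ := s.write 7 0 1 with hs₁
  have hex₁ : Exec (.assign 7 (.const 0) (.const 1)) s s₁ 1 := Exec.assign _ _ _ _
  have h₁ : TableOut F o s₁ := h.congr fun a ha => Memory.write_of_ne _ _ _ (by omega)
  have hu₁ : ∀ l : Fin K, s₁ (reg l) 0 = u l := fun l => by
    rw [hs₁, Memory.write_of_ne _ _ _ (by unfold reg; omega), hu]
  obtain ⟨s₂, hex₂, h₂, hu₂, h7⟩ := exec_forTuples (n := n)
    (T := 1 + Fintype.card (PatIdx D (K + K))) (ok_testBody (D := D) g) (by norm_num) K K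
    (by
      intro j _ _ h
      simp only [Set.mem_insert_iff, Set.mem_singleton_iff] at h
      unfold reg at h
      omega)
    (fun L s => TableOut F o s ∧ (∀ l : Fin K, s (reg l) 0 = u l) ∧
      (s 7 0 ≠ 0 ↔ ∀ v ∈ L, PassesAt F u v g))
    (by
      rintro L s s' hs ⟨h₁, h₂, h₃⟩
      refine ⟨h₁.congr fun a ha => hs a (notMem_regsFrom (ha.imp_left (by omega))), fun l => ?_, ?_⟩
      · rw [hs, h₂]
        rintro ⟨j, hj, e⟩
        rw [reg_inj] at e
        omega
      · rw [hs 7 (notMem_regsFrom (by norm_num)), h₃])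
    (by
      rintro L v s ⟨h₁, h₂, h₃⟩ _ hv
      obtain ⟨s', hex, h'⟩ := exec_testBody g h₁.1 h₂ hv
      have hfr : ∀ a, a ≠ 7 → a ≠ 9 → s' a = s a := fun a h7 h9 =>
        hex.frame (ok_testBody g) (by simp [h7, h9])
      refine ⟨s', hex, h₁.congr fun a ha => hfr a (by omega) (by omega), fun l => ?_, ?_⟩
      · rw [hfr _ (by unfold reg; omega) (by unfold reg; omega), h₂]
      · rw [h', h₃]
        simp [or_imp, forall_and])
    s₁ ⟨h₁, hu₁, by simp [hs₁, Memory.write_same]⟩ h₁.1.size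
  have hall : s₂ 7 0 ≠ 0 ↔ ∀ v, PassesAt F u v g := by
    rw [h7]
    exact ⟨fun h v => h v (mem_tuples n K v), fun h v _ => h v⟩
  have hw : ∀ l : Fin K, (regExpr l).eval s₂ = u l := fun l => by
    simpa [regExpr, Expr.eval] using hu₂ l
  by_cases hp : ∀ v, PassesAt F u v g
  · obtain ⟨s₃, hex₃, ho₃⟩ := exec_emit (linesExpr regExpr [sparse g]) (fun e he => by
      refine ⟨fun h => ?_, fun h => ?_, fun h => ?_⟩ <;> obtain ⟨l, hl⟩ := uses_linesExpr he h
      · exact uses_regExpr l _ hl (Or.inl rfl)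
      · exact uses_regExpr l _ hl (Or.inr (Or.inl rfl))
      · exact uses_regExpr l _ hl (Or.inr (Or.inr (Or.inl rfl)))) s₂ o h₂.2
    rw [eval_linesExpr hw] at ho₃
    have hfr : ∀ a, a ≠ 1 → a ≠ 3 → a ≠ 9 → s₃ a = s₂ a := fun a h1 h3 h9 =>
      hex₃.frame (A := {1, 3, 9}) (ok_emit (by simp) (by simp) (by simp) _) (by simp [h1, h3, h9])
    refine ⟨s₃, hex₁.seq (hex₂.seq (Exec.ite_true (hall.2 hp) hex₃)), ?_, ?_⟩
    · exact h₂.1.congr (hfr 2 (by norm_num) (by norm_num) (by norm_num))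
        (hfr 4 (by norm_num) (by norm_num) (by norm_num)) fun a b =>
          hfr _ (by unfold factArr; omega) (by unfold factArr; omega) (by unfold factArr; omega)
    · simpa [selected, hp] using ho₃
  · have h7 : (Expr.read 7 (.const 0)).eval s₂ = 0 := not_not.1 fun h => hp (hall.1 h)
    refine ⟨s₂.write 9 0 0,
      (hex₁.seq (hex₂.seq (Exec.ite_false h7 (Exec.assign _ _ _ _)))).mono ?_, ?_⟩
    · unfold selectCost
      omega
    · have := h₂.congr (s' := s₂.write 9 0 0) fun a ha => Memory.write_of_ne _ _ _ (by omega)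
      simpa [selected, hp, encodeLines] using this

variable (D) in
/-- Treat a list of candidates. -/
noncomputable def selectAll : List (MvPolynomial (Fin K) ℚ) → Prog
  | [] => skip
  | g :: L => .seq (select D g) (selectAll L)

variable (D n) in
/-- Running time of `selectAll`. -/
noncomputable def selectAllCost : List (MvPolynomial (Fin K) ℚ) → ℕ
  | [] => 1
  | g :: L => selectCost D n g + selectAllCost L

theorem ok_selectAll : ∀ L : List (MvPolynomial (Fin K) ℚ), (selectAll D L).Ok (selectArrays K)
  | [] => ok_skip (Or.inl (by simp))
  | g :: L => ⟨ok_select g, ok_selectAll L⟩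

theorem exec_selectAll {F : Fin n → Fin n → D → D → Prop} {u : Fin K → Fin n} :
    ∀ (L : List (MvPolynomial (Fin K) ℚ)) (o : List ℕ) (s : Memory), TableOut F o s →
      (∀ l : Fin K, s (reg l) 0 = u l) →
      ∃ s', Exec (selectAll D L) s s' (selectAllCost D n L) ∧
        TableOut F (o ++ encodeLines (selected F u L)) s' := by
  intro L
  induction L with
  | nil =>
    intro o s h _
    refine ⟨_, Exec.assign _ _ _ _, ?_⟩
    simpa [selected, encodeLines] using
      h.congr fun a ha => Memory.write_of_ne _ _ _ (by omega)
  | cons g L ih =>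
    intro o s h hu
    obtain ⟨s₁, hex₁, h₁⟩ := exec_select g h hu
    obtain ⟨s₂, hex₂, h₂⟩ := ih _ s₁ h₁ fun l => by
      rw [hex₁.frame (ok_select g) (reg_notMem_selectArrays l), hu]
    refine ⟨s₂, hex₁.seq hex₂, ?_⟩
    have : selected F u (g :: L) = selected F u [g] ++ selected F u L := by
      rw [selected, selected, selected, ← List.map_append, ← List.filter_append]
      rfl
    rw [this]
    simpa [encodeLines] using h₂

variable (D K) in
/-- Print the Gröbner basis. -/
noncomputable def printBasis [NeZero K] : Prog :=
  forTuples 0 K (branchAll (patExpr (D := D) (regExpr (N := K))) fun β => selectAll D (cand β))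

variable (D K) in
/-- Running time of the body of `printBasis`. -/
noncomputable def printBodyCost [NeZero K] (n : ℕ) : ℕ :=
  (∑ β : Set (PatIdx D K), selectAllCost D n (cand β)) + Fintype.card (PatIdx D K)

/-- The printed basis. -/
noncomputable def basis [NeZero K] (F : Fin n → Fin n → D → D → Prop) : List (SparsePoly n) :=
  (tuples n K).flatMap fun u => selected F u (cand (pat F u))

theorem ok_printBasis [NeZero K] : (printBasis D K).Ok Set.univ :=
  ok_forTuples (ok_branchAll _ _ fun _ => (ok_selectAll _).mono (Set.subset_univ _)) _ _
    fun _ _ => trivial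

theorem exec_printBasis [NeZero K] {F : Fin n → Fin n → D → D → Prop} {o : List ℕ} {s : Memory}
    (h : TableOut F o s) :
    ∃ s', Exec (printBasis D K) s s' (tuplesCost n (printBodyCost D K n) K) ∧
      TableOut F (o ++ encodeLines (basis (K := K) F)) s' := by
  exact exec_forTuples (n := n) (T := printBodyCost D K n) (A := selectArrays K)
    (ok_branchAll _ _ fun _ => ok_selectAll _)
    (by
      rintro (h | ⟨j, -, -, h⟩)
      · norm_num at h
      · unfold reg at h
        omega)
    K 0 (fun j _ hj => reg_notMem_selectArrays ⟨j, by omega⟩)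
    (fun L s => TableOut F (o ++ encodeLines (L.flatMap fun u => selected F u (cand (pat F u)))) s)
    (fun L s s' hs h => h.congr fun a ha => hs a (notMem_regsFrom (ha.imp_left (by omega))))
    (by
      intro L u s h _ hu
      have hu' : ∀ l : Fin K, s (reg l) 0 = u l := by simpa using hu
      have hw : ∀ l : Fin K, (regExpr l).eval s = u l := fun l => by
        simpa [regExpr, Expr.eval] using hu' l
      obtain ⟨s', hex, h'⟩ := exec_selectAll (cand (pat F u)) _ s h hu'
      refine ⟨s', (exec_branchAll _ _ (mem_pat_iff hw h.1) hex).mono ?_, ?_⟩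
      · exact Nat.add_le_add_right (Finset.single_le_sum
          (f := fun β : Set (PatIdx D K) => selectAllCost D n (cand β))
          (fun _ _ => Nat.zero_le _) (Finset.mem_univ _)) _
      · simpa [encodeLines] using h')
    s (by simpa [encodeLines] using h) h.1.size

theorem polyBdd_selectAllCost (L : List (MvPolynomial (Fin K) ℚ)) :
    PolyBdd fun n => selectAllCost D n L := by
  induction L with
  | nil => exact .const 1
  | cons g L ih =>
    exact ((PolyBdd.const 1).add (((PolyBdd.const _).tuplesCost K).add (.const _))).add ih

theorem polyBdd_printBasis [NeZero K] :
    PolyBdd fun n => tuplesCost n (printBodyCost D K n) K :=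
  ((PolyBdd.sum _ fun _ => polyBdd_selectAllCost _).add (.const _)).tuplesCost K

end Selection

/-! ### The algorithm -/

section Main

variable {D : Finset ℚ} {Γ : ConstraintLanguage D} {K n : ℕ}

/-- The constant `1` has the least leading monomial, which divides everything. This case settles
instances with an empty relation. -/
theorem isReducedIn_top_iff {g : MvPolynomial (Fin n) ℚ} :
    IsReducedIn ((solIdeal (∅ : Set (Fin n → D))).restrictScalars ℚ) g ↔ g = 1 := by
  have hmem : ∀ h, h ∈ (solIdeal (∅ : Set (Fin n → D))).restrictScalars ℚ := fun h =>
    mem_solIdeal.2 (by simp)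
  have hlm : lm (1 : MvPolynomial (Fin n) ℚ) = 0 := MonomialOrder.degLex.degree_one
  constructor
  · intro hg
    have key := fun α hα => hg.2.2 1 (hmem 1) one_ne_zero α hα (hlm ▸ zero_le)
    have h0 : lm g = 0 := by
      have := key (lm g) (mem_support_iff.2 (by rw [hg.2.1]; exact one_ne_zero))
      rw [← this.2, hlm]
    ext α
    rw [coeff_one]
    split_ifs with h
    · rw [← h, ← h0, hg.2.1]
    · by_contra hα
      exact h ((key α (mem_support_iff.2 hα)).1.trans h0).symm
  · rintro rfl
    refine ⟨hmem 1, by rw [hlm, coeff_zero_one], fun h _ _ α hα hle => ?_⟩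
    have h0 : α = 0 := by
      by_contra hne
      rw [mem_support_iff, coeff_one, if_neg (Ne.symm hne)] at hα
      exact hα rfl
    subst h0
    exact ⟨hlm.symm, by rw [hlm]; exact le_antisymm hle (zero_le)⟩

theorem not_isReducedIn_of_isEmpty {S : Set (Fin 0 → D)} (hS : S.Nonempty)
    {g : MvPolynomial (Fin 0) ℚ} : ¬ IsReducedIn ((solIdeal S).restrictScalars ℚ) g := by
  intro hg
  obtain ⟨φ, hφ⟩ := hS
  have h := mem_solIdeal.1 hg.1 φ hφ
  rw [eq_C_of_isEmpty g, eval_C] at h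
  have := hg.2.1
  rw [Subsingleton.elim (lm g) 0, h] at this
  exact zero_ne_one this

/-- The polynomials printed are those of the reduced Gröbner basis. -/
theorem exists_mem_basis_iff [NeZero K] {F : Fin n → Fin n → D → D → Prop}
    {S : Set (Fin n → D)}
    (hS : ∀ (N : ℕ) [NeZero N] (w : Fin N → Fin n), (fun φ => φ ∘ w) '' S = localSols F w)
    (hK : ∀ g, IsReducedIn ((solIdeal S).restrictScalars ℚ) g → g.vars.card ≤ K)
    (h0 : n = 0 → S.Nonempty) (g : MvPolynomial (Fin n) ℚ) :
    (∃ p ∈ basis (K := K) F, g = p.toPoly) ↔ IsReducedIn ((solIdeal S).restrictScalars ℚ) g := by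
  have : NeZero (K + K) := ⟨by have := NeZero.ne K; omega⟩
  have hreal : ∀ (N : ℕ) [NeZero N] (w : Fin N → Fin n),
      Realizes (patOrd (pat F w)) (patSols (pat F w)) S w := fun N _ w =>
    ⟨fun _ _ => Iff.rfl, by rw [patSols_pat, hS]⟩
  have hpass : ∀ (u : Fin K → Fin n) (g₀ : MvPolynomial (Fin K) ℚ),
      (∀ v, PassesAt F u v g₀) ↔ IsReducedIn ((solIdeal S).restrictScalars ℚ) (rename u g₀) := by
    intro u g₀
    rw [isReducedIn_iff_forall hK]
    refine forall_congr' fun v => ?_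
    rw [PassesAt, (hreal _ (Fin.append u v)).locallyReduced_iff, rename_rename]
    have : (Fin.append u v ∘ Fin.castAdd K : Fin K → Fin n) = u := by
      funext l
      simp
    rw [this]
  constructor
  · rintro ⟨p, hp, rfl⟩
    obtain ⟨u, -, hp⟩ := List.mem_flatMap.1 hp
    obtain ⟨g₀, hg₀, rfl⟩ := List.mem_map.1 hp
    rw [SparsePoly.toPoly_ren, toPoly_sparse, ← hpass]
    simpa using (List.mem_filter.1 hg₀).2
  · intro hg
    rcases Nat.eq_zero_or_pos n with rfl | hn
    -- Without variables there are no tuples and nothing is printed; this is right because the ideal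
    -- of a nonempty solution set is then zero.
    · exact absurd hg (not_isReducedIn_of_isEmpty (h0 rfl))
    · obtain ⟨u, hu⟩ := exists_tuple_of_card_le (hK g hg) (fun _ => ⟨0, hn⟩)
      obtain ⟨g₀, hg₀, rfl⟩ := exists_mem_cand (hreal K u) hg hu
      refine ⟨(sparse g₀).ren u, List.mem_flatMap.2 ⟨u, mem_tuples n K u, List.mem_map.2
        ⟨g₀, List.mem_filter.2 ⟨hg₀, ?_⟩, rfl⟩⟩, by rw [SparsePoly.toPoly_ren, toPoly_sparse]⟩
      simpa using (hpass u g₀).2 hg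

theorem toPoly_mem_of_mem_basis [NeZero K] {F : Fin n → Fin n → D → D → Prop}
    {L : List (MvPolynomial (Fin n) ℚ)}
    (h : ∀ u : Fin K → Fin n, ∀ g ∈ cand (pat F u), rename u g ∈ L) :
    ∀ p ∈ basis (K := K) F, p.toPoly ∈ L := by
  intro p hp
  obtain ⟨u, -, hp⟩ := List.mem_flatMap.1 hp
  obtain ⟨g₀, hg₀, rfl⟩ := List.mem_map.1 hp
  rw [SparsePoly.toPoly_ren, toPoly_sparse]
  exact h u g₀ (List.mem_filter.1 hg₀).1

theorem CSPInstance.eval_constraintPolys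
    {f : (i : Fin Γ.size) → MvPolynomial (Fin (Γ.arity i)) ℚ} (hf : DefinesRelations Γ f)
    {𝒞 : CSPInstance Γ n} {φ : Fin n → D} (hφ : φ ∈ 𝒞.solSet) :
    ∀ p ∈ 𝒞.constraintPolys f, eval (toPt φ) p = 0 := by
  rintro _ ⟨c, hc, rfl⟩
  rw [eval_rename]
  exact (hf c.rel (fun j => φ (c.scope j))).2 (hφ c hc)

theorem CSPInstance.solSet_nonempty_of_isEmpty {𝒞 : CSPInstance Γ 0}
    (h : ∀ c ∈ 𝒞.constraints, (Γ.rel c.rel).Nonempty) : 𝒞.solSet.Nonempty := by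
  refine ⟨Fin.elim0, fun c hc => ?_⟩
  obtain ⟨t, ht⟩ := h c hc
  convert ht using 1
  funext j
  exact (c.scope j).elim0

/-- Print the unit polynomial. -/
noncomputable def printOne : Prog := emit (linesExpr (N := 0) (fun l => l.elim0) [sparse 1])

variable (K) in
/-- The program. -/
noncomputable def mainProg [NeZero K] (ℓ : (i : Fin Γ.size) → List (SparsePoly (Γ.arity i))) :
    Prog :=
  .seq start (.seq (parse ℓ) (.seq (saturate D K) (.seq (pass D K false)
    (.seq (emit [.const 0]) (.ite (.read 6 (.const 0)) printOne (printBasis D K))))))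

variable (K) in
/-- The running time of the program. -/
noncomputable def mainCost [NeZero K] (ℓ : (i : Fin Γ.size) → List (SparsePoly (Γ.arity i)))
    (n : ℕ) : ℕ :=
  n * 3 + 4 + ((∑ r, n ^ Γ.arity r) * (parseBodyCost ℓ + 1) + 1 +
    (tuplesCost n ((D.card ^ 2 + 1) * tuplesCost n (passBodyCost D K true) K + 1) 2 +
      (tuplesCost n (passBodyCost D K false) K +
        (3 + (2 * (linesExpr (N := 0) (fun l => l.elim0) [sparse 1]).length + 1 +
          tuplesCost n (printBodyCost D K n) K + 1)))))

theorem polyBdd_mainCost [NeZero K] (ℓ : (i : Fin Γ.size) → List (SparsePoly (Γ.arity i))) :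
    PolyBdd (mainCost K ℓ) := by
  have hpass : ∀ b, PolyBdd fun n => tuplesCost n (passBodyCost D K b) K :=
    fun b => (PolyBdd.const _).tuplesCost K
  exact ((PolyBdd.id.mul (.const 3)).add (.const 4)).add
    ((((PolyBdd.sum _ fun r => PolyBdd.id.pow _).mul (.const _)).add (.const 1)).add
      (((((PolyBdd.const _).mul (hpass true)).add (.const 1)).tuplesCost 2).add
        ((hpass false).add ((PolyBdd.const 3).add
          (((PolyBdd.const _).add polyBdd_printBasis).add (.const 1))))))

theorem ok_saturate [NeZero K] : (saturate D K).Ok (passArrays K ∪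
    {a | ∃ j, K + K ≤ j ∧ j < K + K + 2 ∧ a = reg j}) :=
  ok_forTuples_range (ok_repeat_pass _) _ _

theorem ok_mainProg [NeZero K] (ℓ : (i : Fin Γ.size) → List (SparsePoly (Γ.arity i))) :
    (mainProg K ℓ).Ok Set.univ :=
  ⟨ok_start, ok_parse ℓ, ok_saturate.mono (Set.subset_univ _),
    (ok_pass false).mono (Set.subset_univ _),
    ok_emit (Set.mem_univ _) (Set.mem_univ _) (Set.mem_univ _) _,
    ok_emit (Set.mem_univ _) (Set.mem_univ _) (Set.mem_univ _) _, ok_printBasis⟩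

theorem exec_mainProg [NeZero K] (hK : D.card + 2 ≤ K) (hK3 : 3 ≤ K)
    {nabla : D → D → D → D} (hnabla : IsDualDiscriminator nabla)
    (hpol : IsPolymorphism Γ (fun v : Fin 3 → D => nabla (v 0) (v 1) (v 2)))
    {f : (i : Fin Γ.size) → MvPolynomial (Fin (Γ.arity i)) ℚ} (hf : DefinesRelations Γ f)
    {ℓ : (i : Fin Γ.size) → List (SparsePoly (Γ.arity i))} (hℓ : LangTemplate Γ f ℓ)
    (𝒞 : CSPInstance Γ n) :
    ∃ s', Exec (mainProg K ℓ) (initial 𝒞.encode) s' (mainCost K ℓ n) ∧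
      ∃ π G : List (SparsePoly n), OutIs s' (encodeLines π ++ [0] ++ encodeLines G) ∧
        PCList D (𝒞.constraintPolys f) (π.map SparsePoly.toPoly) ∧
        (∀ g ∈ G, g.toPoly ∈ π.map SparsePoly.toPoly) ∧
        IsReducedGrlexGroebnerBasis 𝒞.combinatorialIdeal {q | ∃ g ∈ G, q = g.toPoly} := by
  have henc : 𝒞.encode = n :: encodeList Constraint.code 𝒞.constraints := rfl
  obtain ⟨s₁, hex₁, hd₁, e0, e5, e6⟩ := exec_start (D := D) (𝒞.constraintPolys f)
    (encodeList Constraint.code 𝒞.constraints)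
  obtain ⟨s₂, hex₂, F₂, π₂, hd₂, -, hbase, hone, hne⟩ := exec_parse hℓ 𝒞.constraints [n] _ _ s₁
    hd₁ (fun c hc => ⟨c, hc, rfl⟩) e5 (by simp [e0, initial]) (by simp [e6])
  obtain ⟨s₃, hex₃, F, π₃, hd₃, hF, hπ₃, hsat⟩ := exec_saturate (K := K) hd₂
  obtain ⟨s₄, hex₄, π, hd₄, hπ, hcand⟩ := exec_pass_false (K := K) hd₃
  obtain ⟨s₅, hex₅, ho₅⟩ := exec_emit [.const 0] (by simp [Expr.Uses]) s₄ _ hd₄.out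
  have hfr₅ : ∀ a, a ≠ 1 → a ≠ 3 → a ≠ 9 → s₅ a = s₄ a := fun a h1 h3 h9 =>
    hex₅.frame (A := {1, 3, 9}) (ok_emit (by simp) (by simp) (by simp) _) (by simp [h1, h3, h9])
  have h6 : s₅ 6 0 = s₂ 6 0 := by
    rw [hfr₅ 6 (by norm_num) (by norm_num) (by norm_num),
      hex₄.frame (ok_pass false) (notMem_passArrays (by norm_num) (by norm_num) (by norm_num)),
      hex₃.frame ok_saturate]
    rintro (h | ⟨j, -, -, h⟩)
    · exact notMem_passArrays (by norm_num) (by norm_num) (by norm_num) h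
    · unfold reg at h
      omega
  have hex₂' := hex₂.mono (Nat.add_le_add_right (Nat.mul_le_mul_right _
    𝒞.length_constraints_le) 1)
  have hsound : ∀ φ ∈ 𝒞.solSet, ∀ i j, ¬ F i j (φ i) (φ j) := by
    intro φ hφ i j hFij
    have := hd₄.pc.eval_eq_zero (𝒞.eval_constraintPolys hf hφ) _ (hd₄.lines _ _ _ _ hFij)
    rw [eval_factPoly] at this
    exact this ⟨rfl, rfl⟩
  -- If no relation was empty, the saturated table describes all projections, even when the instance
  -- is unsatisfiable. Otherwise `1` has been derived, hence there is no solution and the basis is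
  -- `{1}`.
  by_cases hz : s₂ 6 0 = 0
  · have hTO : TableOut F (encodeLines π ++ [0]) s₅ := by
      refine ⟨hd₄.mem.congr (hfr₅ 2 (by norm_num) (by norm_num) (by norm_num))
        (hfr₅ 4 (by norm_num) (by norm_num) (by norm_num)) fun a b =>
          hfr₅ _ (by unfold factArr; omega) (by unfold factArr; omega)
            (by unfold factArr; omega), ?_⟩
      simpa [Expr.eval] using ho₅
    obtain ⟨s₆, hex₆, h₆⟩ := exec_printBasis (K := K) hTO
    have hzero : (Expr.read 6 (.const 0)).eval s₅ = 0 := h6.trans hz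
    refine ⟨s₆, (hex₁.seq (hex₂'.seq (hex₃.seq (hex₄.seq (hex₅.seq
      (Exec.ite_false hzero hex₆)))))).mono ?_, π, basis (K := K) F, h₆.2, hd₄.pc,
      toPoly_mem_of_mem_basis hcand, ?_⟩
    · simp only [mainCost, List.length_singleton]
      omega
    · rw [𝒞.combinatorialIdeal_eq]
      have hnonempty := (hne hz).2
      refine isReducedGrlexGroebnerBasis_of_forall _ _ ?_ (exists_mem_basis_iff ?_ ?_ ?_)
      · refine (List.finite_toSet ((basis (K := K) F).map SparsePoly.toPoly)).subset ?_
        rintro _ ⟨g, hg, rfl⟩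
        exact List.mem_map_of_mem hg
      · intro N _ w
        exact image_solSet_eq_localSols hK3 hsat hnabla.1 hpol hnonempty
          (fun c hc j j' a b h => hF _ _ _ _ (hbase c hc j j' a b h)) hsound w
      · exact fun g hg => (hg.card_vars_le hnabla (𝒞.closedUnder_solSet hpol)).trans hK
      · rintro rfl
        exact CSPInstance.solSet_nonempty_of_isEmpty hnonempty
  · have hπ1 : (1 : MvPolynomial (Fin n) ℚ) ∈ π.map SparsePoly.toPoly := by
      obtain ⟨p, hp, e⟩ := List.mem_map.1 (hone hz)
      exact List.mem_map.2 ⟨p, hπ (hπ₃ hp), e⟩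
    have hS : 𝒞.solSet = ∅ := by
      refine Set.eq_empty_iff_forall_notMem.2 fun φ hφ => ?_
      have := hd₄.pc.eval_eq_zero (𝒞.eval_constraintPolys hf hφ) _ hπ1
      rw [map_one] at this
      exact one_ne_zero this
    obtain ⟨s₆, hex₆, h₆⟩ := exec_emit (linesExpr (N := 0) (fun l => l.elim0) [sparse 1])
      (fun e he => by
        refine ⟨fun h => ?_, fun h => ?_, fun h => ?_⟩ <;>
          exact (uses_linesExpr he h).choose.elim0) s₅ _ ho₅
    rw [eval_linesExpr (w := fun l => l.elim0) (fun l => l.elim0)] at h₆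
    have hnz : (Expr.read 6 (.const 0)).eval s₅ ≠ 0 := fun h => hz (h6.symm.trans h)
    have htp : ((sparse (1 : MvPolynomial (Fin 0) ℚ)).ren fun l => (l.elim0 : Fin n)).toPoly =
        1 := by
      rw [SparsePoly.toPoly_ren, toPoly_sparse, map_one]
    refine ⟨s₆, (hex₁.seq (hex₂'.seq (hex₃.seq (hex₄.seq (hex₅.seq
      (Exec.ite_true hnz hex₆)))))).mono ?_, π, [(sparse 1).ren fun l => (l.elim0 : Fin n)], ?_,
      hd₄.pc, ?_, ?_⟩
    · simp only [mainCost, List.length_singleton]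
      omega
    · simpa [Expr.eval] using h₆
    · simpa [htp] using hπ1
    · rw [𝒞.combinatorialIdeal_eq, hS]
      refine isReducedGrlexGroebnerBasis_of_forall _ _ ?_ fun g => ?_
      · simp [htp]
      · rw [isReducedIn_top_iff]
        simp [htp]

end Main

theorem mainTheorem8 (D : Finset ℚ) (Γ : ConstraintLanguage D)
    (nabla : D → D → D → D) (hnabla : IsDualDiscriminator nabla)
    (hpol : IsPolymorphism Γ (fun v : Fin 3 → D => nabla (v 0) (v 1) (v 2)))
    (f : (i : Fin Γ.size) → MvPolynomial (Fin (Γ.arity i)) ℚ) (hf : DefinesRelations Γ f) :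
    ∃ (p : RAM.Prog) (c : ℕ), ∀ (n : ℕ) (𝒞 : CSPInstance Γ n),
      PCComputesReducedGroebnerBasis f p 𝒞 (n ^ c + c) := by
  obtain ⟨ℓ, hℓ⟩ := exists_langTemplate hf
  -- The length `|D| + 3` is at least `|D| + 2`, for the variable bound, and at least `3`, for
  -- triangles. The added `1` accounts for the final end marker.
  obtain ⟨c, hc⟩ := ((polyBdd_mainCost (K := D.card + 3) ℓ).add (.const 1)).exists_pow_bound
  refine ⟨mainProg (D.card + 3) ℓ, c, fun n 𝒞 => ?_⟩
  obtain ⟨s', ⟨t, ht, hrun⟩, π, G, hout, hpc, hG, hgb⟩ :=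
    exec_mainProg (K := D.card + 3) (by omega) (by omega) hnabla hpol hf hℓ 𝒞
  have hT := hc n
  have hsplit : encodePolys π ++ encodePolys G = encodeLines π ++ [0] ++ encodeLines G ++ [0] := by
    simp [encodePolys, encodeList, encodeLines]
  have hlen : (encodeLines π ++ [0] ++ encodeLines G).length ≤ t := by
    rw [← hout.2]
    simpa [initial] using hrun.pointer_le (ok_mainProg ℓ)
  refine ⟨π, G, ⟨s', t, hrun, by omega, fun i => ?_⟩, ?_, hpc.isPCDerivation, hG, hgb⟩
  -- The end marker `0` of the second list need not be written, since unwritten output cells are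
  -- zero.
  · rw [hout.1, hsplit]
    rcases Nat.lt_or_ge i (encodeLines π ++ [0] ++ encodeLines G).length with h | h
    · rw [List.getD_append _ _ _ _ h]
    · rw [List.getD_eq_default _ _ h, List.getD_append_right _ _ _ _ h]
      cases i - (encodeLines π ++ [0] ++ encodeLines G).length <;> simp
  · rw [hsplit, List.length_append, List.length_singleton]
    omega
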